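/- **Setting.** Let $r\ge 3$, let $X$ be a $C^r$ Riemannian manifold modelled on a Hilbert space, with a $C^{r-1}$ metric inducing the topology of the tangent spaces and with its Riemannian distance $d$, and let $S:X\to X$ be $C^1$ and injective. Let $M'\subset X$ be a connected embedded $C^r$ submanifold of finite dimension $m$ with compact closure, carrying the induced metric, and let $\overline M\subset M'$ be a compact connected $C^r$ submanifold with (possibly empty) boundary, of the same dimension $m$. Assume that $S$ has an inverse $S^{-1}:M'\to \overline M$ on $M'$ which is $C^1$ along $M'$; in particular $S^{-1}(\overline M)\subset\overline M$. Let $N$ be a $C^{r-1}$ bundle over $M'$ with $TX|_{M'}=TM'\oplus N$ (for instance the normal bundle), and let $Q:TX|_{M'}\to N$ be the projection along $TM'$. For $p\in M'$ put $$A(p)=D(S^{-1}|_{M'})(p):T_pM'\to T_{S^{-1}(p)}M',\qquad B(p)=Q\circ DS(S^{-1}(p))|_N:N_{S^{-1}(p)}\to N_p .$$ Let $\mathbb P$ be an $m$-dimensional Euclidean space, $\mathbb Q$ a Hilbert space, and $J\ge 6$. Let $\sigma_1,\dots,\sigma_s$ be $C^r$ charts of $M'$ with values in $\mathbb P$ whose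 images contain the ball $\mathcal B_J(0)$, put $U_i^j=\sigma_i^{-1}(\mathcal B_j(0))$, and assume that $U_1^1,\dots,U_s^1$ cover $\overline M$. Over each $U_i^J$ let $N$ be trivialized, in class $C^{r-1}$, by linear isometries $\psi_{i,p}:N_p\to\mathbb Q$. Let $h$ be a $C^1$ tubular neighbourhood: for some $\rho>0$, $h$ is a $C^1$ diffeomorphism from $\{(p,v): p\in\bigcup_iU_i^J,\ v\in N_p,\ \|v\|<\rho\}$ onto an open subset of $X$, with $h(p,0)=p$ and $\frac{d}{dt}\big|_{t=0}h(p,tv)=v$ for $v \in N_p$ (for instance $h=\exp|_N$). Put $U=\bigcup_iU_i^{J-3}$ and $K=\bigcup_i\overline{U_i^{J-1}}$. For a section $u$ of $N$ over $U$ let $u_i(x)=\psi_{i,p}(u(p))$, $p=\sigma_i^{-1}(x)$, $x\in\mathcal B_{J-3}(0)$, be its local representatives. Let $\mathcal S^\varepsilon_\delta$ be the set of sections $u$ over $U$ with $\|u(p)\|<\varepsilon$ for all $p\in U$ and with all $u_i$ Lipschitz with constant $\delta$. Write $\operatorname{gr}_u=\{h(p,u(p)):p\in U\}$. Say that $u\in\mathcal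 S^\varepsilon_\delta$ is *fixed by* $T:X\to X$ if $$T(\operatorname{gr}_u)\cap h(\{(p,v):p\in U,\ v\in N_p,\ \|v\|<\varepsilon\})=\operatorname{gr}_u .$$ Let $V\supset M'$ be open in $X$, and fix finitely many $C^r$ charts of $X$ whose domains cover $M'$. A map $T:X\to X$ that is $C^1$ on $V$ is *$\nu$-$C^1$ close to $S$ on $V$* if for all $x\in V$ one has $d(S(x),T(x))\le\nu$ and $\|D(\chi\circ S)(x)-D(\chi\circ T)(x)\|\le\nu$ for every chart $\chi$ of the family whose domain contains both $S(x)$ and $T(x)$. **Theorem.** Assume that for some $\vartheta_1\in(0,1)$ and some $C\ge1$ with $\|D\sigma_i\|\le C$ on $\overline{U_i^{J-1}}$ and $\|D\sigma_i^{-1}\|\le C$ on $\overline{\mathcal B_{J-1}(0)}$ for all $i$: * (Stability) $C^2\|B(p)\|<\vartheta_1$ for all $p\in K$; * (Smoothing) $C^4\|A(p)\|\,\|B(p)\|<\vartheta_1$ for all $p\in K$. Then there is $\delta_0>0$ such that for every $\delta\in(0,\delta_0)$ there is $\varepsilon_0>0$ such that for every $\varepsilon\in(0,\varepsilon_0)$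 the following hold. 1. There is $\nu_0>0$ such that for all $\nu\in(0,\nu_0)$, every $S^\nu:X\to X$ that is $C^1$ on $V$ and $\nu$-$C^1$ close to $S$ on $V$ fixes exactly one section $u^\nu\in\mathcal S^\varepsilon_\delta$. All local representatives of $u^\nu$ are $C^1$, and $p\mapsto h(p,u^\nu(p))$ is a $C^1$ embedding of $U$ into $X$ (a $C^1$ immersion that is a homeomorphism onto its image). The manifold $\overline{M_\nu}=\{h(p,u^\nu(p)):p\in\overline M\}$ is therefore $C^1$. It is negatively invariant under $S^\nu$: for each $z\in\overline{M_\nu}$ there is exactly one $w\in\overline{M_\nu}$ with $S^\nu(w)=z$. 2. $\overline{M_\nu}\to\overline M$ in $C^1$ as $\nu\to0$: for every $\eta>0$ there is $\nu_1>0$ such that for all $\nu\in(0,\nu_1)$, every $S^\nu$ as in 1 and every section $u^\nu\in\mathcal S^\varepsilon_\delta$ fixed by $S^\nu$ one has $\|u^\nu_i(x)\|\le\eta$ and $\|Du^\nu_i(x)\|\le\eta$ for all $i$ and all $x\in\mathcal B_{J-3}(0)$. -/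

import Mathlib

open Set Topology
open scoped Manifold ContDiff Bundle

noncomputable section

section Setting

variable (E P F X M' : Type*)
  [NormedAddCommGroup E] [InnerProductSpace ℝ E]
  [NormedAddCommGroup P] [InnerProductSpace ℝ P]
  [NormedAddCommGroup F] [InnerProductSpace ℝ F]
  [EMetricSpace X] [ChartedSpace E X] [IsManifold 𝓘(ℝ, E) 1 X]
  [Bundle.RiemannianBundle (fun x : X => TangentSpace 𝓘(ℝ, E) x)]
  [TopologicalSpace M'] [ChartedSpace P M'] [IsManifold 𝓘(ℝ, P) 1 M']
  [Bundle.RiemannianBundle (fun p : M' => TangentSpace 𝓘(ℝ, P) p)]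

/-- `K` is an embedded `C^k` submanifold with (possibly empty) boundary of the boundaryless
manifold `M'`, of the same dimension as `M'`: near each of its points `K` is, in a suitable `C^k`
chart of `M'`, everything or a closed half space. -/
def IsDomainWithBoundary (P : Type*) {M' : Type*} [NormedAddCommGroup P] [InnerProductSpace ℝ P]
    [TopologicalSpace M'] [ChartedSpace P M'] (k : WithTop ℕ∞) (K : Set M') : Prop :=
  ∀ p ∈ K, ∃ φ ∈ IsManifold.maximalAtlas 𝓘(ℝ, P) k M', p ∈ φ.source ∧
    (φ.source ⊆ K ∨
      ∃ l : P →L[ℝ] ℝ, l ≠ 0 ∧ φ.source ∩ K = {q ∈ φ.source | 0 ≤ l (φ q)})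

/-- A `C^1` injective map `S` of the Riemannian manifold `X`, an embedded submanifold `M'` of `X`
(given by its inclusion `ι`, and carrying the induced Riemannian metric) with compact closure, and
a compact connected submanifold with boundary `Mbar ⊆ M'` of the same dimension. The inverse of `S`
is defined on `M'`, is `C^1` along `M'` and maps `M'` into `Mbar`; in particular `Mbar` is
negatively invariant. -/
structure NegInvariantManifold (n : WithTop ℕ∞) where
  /-- the map -/
  S : X → X
  contMDiff_S : ContMDiff 𝓘(ℝ, E) 𝓘(ℝ, E) 1 S
  injective_S : Function.Injective S
  /-- the inclusion of `M'` -/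
  ι : M' → X
  contMDiff_ι : ContMDiff 𝓘(ℝ, P) 𝓘(ℝ, E) (n + 1) ι
  isEmbedding_ι : IsEmbedding ι
  isometric_ι : ∀ (p : M') (v : TangentSpace 𝓘(ℝ, P) p),
    ‖mfderiv 𝓘(ℝ, P) 𝓘(ℝ, E) ι p v‖ = ‖v‖
  isCompact_closure : IsCompact (closure (range ι))
  /-- the negatively invariant compact manifold with boundary -/
  Mbar : Set M'
  isCompact_Mbar : IsCompact Mbar
  isConnected_Mbar : IsConnected Mbar
  domain_Mbar : IsDomainWithBoundary P (n + 1) Mbar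
  /-- the inverse of `S` on `M'` -/
  Sinv : M' → M'
  S_Sinv : ∀ p, S (ι (Sinv p)) = ι p
  contMDiff_Sinv : ContMDiff 𝓘(ℝ, P) 𝓘(ℝ, P) 1 Sinv
  Sinv_mem : ∀ p, Sinv p ∈ Mbar

variable {E P X M'} {n : WithTop ℕ∞}

/-- The differential `A p : T_p M' → T_{S⁻¹ p} M'` of the inverse of `S` along `M'`. -/
def NegInvariantManifold.A (D : NegInvariantManifold E P X M' n) (p : M') :
    TangentSpace 𝓘(ℝ, P) p →L[ℝ] TangentSpace 𝓘(ℝ, P) (D.Sinv p) :=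
  mfderiv 𝓘(ℝ, P) 𝓘(ℝ, P) D.Sinv p

/-- The map `p ↦ h (u p)` of `M'` into `X` defined by a section `u`. -/
def NegInvariantManifold.graph (D : NegInvariantManifold E P X M' n)
    (h : TangentBundle 𝓘(ℝ, E) X → X) (u : ∀ p : M', TangentSpace 𝓘(ℝ, E) (D.ι p)) (p : M') : X :=
  h ⟨D.ι p, u p⟩

/-- The normal bundle `N` of `M'` (a bundle complementary to `T M'` in `T X` along `M'`, for
instance the orthogonal complement), given by the projection `Q` of `T X` onto `N` along `T M'`;
nested coordinate balls `U i j` of `M'` covering `Mbar`; and trivializations of `N` over these,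
isometric on fibres and of class `C^n`. -/
structure NormalBundleCover (D : NegInvariantManifold E P X M' n) where
  /-- the projection onto the normal space; only its values at points of `M'` matter -/
  Q : ∀ x : X, TangentSpace 𝓘(ℝ, E) x →L[ℝ] TangentSpace 𝓘(ℝ, E) x
  Q_idem : ∀ (p : M') (v : TangentSpace 𝓘(ℝ, E) (D.ι p)), Q (D.ι p) (Q (D.ι p) v) = Q (D.ι p) v
  Q_eq_zero_iff : ∀ (p : M') (v : TangentSpace 𝓘(ℝ, E) (D.ι p)),
    Q (D.ι p) v = 0 ↔ ∃ w : TangentSpace 𝓘(ℝ, P) p, mfderiv 𝓘(ℝ, P) 𝓘(ℝ, E) D.ι p w = v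
  /-- number of charts -/
  s : ℕ
  /-- number of nested coverings -/
  J : ℕ
  six_le_J : 6 ≤ J
  /-- the charts of `M'` -/
  σ : Fin s → OpenPartialHomeomorph M' P
  σ_mem : ∀ i, σ i ∈ IsManifold.maximalAtlas 𝓘(ℝ, P) (n + 1) M'
  ball_subset : ∀ i, Metric.ball (0 : P) J ⊆ (σ i).target
  cover : ∀ p ∈ D.Mbar, ∃ i, p ∈ (σ i).symm '' Metric.ball (0 : P) 1
  /-- the trivialization `N_p → F` -/
  ψ : Fin s → ∀ p : M', TangentSpace 𝓘(ℝ, E) (D.ι p) →L[ℝ] F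
  /-- its inverse -/
  e : Fin s → ∀ p : M', F →L[ℝ] TangentSpace 𝓘(ℝ, E) (D.ι p)
  e_mem : ∀ i, ∀ x ∈ Metric.ball (0 : P) J, ∀ y,
    Q (D.ι ((σ i).symm x)) (e i ((σ i).symm x) y) = e i ((σ i).symm x) y
  norm_e : ∀ i, ∀ x ∈ Metric.ball (0 : P) J, ∀ y, ‖e i ((σ i).symm x) y‖ = ‖y‖
  ψ_e : ∀ i, ∀ x ∈ Metric.ball (0 : P) J, ∀ y,
    ψ i ((σ i).symm x) (e i ((σ i).symm x) y) = y
  e_ψ : ∀ i, ∀ x ∈ Metric.ball (0 : P) J, ∀ v, Q (D.ι ((σ i).symm x)) v = v →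
    e i ((σ i).symm x) (ψ i ((σ i).symm x) v) = v
  contMDiffOn_e : ∀ i, ContMDiffOn 𝓘(ℝ, P × F) 𝓘(ℝ, E).tangent n
    (fun z : P × F => (⟨D.ι ((σ i).symm z.1), e i ((σ i).symm z.1) z.2⟩ : TangentBundle 𝓘(ℝ, E) X))
    (Metric.ball (0 : P) J ×ˢ univ)

namespace NormalBundleCover

variable {F} {D : NegInvariantManifold E P X M' n} (N : NormalBundleCover F D)

/-- The coordinate patch of index `i` and radius `r` in `M'`. -/
def U (i : Fin N.s) (r : ℝ) : Set M' := (N.σ i).symm '' Metric.ball (0 : P) r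

/-- The neighbourhood of `Mbar` in `M'` over which sections of the normal bundle are taken. -/
def base : Set M' := ⋃ i, N.U i ((N.J : ℝ) - 3)

/-- The union of the closures of the patches of radius `J - 1`. -/
def core : Set M' := ⋃ i, (N.σ i).symm '' Metric.closedBall (0 : P) ((N.J : ℝ) - 1)

/-- The fibre of the normal bundle. -/
def fiber (x : X) : Submodule ℝ (TangentSpace 𝓘(ℝ, E) x) := (N.Q x).range

/-- The vectors of length `< ε` in the normal bundle over `W ⊆ M'`. -/
def disc (ε : ℝ) (W : Set M') : Set (TangentBundle 𝓘(ℝ, E) X) :=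
  {z | ∃ p ∈ W, ∃ v : TangentSpace 𝓘(ℝ, E) (D.ι p), v ∈ N.fiber (D.ι p) ∧ ‖v‖ < ε ∧ z = ⟨D.ι p, v⟩}

/-- The normal differential `B p = Q ∘ DS (S⁻¹ p)` from `N_{S⁻¹ p}` to `N_p`, where
`p = S (S⁻¹ p)`. -/
def B (p : M') : N.fiber (D.ι (D.Sinv p)) →L[ℝ] TangentSpace 𝓘(ℝ, E) (D.S (D.ι (D.Sinv p))) :=
  ((N.Q (D.S (D.ι (D.Sinv p)))).comp (mfderiv 𝓘(ℝ, E) 𝓘(ℝ, E) D.S (D.ι (D.Sinv p)))).comp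
    (N.fiber (D.ι (D.Sinv p))).subtypeL

/-- `C` bounds the differentials of the charts and of their inverses. -/
def ChartBound (C : ℝ) : Prop :=
  ∀ i, ∀ x ∈ Metric.closedBall (0 : P) ((N.J : ℝ) - 1),
    ‖mfderiv 𝓘(ℝ, P) 𝓘(ℝ, P) (N.σ i) ((N.σ i).symm x)‖ ≤ C ∧
    ‖mfderiv 𝓘(ℝ, P) 𝓘(ℝ, P) (N.σ i).symm x‖ ≤ C

/-- The stability condition. -/
def Stability (C ϑ : ℝ) : Prop := ∀ p ∈ N.core, C ^ 2 * ‖N.B p‖ < ϑ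

/-- The smoothing condition. -/
def Smoothing (C ϑ : ℝ) : Prop := ∀ p ∈ N.core, C ^ 4 * ‖D.A p‖ * ‖N.B p‖ < ϑ

/-- `h` is a `C^1` tubular neighbourhood: a `C^1` diffeomorphism from the vectors of length `< ρ`
in the normal bundle over the patches of radius `J` onto an open subset of `X`, which is the
inclusion on the zero section and whose differential at the zero section is the identity on normal
vectors (as for the exponential map). Being a local `C^1` diffeomorphism is expressed in the
bundle charts. -/
structure IsTubular (ρ : ℝ) (h : TangentBundle 𝓘(ℝ, E) X → X) : Prop where
  pos : 0 < ρ
  zero : ∀ i, ∀ p ∈ N.U i N.J, h ⟨D.ι p, 0⟩ = D.ι p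
  injOn : InjOn h (N.disc ρ (⋃ i, N.U i N.J))
  contMDiffOn : ∀ i, ContMDiffOn 𝓘(ℝ, P × F) 𝓘(ℝ, E) 1
    (fun z : P × F => h ⟨D.ι ((N.σ i).symm z.1), N.e i ((N.σ i).symm z.1) z.2⟩)
    (Metric.ball (0 : P) N.J ×ˢ Metric.ball (0 : F) ρ)
  invertible : ∀ i, ∀ z ∈ Metric.ball (0 : P) N.J ×ˢ Metric.ball (0 : F) ρ,
    (mfderiv 𝓘(ℝ, P × F) 𝓘(ℝ, E)
      (fun z : P × F => h ⟨D.ι ((N.σ i).symm z.1), N.e i ((N.σ i).symm z.1) z.2⟩) z).IsInvertible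
  normal : ∀ i, ∀ p ∈ N.U i N.J, ∀ v : TangentSpace 𝓘(ℝ, E) (D.ι p), v ∈ N.fiber (D.ι p) →
    (mfderiv 𝓘(ℝ, ℝ) 𝓘(ℝ, E) (fun t : ℝ => h ⟨D.ι p, t • v⟩) 0 (1 : ℝ) : E) = v

/-- The local representative `u_i` of a section `u`, a map from a ball of `P` to `F`. -/
def loc (u : ∀ p : M', TangentSpace 𝓘(ℝ, E) (D.ι p)) (i : Fin N.s) (x : P) : F :=
  N.ψ i ((N.σ i).symm x) (u ((N.σ i).symm x))

/-- The sections over `base` of the `ε`-disc bundle whose local representatives are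
`δ`-Lipschitz. -/
def LipSection (ε δ : ℝ) : Set (∀ p : M', TangentSpace 𝓘(ℝ, E) (D.ι p)) :=
  {u | (∀ p ∈ N.base, u p ∈ N.fiber (D.ι p) ∧ ‖u p‖ < ε) ∧
    ∀ i, ∀ x ∈ Metric.ball (0 : P) ((N.J : ℝ) - 3), ∀ x' ∈ Metric.ball (0 : P) ((N.J : ℝ) - 3),
      ‖N.loc u i x - N.loc u i x'‖ ≤ δ * ‖x - x'‖}

/-- The section `u` is a fixed point of the graph transform of `T`: the part over `base` of the
image of its graph under `T` is its graph. -/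
def IsFixedSection (h : TangentBundle 𝓘(ℝ, E) X → X) (ε : ℝ) (T : X → X)
    (u : ∀ p : M', TangentSpace 𝓘(ℝ, E) (D.ι p)) : Prop :=
  T '' (D.graph h u '' N.base) ∩ h '' N.disc ε N.base = D.graph h u '' N.base

end NormalBundleCover

/-- The differential at `x` of a map `f : X → X` read in a chart `φ` of the target. -/
def chartDiff (φ : OpenPartialHomeomorph X E) (f : X → X) (x : X) :
    TangentSpace 𝓘(ℝ, E) x →L[ℝ] E :=
  mfderiv 𝓘(ℝ, E) 𝓘(ℝ, E) (fun y => φ (f y)) x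

/-- `T` is `ν`-close to `S` on `V` in the `C^1` sense: the values are `ν`-close, and the
differentials, read in the charts of the target from the family `χ`, are `ν`-close. -/
def C1CloseOn {a : ℕ} (χ : Fin a → OpenPartialHomeomorph X E) (V : Set X) (ν : ℝ)
    (S T : X → X) : Prop :=
  ∀ x ∈ V, edist (S x) (T x) ≤ ENNReal.ofReal ν ∧
    ∀ b, S x ∈ (χ b).source → T x ∈ (χ b).source →
      ‖chartDiff (χ b) S x - chartDiff (χ b) T x‖ ≤ ν

end Setting

end

/-!
The invariant section is found by the graph transform. A map `T` that is `C^1` close to `S` sends the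
graph of a small section `u` of the normal bundle with small Lipschitz constant to a set which
contains the graph of another such section over the whole of `base`, because `S` maps
`S⁻¹ M' ⊆ Mbar` onto `M'`. The fixed sections of `T` are the sections that
are transformed into themselves (`isFixedSection_iff`).

In tubular coordinates the differential of `S` at a point of `M'` is block triangular, with the
coordinate representative of `A` as the inverse of its tangential block and one of `B` as its normal
block (`isDominatedBlock_fderiv_transition`). Stability makes the normal block a contraction of rate
`ϑ`; smoothing makes it dominate the inverse of the tangential block. For a map that differs from
such a linear map by a small Lipschitz error, linear estimates give that

* the image of a graph over a ball covers a neighbourhood of the image of the centre, and is smaller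
  than the graph (`GraphConstants.exists_preimage`);
* the distance of two graphs decreases by the factor `(1 + ϑ) / 2` (`GraphConstants.contraction`);
* the Lipschitz bound `δ` is preserved (`GraphConstants.lipschitz`).

Hence the iterates of the zero section converge to a section that is transformed into itself
(`exists_isGraphImage_self`), and it is unique (`IsGraphImage.eqOn`). In order to see that it is
`C^1`, no convergence of derivatives is used: instead, the *defect* of strict differentiability of
`u` at a point is the least Lipschitz constant near the point of the difference of `u` and a linear
map. It is at most `δ`, and the graph transform decreases the supremum of the defects by the factor
`(1 + ϑ) / 2` (`GraphConstants.defectLE_image`), so that it vanishes for the invariant section.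

The estimates are local; they are made uniform by compactness of the closed coordinate balls. For
this, closeness to `S` is expressed by a filter `perturbations` on the maps of `X`, for which
evaluation and differentiation are jointly continuous at `S`. The injectivity of `S` enters in
`exists_localization`: the points of a thin tube that are mapped near a point `p` of `M'` lie near
`S⁻¹ p`, so that a single coordinate system of the source suffices at each point of the target.

For the convergence as `ν → 0`, the invariant section for smaller constants `ε'` and `δ'` is an
invariant section for `ε` and `δ`, hence equal to the given one; so its size and its Lipschitz
constant are as small as desired if `T` is close to `S`.
-/

/-! ### Linear estimates for a dominated block map -/

section LinearEstimates

open Filter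

variable {P F : Type*} [NormedAddCommGroup P] [NormedSpace ℝ P]
  [NormedAddCommGroup F] [NormedSpace ℝ F]

/-- A linear map `L` of `P × F` that is block triangular, `L = (a⁻¹, *; 0, b)`, where the
contraction `b` in the direction of `F` dominates the expansion `a` of the inverse in the
direction of `P`. The numbers `θ` and `R` are the rate and a bound for all the entries. -/
structure IsDominatedBlock (θ R : ℝ) (L : P × F →L[ℝ] P × F) (a : P →L[ℝ] P) (b : F →L[ℝ] F) :
    Prop where
  apply_fst : ∀ ξ, L (a ξ, 0) = (ξ, 0)
  apply_snd : ∀ y, (L (0, y)).2 = b y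
  norm_le : ‖L‖ ≤ R
  norm_a_le : ‖a‖ ≤ R
  norm_b_le : ‖b‖ ≤ θ
  norm_mul_le : ‖a‖ * ‖b‖ ≤ θ

/-- The smallness relations between the rate `θ`, the bound `R`, the Lipschitz constant `δ` of the
sections, and the accuracy `c` to which a map is approximated by its linear part. The factors
`100 * R ^ 3` are generous: all error terms below are of the form `k * R ^ i * δ` or `k * R ^ i * c`
with `i ≤ 3` and `k` small, and have to be absorbed in the gap between `θ` and `(1 + θ) / 2`. -/
structure GraphConstants (θ R δ c : ℝ) : Prop where
  rate_pos : 0 < θ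
  rate_lt : θ < 1
  one_le : 1 ≤ R
  lip_pos : 0 < δ
  acc_pos : 0 < c
  lip_le : 100 * R ^ 3 * δ ≤ 1 - θ
  acc_le : 100 * R ^ 3 * c ≤ δ * (1 - θ)

namespace GraphConstants

variable {θ R δ c : ℝ}

lemma bounds (h : GraphConstants θ R δ c) :
    100 * δ ≤ 1 - θ ∧ 100 * (R * δ) ≤ 1 - θ ∧ 100 * (R ^ 2 * δ) ≤ 1 - θ ∧
    100 * c ≤ δ * (1 - θ) ∧ 100 * (R * c) ≤ δ * (1 - θ) ∧ 100 * (R ^ 2 * c) ≤ δ * (1 - θ) ∧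
    0 < R := by
  have hR := h.one_le
  have h1 : 1 ≤ R ^ 3 := one_le_pow₀ hR
  have h2 : R ≤ R ^ 3 := le_self_pow₀ hR (by norm_num)
  have h3 : R ^ 2 ≤ R ^ 3 := pow_le_pow_right₀ hR (by norm_num)
  have hδ := h.lip_pos.le
  have hc := h.acc_pos.le
  have e1 := h.lip_le
  have e2 := h.acc_le
  refine ⟨?_, ?_, ?_, ?_, ?_, ?_, by linarith⟩
  · nlinarith [mul_le_mul_of_nonneg_right h1 hδ]
  · nlinarith [mul_le_mul_of_nonneg_right h2 hδ]
  · nlinarith [mul_le_mul_of_nonneg_right h3 hδ]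
  · nlinarith [mul_le_mul_of_nonneg_right h1 hc]
  · nlinarith [mul_le_mul_of_nonneg_right h2 hc]
  · nlinarith [mul_le_mul_of_nonneg_right h3 hc]

end GraphConstants

namespace IsDominatedBlock

variable {θ R c : ℝ} {L : P × F →L[ℝ] P × F} {a : P →L[ℝ] P} {b : F →L[ℝ] F}

lemma injective (h : IsDominatedBlock θ R L a b) : Function.Injective a := by
  intro x y hxy
  have h1 := h.apply_fst x
  rw [hxy, h.apply_fst y] at h1
  exact (Prod.ext_iff.1 h1).1.symm

lemma surjective [FiniteDimensional ℝ P] (h : IsDominatedBlock θ R L a b) :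
    Function.Surjective a :=
  (LinearMap.injective_iff_surjective (f := (a : P →ₗ[ℝ] P))).1 h.injective

lemma norm_fst_le [FiniteDimensional ℝ P] (h : IsDominatedBlock θ R L a b) (x : P) (y : F) :
    ‖x‖ ≤ ‖a‖ * (‖(L (x, y)).1‖ + R * ‖y‖) := by
  obtain ⟨ξ, rfl⟩ := h.surjective x
  have h1 : L (a ξ, y) = (ξ, 0) + L (0, y) := by
    rw [← h.apply_fst ξ, ← map_add]; simp
  have h2 : ξ = (L (a ξ, y)).1 - (L (0, y)).1 := by rw [h1]; simp
  have h3 : ‖(L (0, y)).1‖ ≤ R * ‖y‖ := by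
    calc ‖(L (0, y)).1‖ ≤ ‖L (0, y)‖ := _root_.norm_fst_le _
      _ ≤ ‖L‖ * ‖((0 : P), y)‖ := L.le_opNorm _
      _ ≤ R * ‖y‖ := by
        rw [Prod.norm_mk, norm_zero, max_eq_right (norm_nonneg y)]
        exact mul_le_mul_of_nonneg_right h.norm_le (norm_nonneg y)
  calc ‖a ξ‖ ≤ ‖a‖ * ‖ξ‖ := a.le_opNorm ξ
    _ ≤ ‖a‖ * (‖(L (a ξ, y)).1‖ + R * ‖y‖) := by
      refine mul_le_mul_of_nonneg_left ?_ (norm_nonneg a)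
      calc ‖ξ‖ = ‖(L (a ξ, y)).1 - (L (0, y)).1‖ := by rw [← h2]
        _ ≤ ‖(L (a ξ, y)).1‖ + ‖(L (0, y)).1‖ := norm_sub_le _ _
        _ ≤ _ := by gcongr

lemma snd_eq [FiniteDimensional ℝ P] (h : IsDominatedBlock θ R L a b) (x : P) (y : F) :
    (L (x, y)).2 = b y := by
  obtain ⟨ξ, rfl⟩ := h.surjective x
  have h1 : L (a ξ, y) = (ξ, 0) + L (0, y) := by
    rw [← h.apply_fst ξ, ← map_add]; simp
  rw [h1, Prod.snd_add, h.apply_snd]; simp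

/-- If `w'` agrees with `L w` up to an error `e`, then the `P`-component of `w` is controlled
by that of `w'`, and the `F`-component of `w'` is controlled by that of `w`. -/
lemma pair_bounds [FiniteDimensional ℝ P] (h : IsDominatedBlock θ R L a b) {w w' : P × F} {e : ℝ}
    (hw : ‖w' - L w‖ ≤ e) :
    ‖w.1‖ ≤ ‖a‖ * (‖w'.1‖ + R * ‖w.2‖ + e) ∧ ‖w'.2‖ ≤ ‖b‖ * ‖w.2‖ + e := by
  have h1 : ‖w'.1 - (L w).1‖ ≤ e := (_root_.norm_fst_le (w' - L w)).trans hw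
  have h2 : ‖w'.2 - (L w).2‖ ≤ e := (norm_snd_le (w' - L w)).trans hw
  have h3 := h.norm_fst_le w.1 w.2
  have h4 := h.snd_eq w.1 w.2
  constructor
  · refine h3.trans (mul_le_mul_of_nonneg_left ?_ (norm_nonneg a))
    have : ‖(L (w.1, w.2)).1‖ ≤ ‖w'.1‖ + ‖w'.1 - (L w).1‖ := by
      have := norm_sub_le w'.1 (w'.1 - (L w).1)
      simpa using this
    linarith
  · have h5 : ‖w'.2‖ ≤ ‖(L w).2‖ + ‖w'.2 - (L w).2‖ := by
      have := norm_add_le ((L w).2) (w'.2 - (L w).2)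
      simpa using this
    have h6 : ‖(L w).2‖ ≤ ‖b‖ * ‖w.2‖ := by
      have : (L w).2 = b w.2 := h4
      rw [this]; exact b.le_opNorm _
    linarith

end IsDominatedBlock

section Approx

variable {θ R δ c : ℝ} {L : P × F →L[ℝ] P × F} {a : P →L[ℝ] P} {b : F →L[ℝ] F}
  [FiniteDimensional ℝ P]

/-- Two points of graphs of `δ`-Lipschitz functions at distance `≤ d`, with images over the same
point of `P`: the images are closer than the graphs, by a definite factor, and the points are
close if the graphs are. Here `w` is the difference of the points and `w'` that of their images. -/
lemma GraphConstants.contraction (hK : GraphConstants θ R δ c) (h : IsDominatedBlock θ R L a b)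
    {w w' : P × F} {d : ℝ} (hd : 0 ≤ d) (hw : ‖w' - L w‖ ≤ c * ‖w‖) (hw' : w'.1 = 0)
    (hy : ‖w.2‖ ≤ δ * ‖w.1‖ + d) :
    ‖w.1‖ ≤ 3 * R ^ 2 * d ∧ ‖w'.2‖ ≤ (1 + θ) / 2 * d := by
  obtain ⟨b1, b2, b3, b4, b5, b6, hR⟩ := hK.bounds
  obtain ⟨h1, h2⟩ := h.pair_bounds hw
  have hθ := hK.rate_pos; have hθ1 := hK.rate_lt; have hδ := hK.lip_pos; have hc := hK.acc_pos
  have hR1 := hK.one_le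
  have hwn : ‖w‖ ≤ ‖w.1‖ + ‖w.2‖ := by
    rw [Prod.norm_def]; exact max_le_add_of_nonneg (norm_nonneg _) (norm_nonneg _)
  set x := ‖w.1‖ with hx
  set y := ‖w.2‖ with hyd
  have hx0 : 0 ≤ x := norm_nonneg _
  have hy0 : 0 ≤ y := norm_nonneg _
  rw [hw', norm_zero, zero_add] at h1
  have e0 : c * ‖w‖ ≤ c * (x + y) := by gcongr
  have e1 : x ≤ R * (R * y + c * (x + y)) := by
    refine h1.trans ?_
    have : 0 ≤ R * y + c * ‖w‖ := by positivity
    calc _ ≤ R * (R * y + c * ‖w‖) := mul_le_mul_of_nonneg_right h.norm_a_le this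
      _ ≤ _ := by gcongr
  have hRc : 100 * (R * c) ≤ 1 := by nlinarith
  have hR2δ : 100 * (R ^ 2 * δ) ≤ 1 := by linarith
  have hδ1 : δ ≤ 1 := by linarith
  have e2 : x ≤ R ^ 2 * (δ * x + d) + R * c * (x + (δ * x + d)) := by
    have : R * (R * y + c * (x + y)) = R ^ 2 * y + R * c * (x + y) := by ring
    rw [this] at e1
    refine e1.trans ?_
    gcongr
  have hxd : x ≤ 3 * R ^ 2 * d := by
    have t1 : R ^ 2 * δ * x ≤ 1 / 100 * x := by gcongr; linarith
    have t2 : R * c * x ≤ 1 / 100 * x := by gcongr; linarith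
    have t3 : R * c * (δ * x) ≤ 1 / 100 * x := by
      have : R * c * (δ * x) ≤ R * c * (1 * x) := by gcongr
      linarith
    have t4 : R * c * d ≤ R ^ 2 * d := by
      have : R * c ≤ R ^ 2 := by nlinarith
      gcongr
    have t0 : 0 ≤ R ^ 2 * d := by positivity
    linarith
  refine ⟨hxd, ?_⟩
  have e3 : ‖w'.2‖ ≤ θ * y + c * (x + y) := by
    refine h2.trans ?_
    have := mul_le_mul_of_nonneg_right h.norm_b_le hy0
    linarith
  have e4 : ‖w'.2‖ ≤ θ * d + (2 * δ) * x + c * d := by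
    have : θ * y + c * (x + y) ≤ θ * (δ * x + d) + c * (x + (δ * x + d)) := by gcongr
    have t1 : θ * (δ * x) ≤ 1 * (δ * x) := by gcongr
    have t2 : c * x ≤ δ / 2 * x := by gcongr; nlinarith
    have t3 : c * (δ * x) ≤ 1 / 2 * (δ * x) := by gcongr; nlinarith
    linarith
  have t5 : (2 * δ) * x ≤ 6 * (R ^ 2 * δ) * d := by
    calc (2 * δ) * x ≤ (2 * δ) * (3 * R ^ 2 * d) := by gcongr
      _ = _ := by ring
  have t6 : 6 * (R ^ 2 * δ) * d ≤ (1 - θ) * (6 / 100) * d :=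
    mul_le_mul_of_nonneg_right (by linarith) hd
  have t7 : c * d ≤ (1 - θ) * (1 / 100) * d :=
    mul_le_mul_of_nonneg_right (by nlinarith) hd
  linarith [mul_nonneg (sub_nonneg.2 hθ1.le) hd]

/-- The image of a pair of points of a `δ`-Lipschitz graph is again such a pair. It is here,
and in the improvement of the defect of differentiability, that `‖a‖ * ‖b‖ ≤ θ` is needed. -/
lemma GraphConstants.lipschitz (hK : GraphConstants θ R δ c) (h : IsDominatedBlock θ R L a b)
    {w w' : P × F} (hw : ‖w' - L w‖ ≤ c * ‖w‖) (hy : ‖w.2‖ ≤ δ * ‖w.1‖) :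
    ‖w.1‖ ≤ 2 * R * ‖w'.1‖ ∧ ‖w'.2‖ ≤ δ * ‖w'.1‖ := by
  obtain ⟨b1, b2, b3, b4, b5, b6, hR⟩ := hK.bounds
  have hθ := hK.rate_pos; have hθ1 := hK.rate_lt; have hδ := hK.lip_pos; have hc := hK.acc_pos
  have hR1 := hK.one_le
  have hδ1 : δ ≤ 1 := by linarith
  have hwn : ‖w‖ ≤ ‖w.1‖ := by
    rw [Prod.norm_def]; refine max_le le_rfl (hy.trans ?_)
    exact mul_le_of_le_one_left (norm_nonneg _) hδ1
  have hw2 : ‖w' - L w‖ ≤ c * ‖w.1‖ := hw.trans (by gcongr)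
  obtain ⟨h1, h2⟩ := h.pair_bounds hw2
  set x := ‖w.1‖ with hx
  set x' := ‖w'.1‖
  set y := ‖w.2‖
  set A := ‖a‖
  set B := ‖b‖
  have hx0 : 0 ≤ x := norm_nonneg _
  have hx0' : 0 ≤ x' := norm_nonneg _
  have hA0 : 0 ≤ A := norm_nonneg _
  have hB0 : 0 ≤ B := norm_nonneg _
  have hA : A ≤ R := h.norm_a_le
  have e1 : x ≤ A * x' + (R ^ 2 * δ + R * c) * x := by
    have : A * (x' + R * y + c * x) ≤ A * x' + R * (R * (δ * x) + c * x) := by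
      have : A * (R * y + c * x) ≤ R * (R * (δ * x) + c * x) := by gcongr
      linarith
    nlinarith
  have hτ : R ^ 2 * δ + R * c ≤ (1 - θ) / 50 := by nlinarith
  have e2 : x ≤ A * x' + (1 - θ) / 50 * x := e1.trans (by gcongr)
  have e3 : ‖w'.2‖ ≤ (B * δ + c) * x := by
    have : B * y ≤ B * (δ * x) := by gcongr
    linarith
  have e4 : x ≤ 2 * (A * x') := by nlinarith
  constructor
  · have : A * x' ≤ R * x' := by gcongr
    linarith
  · -- multiply the bound for `x` by `B δ + c`, and use `A B ≤ θ`
    have hAB : A * B ≤ θ := h.norm_mul_le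
    have f1 : (1 - (1 - θ) / 50) * x ≤ A * x' := by linarith
    have f2 : (1 - (1 - θ) / 50) * ‖w'.2‖ ≤ (B * δ + c) * (A * x') := by
      calc (1 - (1 - θ) / 50) * ‖w'.2‖ ≤ (1 - (1 - θ) / 50) * ((B * δ + c) * x) := by
            gcongr; linarith
        _ = (B * δ + c) * ((1 - (1 - θ) / 50) * x) := by ring
        _ ≤ _ := by gcongr
    have f3 : (B * δ + c) * (A * x') ≤ (θ * δ + δ * (1 - θ) / 100) * x' := by
      have g1 : A * B * δ ≤ θ * δ := by gcongr
      have g2 : A * c ≤ R * c := by gcongr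
      have : (B * δ + c) * (A * x') = (A * B * δ + A * c) * x' := by ring
      rw [this]; gcongr; linarith
    have f4 : (θ * δ + δ * (1 - θ) / 100) * x' ≤ (1 - (1 - θ) / 50) * (δ * x') := by
      have : 0 ≤ δ * x' * (1 - θ) := by
        have := sub_nonneg.2 hθ1.le
        positivity
      nlinarith
    have f5 : 0 < 1 - (1 - θ) / 50 := by linarith
    exact le_of_mul_le_mul_left (f2.trans (f3.trans f4)) f5

end Approx

end LinearEstimates

/-! ### Points over a prescribed base point -/

section Existence

open Filter

variable {P F : Type*} [NormedAddCommGroup P] [NormedSpace ℝ P] [FiniteDimensional ℝ P]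
  [NormedAddCommGroup F] [NormedSpace ℝ F]
  {θ R δ c : ℝ} {L : P × F →L[ℝ] P × F} {a : P →L[ℝ] P} {b : F →L[ℝ] F}

lemma GraphConstants.bounds_acc (hK : GraphConstants θ R δ c) :
    100 * c ≤ 1 - θ ∧ 100 * (R * c) ≤ 1 - θ ∧ 100 * (R ^ 2 * c) ≤ 1 - θ ∧ 100 * c ≤ δ := by
  obtain ⟨b1, b2, b3, b4, b5, b6, hR⟩ := hK.bounds
  have hθ1 := hK.rate_lt; have hθ := hK.rate_pos; have hδ := hK.lip_pos
  have h1 : δ * (1 - θ) ≤ 1 * (1 - θ) := by gcongr; linarith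
  have h2 : δ * (1 - θ) ≤ δ * 1 := by gcongr; linarith
  refine ⟨by linarith, by linarith, by linarith, by linarith⟩

/-- The size of the image of a small vector, if `G` almost preserves the zero section. -/
lemma GraphConstants.norm_image_snd_le (hK : GraphConstants θ R δ c)
    (h : IsDominatedBlock θ R L a b)
    {G : P × F → P × F} {x x' x'' t : P} {y₀ : F} {r ε : ℝ} (hr : 0 < r) (hε : 0 < ε)
    (hεr : ε < r)
    (hG : ∀ z ∈ Metric.ball (x, (0 : F)) r, ∀ z' ∈ Metric.ball (x, (0 : F)) r,
      ‖G z - G z' - L (z - z')‖ ≤ c * ‖z - z'‖)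
    (hx' : ‖G (x, 0) - (x', 0)‖ ≤ (1 - θ) / 16 * ε) (hx'' : ‖x'' - x'‖ ≤ (1 - θ) / 16 * ε)
    (ht : t ∈ Metric.ball x r) (hy0 : ‖y₀‖ < ε) (htx : (G (t, y₀)).1 = x'') :
    ‖(G (t, y₀)).2‖ ≤ (1 + θ) / 2 * ε := by
  obtain ⟨b1, b2, b3, b4, b5, b6, hR⟩ := hK.bounds
  obtain ⟨d1, d2, d3, d4⟩ := hK.bounds_acc
  have hθ := hK.rate_pos; have hθ1 := hK.rate_lt; have hδ := hK.lip_pos; have hc := hK.acc_pos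
  have hR1 := hK.one_le
  have hR2 : R ≤ R ^ 2 := le_self_pow₀ hR1 two_ne_zero
  have hmem : (t, y₀) ∈ Metric.ball (x, (0 : F)) r := by
    rw [← ball_prod_same]
    exact ⟨ht, by simpa using hy0.trans hεr⟩
  have hmem0 : (x, (0 : F)) ∈ Metric.ball (x, (0 : F)) r := Metric.mem_ball_self hr
  have h1 := hG _ (hmem) _ hmem0
  obtain ⟨h2, h3⟩ := h.pair_bounds h1
  simp only [Prod.fst_sub, Prod.snd_sub, sub_zero] at h2 h3
  have hy := hy0.le
  have hw : ‖(t, y₀) - (x, (0 : F))‖ ≤ ‖t - x‖ + ‖y₀‖ := by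
    rw [Prod.norm_def]
    simp
  set X := ‖t - x‖
  set Y := ‖y₀‖
  have hX0 : 0 ≤ X := norm_nonneg _
  have hY0 : 0 ≤ Y := norm_nonneg _
  have e1 : ‖(G (t, y₀)).1 - (G (x, 0)).1‖ ≤ (1 - θ) / 8 * ε := by
    have q1 := (norm_fst_le (G (x, 0) - (x', 0))).trans hx'
    simp only [Prod.fst_sub] at q1
    have : (G (t, y₀)).1 - (G (x, 0)).1 = (x'' - x') - ((G (x, 0)).1 - x') := by
      rw [htx]; abel
    rw [this]
    refine (norm_sub_le _ _).trans ?_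
    linarith
  have e2 : ‖(G (x, 0)).2‖ ≤ (1 - θ) / 16 * ε := by
    have q1 := (norm_snd_le (G (x, 0) - (x', 0))).trans hx'
    simpa using q1
  have e3 : X ≤ R * ((1 - θ) / 8 * ε + R * ε + c * (X + ε)) := by
    refine h2.trans ?_
    have hcw : c * ‖(t, y₀) - (x, (0 : F))‖ ≤ c * (X + ε) := by gcongr; linarith
    have : 0 ≤ (1 - θ) / 8 * ε + R * ε + c * (X + ε) := by
      have := sub_nonneg.2 hθ1.le
      positivity
    refine (mul_le_mul_of_nonneg_left ?_ (norm_nonneg a)).trans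
      (mul_le_mul_of_nonneg_right h.norm_a_le this)
    have : R * Y ≤ R * ε := by gcongr
    linarith
  have e4 : X ≤ 3 * R ^ 2 * ε := by
    have t1 : R * c * X ≤ 1 / 100 * X := by gcongr; linarith
    have t2 : R * c * ε ≤ 1 / 100 * ε := by gcongr; linarith
    have t3 : R * ((1 - θ) / 8 * ε) ≤ R * (1 / 8 * ε) := by gcongr; linarith
    have t4 : R * ε ≤ R ^ 2 * ε := by gcongr
    have t5 : 1 * ε ≤ R ^ 2 * ε := by gcongr; linarith
    linarith
  have e5 : ‖(G (t, y₀)).2‖ ≤ θ * ε + c * (X + ε) + (1 - θ) / 16 * ε := by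
    have q1 : ‖(G (t, y₀)).2‖ ≤ ‖(G (t, y₀)).2 - (G (x, 0)).2‖ + ‖(G (x, 0)).2‖ := by
      simpa using norm_add_le ((G (t, y₀)).2 - (G (x, 0)).2) ((G (x, 0)).2)
    have q2 : ‖b‖ * Y ≤ θ * ε := mul_le_mul h.norm_b_le hy hY0 hθ.le
    have hcw : c * ‖(t, y₀) - (x, (0 : F))‖ ≤ c * (X + ε) := by gcongr; linarith
    linarith
  have e6 : c * X ≤ (1 - θ) * (3 / 100) * ε := by
    calc c * X ≤ c * (3 * R ^ 2 * ε) := by gcongr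
      _ = 3 * (R ^ 2 * c) * ε := by ring
      _ ≤ _ := mul_le_mul_of_nonneg_right (by linarith) hε.le
  have e7 : c * ε ≤ (1 - θ) * (1 / 100) * ε := mul_le_mul_of_nonneg_right (by linarith) hε.le
  have e8 : 0 ≤ (1 - θ) * ε := mul_nonneg (sub_nonneg.2 hθ1.le) hε.le
  linarith

/-- A map `G` that is linearly approximated by a dominated block map near `(x, 0)`, and sends
`(x, 0)` close to `(x', 0)`, maps the graph of every small `δ`-Lipschitz function over a
neighbourhood of `x'`, and this part of the image is smaller than the graph by a definite factor.
The base component of `G` on the graph is close to the linear map with right inverse `a`, hence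
the image of a ball of radius `s` around `x` contains one of radius `s / (2 * R)`, and it maps `x`
to a point at distance at most `(R + 3) * ε` from `x''`; this explains the condition on `r`. -/
lemma GraphConstants.exists_preimage (hK : GraphConstants θ R δ c) (h : IsDominatedBlock θ R L a b)
    {G : P × F → P × F} {x x' x'' : P} {r ε : ℝ} (hr : 0 < r) (hε : 0 < ε)
    (hεr : 4 * R * (R + 3) * ε ≤ r)
    (hG : ∀ z ∈ Metric.ball (x, (0 : F)) r, ∀ z' ∈ Metric.ball (x, (0 : F)) r,
      ‖G z - G z' - L (z - z')‖ ≤ c * ‖z - z'‖)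
    (hx' : ‖G (x, 0) - (x', 0)‖ ≤ (1 - θ) / 16 * ε) (hx'' : ‖x'' - x'‖ ≤ (1 - θ) / 16 * ε)
    {u : P → F} (hu : ∀ t ∈ Metric.ball x r, ‖u t‖ < ε)
    (hlip : ∀ t ∈ Metric.ball x r, ∀ t' ∈ Metric.ball x r, ‖u t - u t'‖ ≤ δ * ‖t - t'‖) :
    ∃ t ∈ Metric.ball x r, (G (t, u t)).1 = x'' ∧ ‖(G (t, u t)).2‖ ≤ (1 + θ) / 2 * ε := by
  obtain ⟨b1, b2, b3, b4, b5, b6, hR⟩ := hK.bounds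
  have hθ := hK.rate_pos; have hθ1 := hK.rate_lt; have hδ := hK.lip_pos; have hc := hK.acc_pos
  have hR1 := hK.one_le
  have hδ1 : δ ≤ 1 := by linarith
  have hεr' : ε < r := by
    have : 16 * ε ≤ 4 * R * (R + 3) * ε := by gcongr; nlinarith
    linarith
  have hmem : ∀ t ∈ Metric.ball x r, (t, u t) ∈ Metric.ball (x, (0 : F)) r := by
    intro t ht
    rw [← ball_prod_same]
    exact ⟨ht, by simpa using (hu t ht).trans hεr'⟩
  have hmem0 : (x, (0 : F)) ∈ Metric.ball (x, (0 : F)) r := Metric.mem_ball_self hr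
  -- the linear part in the direction of the base, and its right inverse `a`
  let f' : P →L[ℝ] P :=
    (ContinuousLinearMap.fst ℝ P F).comp (L.comp (ContinuousLinearMap.inl ℝ P F))
  have hf' : ∀ t, f' t = (L (t, 0)).1 := fun t => rfl
  let g : f'.NonlinearRightInverse :=
    { toFun := a
      nnnorm := ⟨R, hR.le⟩
      bound' := fun y => (a.le_opNorm y).trans
        (mul_le_mul_of_nonneg_right h.norm_a_le (norm_nonneg y))
      right_inv' := fun y => by rw [hf', h.apply_fst] }
  have hc' : 0 ≤ R * δ + c := by positivity
  have happ : ApproximatesLinearOn (fun t => (G (t, u t)).1) f' (Metric.ball x r)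
      ⟨R * δ + c, hc'⟩ := by
    intro t ht t' ht'
    have h1 := hG _ (hmem t ht) _ (hmem t' ht')
    have h2 := hlip t ht t' ht'
    have h3 : ‖(t, u t) - (t', u t')‖ ≤ ‖t - t'‖ := by
      rw [Prod.mk_sub_mk, Prod.norm_mk]
      exact max_le le_rfl (h2.trans (mul_le_of_le_one_left (norm_nonneg _) hδ1))
    have h4 : L ((t, u t) - (t', u t')) = L (t - t', 0) + L (0, u t - u t') := by
      rw [← map_add]; simp
    have h5 : (G (t, u t)).1 - (G (t', u t')).1 - f' (t - t') =
        (G (t, u t) - G (t', u t') - L ((t, u t) - (t', u t'))).1 + (L (0, u t - u t')).1 := by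
      rw [h4, hf', Prod.fst_sub, Prod.fst_sub, Prod.fst_add]; abel
    have h6 : ‖(L (0, u t - u t')).1‖ ≤ R * ‖u t - u t'‖ := by
      calc ‖(L (0, u t - u t')).1‖ ≤ ‖L (0, u t - u t')‖ := norm_fst_le _
        _ ≤ ‖L‖ * ‖((0 : P), u t - u t')‖ := L.le_opNorm _
        _ ≤ R * ‖u t - u t'‖ := by
          rw [Prod.norm_mk, norm_zero, max_eq_right (norm_nonneg _)]
          exact mul_le_mul_of_nonneg_right h.norm_le (norm_nonneg _)
    change ‖(G (t, u t)).1 - (G (t', u t')).1 - f' (t - t')‖ ≤ (R * δ + c) * ‖t - t'‖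
    rw [h5]
    refine (norm_add_le _ _).trans ?_
    have h7 := (norm_fst_le (G (t, u t) - G (t', u t') - L ((t, u t) - (t', u t')))).trans h1
    have h8 : c * ‖(t, u t) - (t', u t')‖ ≤ c * ‖t - t'‖ := by gcongr
    have h9 : R * ‖u t - u t'‖ ≤ R * (δ * ‖t - t'‖) := by gcongr
    linarith
  -- the image of the point of the graph over `x` lies almost over `x'`
  have hbase : ‖(G (x, u x)).1 - x'‖ ≤ (1 - θ) / 16 * ε + (R + c) * ε := by
    have hxx := Metric.mem_ball_self (x := x) hr
    have h1 := hG _ (hmem x hxx) _ hmem0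
    have h2 : (x, u x) - (x, (0 : F)) = (0, u x) := by simp
    rw [h2] at h1
    have h3 : ‖((0 : P), u x)‖ = ‖u x‖ := by
      rw [Prod.norm_mk, norm_zero, max_eq_right (norm_nonneg _)]
    rw [h3] at h1
    have h4 : ‖L (0, u x)‖ ≤ R * ‖u x‖ := by
      have := L.le_opNorm ((0 : P), u x)
      rw [h3] at this
      exact this.trans (mul_le_mul_of_nonneg_right h.norm_le (norm_nonneg _))
    have h5 : G (x, u x) - (x', 0) =
      (G (x, u x) - G (x, 0) - L (0, u x)) + L (0, u x) + (G (x, 0) - (x', 0)) := by abel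
    have h6 : ‖G (x, u x) - (x', 0)‖ ≤ c * ‖u x‖ + R * ‖u x‖ + (1 - θ) / 16 * ε := by
      rw [h5]
      exact (norm_add_le _ _).trans (add_le_add ((norm_add_le _ _).trans (add_le_add h1 h4)) hx')
    have h7 := norm_fst_le (G (x, u x) - (x', 0))
    have h8 : (R + c) * ‖u x‖ ≤ (R + c) * ε := by gcongr; exact (hu x hxx).le
    simp only [Prod.fst_sub] at h7
    linarith
  have hsurj := happ.surjOn_closedBall_of_nonlinearRightInverse g (ε := r / 2) (b := x)
    (by linarith) (Metric.closedBall_subset_ball (by linarith))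
  have hx''mem : x'' ∈ Metric.closedBall ((fun t => (G (t, u t)).1) x)
      (((g.nnnorm : ℝ)⁻¹ - ((⟨R * δ + c, hc'⟩ : NNReal) : ℝ)) * (r / 2)) := by
    rw [Metric.mem_closedBall, dist_eq_norm]
    change ‖x'' - (G (x, u x)).1‖ ≤ (R⁻¹ - (R * δ + c)) * (r / 2)
    have h1 : ‖x'' - (G (x, u x)).1‖ ≤ (1 - θ) / 16 * ε + ((1 - θ) / 16 * ε + (R + c) * ε) := by
      have : x'' - (G (x, u x)).1 = (x'' - x') - ((G (x, u x)).1 - x') := by abel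
      rw [this]
      exact (norm_sub_le _ _).trans (add_le_add hx'' hbase)
    have hc1 : c ≤ 1 := by nlinarith
    have h2 : ‖x'' - (G (x, u x)).1‖ ≤ (R + 3) * ε := by
      have : (1 - θ) / 16 * ε + ((1 - θ) / 16 * ε + (R + c) * ε) =
        ((1 - θ) / 8 + R + c) * ε := by ring
      rw [this] at h1
      exact h1.trans (mul_le_mul_of_nonneg_right (by linarith) hε.le)
    have h3 : (R + 3) * ε ≤ (R⁻¹ / 2) * (r / 2) := by
      have : (R⁻¹ / 2) * (r / 2) = r / (4 * R) := by field_simp; ring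
      rw [this, le_div_iff₀ (by positivity)]
      linarith
    have h4 : R⁻¹ / 2 ≤ R⁻¹ - (R * δ + c) := by
      have : R * δ + c ≤ R⁻¹ / 2 := by
        rw [inv_eq_one_div, div_div, le_div_iff₀ (by positivity)]
        nlinarith
      linarith
    refine h2.trans (h3.trans ?_)
    gcongr
  obtain ⟨t, ht, htx⟩ := hsurj hx''mem
  have ht' : t ∈ Metric.ball x r := Metric.closedBall_subset_ball (by linarith) ht
  refine ⟨t, ht', htx, ?_⟩
  exact hK.norm_image_snd_le h hr hε hεr' hG hx' hx'' ht' (hu t ht') htx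

end Existence

/-! ### The defect of strict differentiability -/

section Defect

open Filter

variable {P F : Type*} [NormedAddCommGroup P] [NormedSpace ℝ P]
  [NormedAddCommGroup F] [NormedSpace ℝ F]

/-- Near `x` the function `u` is linear up to a Lipschitz error of constant `η`: its defect of
strict differentiability at `x` is at most `η`. -/
def DefectLE (u : P → F) (x : P) (η : ℝ) : Prop :=
  ∃ L : P →L[ℝ] F, ∀ᶠ z in 𝓝 (x, x), ‖u z.1 - u z.2 - L (z.1 - z.2)‖ ≤ η * ‖z.1 - z.2‖

lemma norm_apply_le_of_eventually {T : P →L[ℝ] F} {C : ℝ} {x : P}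
    (h : ∀ᶠ z in 𝓝 (x, x), ‖T (z.1 - z.2)‖ ≤ C * ‖z.1 - z.2‖) (v : P) : ‖T v‖ ≤ C * ‖v‖ := by
  have h1 : Tendsto (fun t : ℝ => (x + t • v, x)) (𝓝[>] 0) (𝓝 (x, x)) := by
    have : Tendsto (fun t : ℝ => (x + t • v, x)) (𝓝 0) (𝓝 (x + (0 : ℝ) • v, x)) :=
      Continuous.tendsto (by fun_prop) 0
    simp only [zero_smul, add_zero] at this
    exact this.mono_left nhdsWithin_le_nhds
  obtain ⟨t, ht, ht0⟩ := ((h1.eventually h).and self_mem_nhdsWithin).exists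
  have ht0' : (0 : ℝ) < t := ht0
  simp only [add_sub_cancel_left, map_smul, norm_smul, Real.norm_eq_abs, abs_of_pos ht0'] at ht
  have : t * ‖T v‖ ≤ t * (C * ‖v‖) := by linarith
  exact le_of_mul_le_mul_left this ht0'

/-- A function without defect is strictly differentiable: its approximate differentials converge. -/
lemma DefectLE.exists_hasStrictFDerivAt [CompleteSpace F] {u : P → F} {x : P}
    (h : ∀ η > 0, DefectLE u x η) : ∃ L : P →L[ℝ] F, HasStrictFDerivAt u L x := by
  choose! A hA using h
  -- the approximate differentials form a Cauchy family
  have hdist : ∀ η > 0, ∀ η' > 0, ‖A η - A η'‖ ≤ η + η' := by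
    intro η hη η' hη'
    refine ContinuousLinearMap.opNorm_le_bound _ (by linarith) fun v => ?_
    refine norm_apply_le_of_eventually (x := x) ?_ v
    filter_upwards [hA η hη, hA η' hη'] with z h1 h2
    have : (A η - A η') (z.1 - z.2) = (u z.1 - u z.2 - A η' (z.1 - z.2)) -
      (u z.1 - u z.2 - A η (z.1 - z.2)) := by
      simp only [sub_apply]; abel
    rw [this]
    refine (norm_sub_le _ _).trans ?_
    linarith
  let s : ℕ → P →L[ℝ] F := fun n => A (1 / (n + 1))
  have hpos : ∀ n : ℕ, (0 : ℝ) < 1 / (n + 1) := fun n => by positivity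
  have hcau : CauchySeq s := by
    refine cauchySeq_of_le_tendsto_0 (fun n : ℕ => 2 * (1 / ((n : ℝ) + 1))) ?_ ?_
    · intro n m N hn hm
      rw [dist_eq_norm]
      refine (hdist _ (hpos n) _ (hpos m)).trans ?_
      have h1 : (1 : ℝ) / (n + 1) ≤ 1 / (N + 1) := by gcongr
      have h2 : (1 : ℝ) / (m + 1) ≤ 1 / (N + 1) := by gcongr
      linarith
    · simpa using (tendsto_one_div_add_atTop_nhds_zero_nat (𝕜 := ℝ)).const_mul 2
  obtain ⟨L, hL⟩ := cauchySeq_tendsto_of_complete hcau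
  refine ⟨L, ?_⟩
  rw [hasStrictFDerivAt_iff_isLittleO, Asymptotics.isLittleO_iff]
  intro c hc
  have hAL : ‖A (c / 2) - L‖ ≤ c / 2 := by
    have h1 : Tendsto (fun n : ℕ => ‖A (c / 2) - s n‖) atTop (𝓝 ‖A (c / 2) - L‖) :=
      (tendsto_const_nhds.sub hL).norm
    have h2 : Tendsto (fun n : ℕ => c / 2 + 1 / ((n : ℝ) + 1)) atTop (𝓝 (c / 2 + 0)) :=
      tendsto_const_nhds.add tendsto_one_div_add_atTop_nhds_zero_nat
    rw [add_zero] at h2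
    exact le_of_tendsto_of_tendsto' h1 h2 fun n => hdist _ (by linarith) _ (hpos n)
  filter_upwards [hA (c / 2) (by linarith)] with z hz
  have : u z.1 - u z.2 - L (z.1 - z.2) = (u z.1 - u z.2 - A (c / 2) (z.1 - z.2)) +
      (A (c / 2) - L) (z.1 - z.2) := by
    simp only [sub_apply]; abel
  rw [this]
  refine (norm_add_le _ _).trans ?_
  have := (A (c / 2) - L).le_of_opNorm_le hAL (z.1 - z.2)
  linarith

/-- A function that is strictly differentiable at all points of an open set is `C^1` there. -/
lemma contDiffOn_one_of_hasStrictFDerivAt {u : P → F} {s : Set P} (hs : IsOpen s)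
    (h : ∀ x ∈ s, ∃ L : P →L[ℝ] F, HasStrictFDerivAt u L x) : ContDiffOn ℝ 1 u s := by
  have hd : ∀ x ∈ s, HasStrictFDerivAt u (fderiv ℝ u x) x := by
    intro x hx
    obtain ⟨L, hL⟩ := h x hx
    rwa [hL.hasFDerivAt.fderiv]
  have h1 : DifferentiableOn ℝ u s := fun x hx =>
    (hd x hx).hasFDerivAt.differentiableAt.differentiableWithinAt
  have h2 : ContinuousOn (fderiv ℝ u) s := by
    intro x hx
    refine ContinuousAt.continuousWithinAt ?_
    rw [ContinuousAt, Metric.tendsto_nhds]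
    intro η hη
    have h3 := (hd x hx).isLittleO
    rw [Asymptotics.isLittleO_iff] at h3
    have h4 := (Continuous.tendsto (f := fun y : P => (y, y)) (by fun_prop) x).eventually
      (h3 (half_pos hη)).eventually_nhds
    filter_upwards [h4, hs.mem_nhds hx] with y h5 hys
    rw [dist_eq_norm]
    refine lt_of_le_of_lt ?_ (half_lt_self hη)
    have h6 : HasFDerivAt (fun z => u z - fderiv ℝ u x z) (fderiv ℝ u y - fderiv ℝ u x) y :=
      (hd y hys).hasFDerivAt.sub (fderiv ℝ u x).hasFDerivAt
    refine h6.le_of_lip' (half_pos hη).le ?_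
    have h7 : Tendsto (fun z : P => (z, y)) (𝓝 y) (𝓝 (y, y)) :=
      Continuous.tendsto (by fun_prop) y
    filter_upwards [h7.eventually h5] with z hz
    have : u z - fderiv ℝ u x z - (u y - fderiv ℝ u x y) =
        u z - u y - fderiv ℝ u x (z - y) := by rw [map_sub]; abel
    rw [this]
    exact hz
  intro x hx
  rw [show (1 : WithTop ℕ∞) = 0 + 1 from rfl]
  exact ((contDiffOn_succ_iff_fderiv_of_isOpen hs).2
    ⟨h1, by simp, contDiffOn_zero.2 h2⟩) x hx

/-- The numerical inequality behind the improvement of the defect. In the application `A` and `B`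
are the norms of the blocks, `D` and `N` are the distances of the base points of two points of the
graph and of their images, `U` is the distance of the values, and `q` is the error of the
transformed linear approximation. -/
lemma GraphConstants.defect_factor {θ R δ c A B η D N U q : ℝ} (hK : GraphConstants θ R δ c)
    (hN0 : 0 ≤ N) (hA0 : 0 ≤ A) (hA : A ≤ R) (hB0 : 0 ≤ B) (hAB : A * B ≤ θ) (hη : 0 < η)
    (hD0 : 0 ≤ D) (hD : D ≤ A * (N + R * U + 2 * c * D)) (hU : U ≤ δ * D)
    (hq : q ≤ (B + c) * (η * D) + c * (η * D) +
        6 * R * δ * ((R + c) * (η * D) + c * (η * D))) :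
    q ≤ (1 + θ) / 2 * η * N := by
  obtain ⟨b1, b2, b3, b4, b5, b6, hR⟩ := hK.bounds
  obtain ⟨d1, d2, d3, d4⟩ := hK.bounds_acc
  have hθ := hK.rate_pos; have hθ1 := hK.rate_lt; have hδ := hK.lip_pos; have hc := hK.acc_pos
  have hR1 := hK.one_le
  have hs : 0 < 1 - θ := sub_pos.2 hθ1
  have hηD : 0 ≤ η * D := by positivity
  have e1 : 2 * c + 6 * R * δ * (R + 2 * c) ≤ 7 * R ^ 2 * δ := by
    have f1 : 1 * δ ≤ R ^ 2 * δ := by gcongr; exact one_le_pow₀ hR1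
    have f2 : R * δ ≤ R ^ 2 * δ := by gcongr; exact le_self_pow₀ hR1 two_ne_zero
    have f3 : R * δ * (100 * c) ≤ R * δ * 1 := by gcongr; linarith
    linarith
  have m2 : q ≤ (B + 7 * R ^ 2 * δ) * (η * D) := by
    have := mul_le_mul_of_nonneg_right e1 hηD
    linarith
  have m3 : (1 - (1 - θ) / 25) * D ≤ A * N := by
    have e1 : A * (R * U + 2 * c * D) ≤ R * (R * (δ * D) + 2 * c * D) := by
      calc A * (R * U + 2 * c * D) ≤ A * (R * (δ * D) + 2 * c * D) := by gcongr
        _ ≤ _ := by gcongr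
    have e2 : (R ^ 2 * δ + 2 * (R * c)) * D ≤ (1 - θ) / 25 * D := by
      gcongr
      have := mul_le_mul_of_nonneg_right (by linarith : δ ≤ 1) hs.le
      linarith
    linarith
  have m4 : A * (B + 7 * R ^ 2 * δ) ≤ θ + 7 * (1 - θ) / 100 := by
    have e1 : A * (7 * R ^ 2 * δ) ≤ R * (7 * R ^ 2 * δ) := by gcongr
    have e2 := hK.lip_le
    linarith
  have hf : 0 < 1 - (1 - θ) / 25 := by linarith
  have hBR : 0 ≤ (B + 7 * R ^ 2 * δ) * η := by positivity
  have hηN : 0 ≤ η * N := by positivity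
  have m5 : (1 - (1 - θ) / 25) * q ≤ (1 - (1 - θ) / 25) * ((1 + θ) / 2 * η * N) := by
    calc _ ≤ (1 - (1 - θ) / 25) * ((B + 7 * R ^ 2 * δ) * (η * D)) :=
          mul_le_mul_of_nonneg_left m2 hf.le
      _ = (B + 7 * R ^ 2 * δ) * η * ((1 - (1 - θ) / 25) * D) := by ring
      _ ≤ (B + 7 * R ^ 2 * δ) * η * (A * N) := mul_le_mul_of_nonneg_left m3 hBR
      _ = A * (B + 7 * R ^ 2 * δ) * (η * N) := by ring
      _ ≤ (θ + 7 * (1 - θ) / 100) * (η * N) := mul_le_mul_of_nonneg_right m4 hηN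
      _ ≤ ((1 - (1 - θ) / 25) * ((1 + θ) / 2)) * (η * N) := by
          refine mul_le_mul_of_nonneg_right ?_ hηN
          nlinarith
      _ = _ := by ring
  exact le_of_mul_le_mul_left m5 hf

variable [FiniteDimensional ℝ P] {θ R δ c : ℝ} {L : P × F →L[ℝ] P × F} {a : P →L[ℝ] P}
  {b : F →L[ℝ] F}

/-- The graph transform improves the defect of strict differentiability by a definite factor: if
`G` maps the graph of `u` near `x` to the graph of `u'` near `x'`, then a linear approximation of
`u` is transformed into a better one of `u'`. -/
lemma GraphConstants.defectLE_image (hK : GraphConstants θ R δ c) (h : IsDominatedBlock θ R L a b)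
    {G : P × F → P × F} {Λ : P × F →L[ℝ] P × F} {x x' : P} {u u' : P → F}
    (hΛ : HasStrictFDerivAt G Λ (x, u x)) (hΛL : ‖Λ - L‖ ≤ c)
    (hlip : ∀ᶠ z in 𝓝 (x, x), ‖u z.1 - u z.2‖ ≤ δ * ‖z.1 - z.2‖)
    {ξ : P → P} (hξ : Tendsto ξ (𝓝 x') (𝓝 x)) (hG : ∀ᶠ t in 𝓝 x', G (ξ t, u (ξ t)) = (t, u' t))
    {η : ℝ} (hη : 0 < η) (hηδ : η ≤ δ) (hu : DefectLE u x η) :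
    DefectLE u' x' ((1 + θ) / 2 * η) := by
  obtain ⟨b1, b2, b3, b4, b5, b6, hR⟩ := hK.bounds
  have hθ := hK.rate_pos; have hθ1 := hK.rate_lt; have hδ := hK.lip_pos; have hc := hK.acc_pos
  have hR1 := hK.one_le
  have hδ1 : 100 * δ ≤ 1 := by linarith
  obtain ⟨d1, d2, d3, hcδ⟩ := hK.bounds_acc
  obtain ⟨ℓ, hℓ⟩ := hu
  have hℓn : ∀ v, ‖ℓ v‖ ≤ 2 * δ * ‖v‖ := by
    refine fun v => norm_apply_le_of_eventually (x := x) ?_ v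
    filter_upwards [hℓ, hlip] with z h1 h2
    have : ℓ (z.1 - z.2) = (u z.1 - u z.2) - (u z.1 - u z.2 - ℓ (z.1 - z.2)) := by abel
    rw [this]
    refine (norm_sub_le _ _).trans ?_
    have : η * ‖z.1 - z.2‖ ≤ δ * ‖z.1 - z.2‖ := by gcongr
    linarith
  -- the image of the graph of `ℓ` under `Λ`
  let J : P →L[ℝ] P × F := (ContinuousLinearMap.id ℝ P).prod ℓ
  have hJ : ∀ v, J v = (v, ℓ v) := fun v => rfl
  have hJn : ∀ v, ‖J v‖ ≤ ‖v‖ := by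
    intro v
    rw [hJ, Prod.norm_mk]
    refine max_le le_rfl ((hℓn v).trans ?_)
    exact mul_le_of_le_one_left (norm_nonneg v) (by linarith)
  have hΛLv : ∀ w, ‖Λ w - L w‖ ≤ c * ‖w‖ := fun w => (Λ - L).le_of_opNorm_le hΛL w
  have hpair : ∀ v, ‖v‖ ≤ 2 * R * ‖(Λ (J v)).1‖ ∧ ‖(Λ (J v)).2‖ ≤ 3 * δ * ‖v‖ := by
    intro v
    obtain ⟨p1, p2⟩ := h.pair_bounds (w := J v) (w' := Λ (J v)) (e := c * ‖v‖)
      ((hΛLv _).trans (by gcongr; exact hJn v))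
    change ‖v‖ ≤ ‖a‖ * (‖(Λ (J v)).1‖ + R * ‖ℓ v‖ + c * ‖v‖) at p1
    change ‖(Λ (J v)).2‖ ≤ ‖b‖ * ‖ℓ v‖ + c * ‖v‖ at p2
    have hv := norm_nonneg v
    constructor
    · have q1 : ‖v‖ ≤ R * (‖(Λ (J v)).1‖ + R * (2 * δ * ‖v‖) + c * ‖v‖) := by
        refine p1.trans ((mul_le_mul_of_nonneg_right h.norm_a_le (by positivity)).trans ?_)
        gcongr
        exact hℓn v
      have q2 : 100 * (R ^ 2 * δ) * ‖v‖ ≤ 1 * ‖v‖ := by gcongr; linarith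
      have q3 : 100 * (R * c) * ‖v‖ ≤ 1 * ‖v‖ := by gcongr; linarith
      linarith
    · have q1 : ‖b‖ * ‖ℓ v‖ ≤ 1 * (2 * δ * ‖v‖) :=
        mul_le_mul (h.norm_b_le.trans hθ1.le) (hℓn v) (norm_nonneg _) zero_le_one
      have q2 : 100 * c * ‖v‖ ≤ δ * ‖v‖ := by gcongr
      have q3 : 0 ≤ δ * ‖v‖ := by positivity
      linarith
  let α : P →ₗ[ℝ] P := ((ContinuousLinearMap.fst ℝ P F).comp (Λ.comp J) : P →L[ℝ] P)
  have hα : ∀ v, α v = (Λ (J v)).1 := fun v => rfl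
  have hαinj : Function.Injective α := by
    rw [← LinearMap.ker_eq_bot, LinearMap.ker_eq_bot']
    intro v hv
    have := (hpair v).1
    rw [← hα, hv] at this
    simpa using this
  let αe : P ≃L[ℝ] P := (LinearEquiv.ofInjectiveEndo α hαinj).toContinuousLinearEquiv
  have hαe : ∀ v, αe v = (Λ (J v)).1 := fun v => rfl
  -- the transformed linear map
  let ℓ' : P →L[ℝ] F :=
    ((ContinuousLinearMap.snd ℝ P F).comp (Λ.comp J)).comp (αe.symm : P →L[ℝ] P)
  have hℓ' : ∀ v, ℓ' (Λ (J v)).1 = (Λ (J v)).2 := by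
    intro v
    change (Λ (J (αe.symm (Λ (J v)).1))).2 = _
    rw [← hαe, ContinuousLinearEquiv.symm_apply_apply]
  have hℓ'n : ∀ v, ‖ℓ' v‖ ≤ 6 * R * δ * ‖v‖ := by
    intro v
    obtain ⟨v, rfl⟩ := αe.surjective v
    rw [hαe, hℓ']
    have := hpair v
    calc _ ≤ 3 * δ * ‖v‖ := this.2
      _ ≤ 3 * δ * (2 * R * ‖(Λ (J v)).1‖) := by gcongr; exact this.1
      _ = _ := by ring
  refine ⟨ℓ', ?_⟩
  have hξ2 : Tendsto (fun z : P × P => (ξ z.1, ξ z.2)) (𝓝 (x', x')) (𝓝 (x, x)) := by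
    rw [nhds_prod_eq, nhds_prod_eq]; exact hξ.prodMap hξ
  have hcont : Tendsto (fun z : P × P => ((z.1, u z.1), (z.2, u z.2))) (𝓝 (x, x))
      (𝓝 ((x, u x), (x, u x))) := by
    have hcu : Tendsto u (𝓝 x) (𝓝 (u x)) := by
      rw [tendsto_iff_norm_sub_tendsto_zero]
      have h1 : Tendsto (fun z : P => (z, x)) (𝓝 x) (𝓝 (x, x)) :=
        Continuous.tendsto (by fun_prop) x
      have h2 : Tendsto (fun z : P => δ * ‖z - x‖) (𝓝 x) (𝓝 0) := by
        have : Tendsto (fun z : P => δ * ‖z - x‖) (𝓝 x) (𝓝 (δ * ‖x - x‖)) :=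
          Continuous.tendsto (by fun_prop) x
        simpa using this
      refine squeeze_zero' (Eventually.of_forall fun _ => norm_nonneg _) ?_ h2
      filter_upwards [h1.eventually hlip] with z hz using hz
    have h3 : Tendsto (fun z => (z, u z)) (𝓝 x) (𝓝 (x, u x)) := by
      rw [nhds_prod_eq]; exact tendsto_id.prodMk hcu
    rw [nhds_prod_eq, nhds_prod_eq (x := (x, u x))]
    exact h3.prodMap h3
  have hstr := hΛ.isLittleO
  rw [Asymptotics.isLittleO_iff] at hstr
  -- the error of the linearization of `G` is made small compared with `η`
  have hstr' := hcont.eventually (hstr (c := c * η) (by positivity))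
  filter_upwards [hξ2.eventually hℓ, hξ2.eventually hlip, hξ2.eventually hstr',
    (continuous_fst.tendsto (x', x')).eventually hG,
    (continuous_snd.tendsto (x', x')).eventually hG] with z g1 g2 g3 g4 g5
  rw [g4, g5] at g3
  set t := ξ z.1
  set t' := ξ z.2
  set D := t - t' with hD
  set κ := u t - u t' - ℓ D with hκ
  have hDu : (t, u t) - (t', u t') = (D, u t - u t') := by simp [hD]
  have hDu' : (D, u t - u t') = J D + (0, κ) := by rw [hJ, hκ]; simp
  have hzz : (z.1, u' z.1) - (z.2, u' z.2) = (z.1 - z.2, u' z.1 - u' z.2) := by simp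
  rw [hDu, hzz] at g3
  have hnD : ‖(D, u t - u t')‖ ≤ ‖D‖ := by
    rw [Prod.norm_mk]
    refine max_le le_rfl (g2.trans ?_)
    exact mul_le_of_le_one_left (norm_nonneg _) (by linarith)
  have hD0 := norm_nonneg D
  have g3' : ‖(z.1 - z.2, u' z.1 - u' z.2) - Λ (D, u t - u t')‖ ≤ c * η * ‖D‖ :=
    g3.trans (by gcongr)
  have hη1 : η ≤ 1 := by linarith
  -- the base points
  obtain ⟨p1, -⟩ := h.pair_bounds (w := (D, u t - u t')) (w' := (z.1 - z.2, u' z.1 - u' z.2))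
    (e := 2 * c * ‖D‖) (by
      have e1 := hΛLv (D, u t - u t')
      have e2 : c * ‖(D, u t - u t')‖ ≤ c * ‖D‖ := by gcongr
      have e3 : c * η * ‖D‖ ≤ c * 1 * ‖D‖ := by gcongr
      have := norm_add_le ((z.1 - z.2, u' z.1 - u' z.2) - Λ (D, u t - u t'))
        (Λ (D, u t - u t') - L (D, u t - u t'))
      rw [sub_add_sub_cancel] at this
      linarith)
  -- the difference of the values
  set ζ := (z.1 - z.2, u' z.1 - u' z.2) - Λ (D, u t - u t') with hζ
  have k1 : (z.1 - z.2, u' z.1 - u' z.2) = Λ (J D) + Λ (0, κ) + ζ := by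
    rw [hζ, ← map_add, ← hDu']; abel
  have k2 : z.1 - z.2 = (Λ (J D)).1 + (Λ (0, κ)).1 + ζ.1 := congrArg Prod.fst k1
  have k3 : u' z.1 - u' z.2 = (Λ (J D)).2 + (Λ (0, κ)).2 + ζ.2 := congrArg Prod.snd k1
  have k4 : u' z.1 - u' z.2 - ℓ' (z.1 - z.2) =
      (Λ (0, κ)).2 + ζ.2 - ℓ' ((Λ (0, κ)).1 + ζ.1) := by
    rw [k3, k2, map_add, map_add, map_add, hℓ']; abel
  have n0 : ‖((0 : P), κ)‖ = ‖κ‖ := by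
    rw [Prod.norm_mk, norm_zero, max_eq_right (norm_nonneg _)]
  have n1 : ‖(Λ (0, κ)).2‖ ≤ ‖b‖ * ‖κ‖ + c * ‖κ‖ := by
    have e1 : ‖(Λ (0, κ) - L (0, κ)).2‖ ≤ c * ‖κ‖ := by
      refine (norm_snd_le _).trans ?_
      rw [← n0]; exact hΛLv _
    have e2 := b.le_opNorm κ
    rw [← h.apply_snd κ] at e2
    have := norm_add_le (L (0, κ)).2 (Λ (0, κ) - L (0, κ)).2
    rw [Prod.snd_sub, add_sub_cancel] at this
    rw [Prod.snd_sub] at e1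
    linarith
  have n2 : ‖(Λ (0, κ)).1‖ ≤ (R + c) * ‖κ‖ := by
    refine (norm_fst_le _).trans ?_
    rw [← n0]
    refine Λ.le_of_opNorm_le ?_ _
    calc ‖Λ‖ = ‖L + (Λ - L)‖ := by rw [add_sub_cancel]
      _ ≤ ‖L‖ + ‖Λ - L‖ := norm_add_le _ _
      _ ≤ R + c := add_le_add h.norm_le hΛL
  have n3 := (norm_fst_le ζ).trans g3'
  have n4 := (norm_snd_le ζ).trans g3'
  have n5 : ‖ℓ' ((Λ (0, κ)).1 + ζ.1)‖ ≤ 6 * R * δ * ((R + c) * ‖κ‖ + c * η * ‖D‖) := by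
    refine (hℓ'n _).trans ?_
    gcongr
    exact (norm_add_le _ _).trans (add_le_add n2 n3)
  have n6 : ‖κ‖ ≤ η * ‖D‖ := g1
  have m1 : ‖(Λ (0, κ)).2 + ζ.2 - ℓ' ((Λ (0, κ)).1 + ζ.1)‖ ≤
      (‖b‖ + c) * (η * ‖D‖) + c * (η * ‖D‖) +
        6 * R * δ * ((R + c) * (η * ‖D‖) + c * (η * ‖D‖)) := by
    refine (norm_sub_le _ _).trans ?_
    have e1 := norm_add_le (Λ (0, κ)).2 ζ.2
    have e2 : (‖b‖ + c) * ‖κ‖ ≤ (‖b‖ + c) * (η * ‖D‖) := by gcongr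
    have e3 : 6 * R * δ * ((R + c) * ‖κ‖ + c * η * ‖D‖) ≤
      6 * R * δ * ((R + c) * (η * ‖D‖) + c * η * ‖D‖) := by gcongr
    linarith
  rw [k4]
  exact hK.defect_factor (norm_nonneg _) (norm_nonneg a) h.norm_a_le (norm_nonneg b)
    h.norm_mul_le hη hD0 p1 g2 m1

end Defect

/-! ### Parametrizations of manifolds -/

section Parametrization

open Filter

variable {E E' X : Type*} [NormedAddCommGroup E] [NormedSpace ℝ E]
  [NormedAddCommGroup E'] [NormedSpace ℝ E']
  [TopologicalSpace X] [ChartedSpace E X] [IsManifold 𝓘(ℝ, E) 1 X]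

/-- An injective `C^1` map of an open subset of a Banach space into a manifold, with invertible
differentials, is a homeomorphism onto an open set, with a `C^1` inverse. -/
theorem exists_openPartialHomeomorph_of_isInvertible_mfderiv [CompleteSpace E']
    {f : E' → X} {s : Set E'}
    (hs : IsOpen s) (hf : ContMDiffOn 𝓘(ℝ, E') 𝓘(ℝ, E) 1 f s)
    (hinv : ∀ x ∈ s, (mfderiv 𝓘(ℝ, E') 𝓘(ℝ, E) f x).IsInvertible) (hinj : InjOn f s) :
    ∃ e : OpenPartialHomeomorph E' X, e.source = s ∧ (⇑e = f) ∧
      ContMDiffOn 𝓘(ℝ, E) 𝓘(ℝ, E') 1 e.symm e.target := by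
  -- the map read in a chart at a point of the image
  have key : ∀ x ∈ s, ∃ g' : E' ≃L[ℝ] E,
      ContDiffAt ℝ 1 (fun y => chartAt E (f x) (f y)) x ∧
      HasFDerivAt (fun y => chartAt E (f x) (f y)) (g' : E' →L[ℝ] E) x := by
    intro x hx
    have h1 : ContMDiffAt 𝓘(ℝ, E') 𝓘(ℝ, E) 1 f x := (hf x hx).contMDiffAt (hs.mem_nhds hx)
    have h2 : ContMDiffAt 𝓘(ℝ, E) 𝓘(ℝ, E) 1 (extChartAt 𝓘(ℝ, E) (f x)) (f x) :=
      contMDiffAt_extChartAt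
    have h3 : ContMDiffAt 𝓘(ℝ, E') 𝓘(ℝ, E) 1 (fun y => extChartAt 𝓘(ℝ, E) (f x) (f y)) x :=
      h2.comp x h1
    have h4 : (mfderiv 𝓘(ℝ, E') 𝓘(ℝ, E) (fun y => extChartAt 𝓘(ℝ, E) (f x) (f y)) x) =
        (mfderiv 𝓘(ℝ, E) 𝓘(ℝ, E) (extChartAt 𝓘(ℝ, E) (f x)) (f x)).comp
          (mfderiv 𝓘(ℝ, E') 𝓘(ℝ, E) f x) :=
      mfderiv_comp x (h2.mdifferentiableAt one_ne_zero) (h1.mdifferentiableAt one_ne_zero)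
    have h5 : (mfderiv 𝓘(ℝ, E') 𝓘(ℝ, E)
        (fun y => extChartAt 𝓘(ℝ, E) (f x) (f y)) x).IsInvertible := by
      rw [h4]
      exact (isInvertible_mfderiv_extChartAt (mem_extChartAt_source (f x))).comp (hinv x hx)
    rw [mfderiv_eq_fderiv] at h5
    obtain ⟨(g' : E' ≃L[ℝ] E), hg'⟩ := h5
    have h6 : ContDiffAt ℝ 1 (fun y => chartAt E (f x) (f y)) x := by
      simpa using! h3.contDiffAt
    refine ⟨g', h6, ?_⟩
    have h7 := (h6.differentiableAt one_ne_zero).hasFDerivAt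
    have h8 : fderiv ℝ (fun y => chartAt E (f x) (f y)) x = (g' : E' →L[ℝ] E) := hg'.symm
    rwa [h8] at h7
  have hcont : ContinuousOn f s := hf.continuousOn
  have hnhds : ∀ x ∈ s, map f (𝓝 x) = 𝓝 (f x) := by
    intro x hx
    obtain ⟨g', h1, h2⟩ := key x hx
    have h3 : HasStrictFDerivAt (fun y => chartAt E (f x) (f y)) (g' : E' →L[ℝ] E) x :=
      h1.hasStrictFDerivAt' h2 one_ne_zero
    have h4 := h3.map_nhds_eq_of_equiv
    set φ := chartAt E (f x)
    have hfx : f x ∈ φ.source := mem_chart_source E (f x)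
    have h5 : f =ᶠ[𝓝 x] fun y => φ.symm (φ (f y)) := by
      have : ∀ᶠ y in 𝓝 x, f y ∈ φ.source :=
        (hcont.continuousAt (hs.mem_nhds hx)).eventually (φ.open_source.mem_nhds hfx)
      filter_upwards [this] with y hy using (φ.left_inv hy).symm
    have h6 : map φ.symm (𝓝 (φ (f x))) = 𝓝 (f x) := by
      have := φ.symm.map_nhds_eq (x := φ (f x)) (φ.map_source hfx)
      rwa [φ.left_inv hfx] at this
    rw [Filter.map_congr h5]
    change map (φ.symm ∘ fun y => φ (f y)) (𝓝 x) = _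
    rw [← Filter.map_map, h4, h6]
  have hopen : IsOpenMap (s.domRestrict f) := by
    rw [isOpenMap_iff_nhds_le]
    rintro ⟨x, hx⟩
    have h1 : map ((↑) : s → E') (𝓝 ⟨x, hx⟩) = 𝓝 x := hs.isOpenEmbedding_subtypeVal.map_nhds_eq _
    change 𝓝 (f x) ≤ map (f ∘ ((↑) : s → E')) (𝓝 ⟨x, hx⟩)
    rw [← Filter.map_map, h1, hnhds x hx]
  let e₀ : PartialEquiv E' X := hinj.toPartialEquiv f s
  have he₀ : ⇑e₀ = f := rfl
  let e : OpenPartialHomeomorph E' X :=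
    OpenPartialHomeomorph.ofContinuousOpenRestrict e₀ hcont hopen hs
  have hes : e.source = s := rfl
  refine ⟨e, hes, rfl, ?_⟩
  have hef : ⇑e = f := rfl
  intro y hy
  set x := e.symm y with hx
  have hxs : x ∈ s := e.map_target hy
  have hfx : f x = y := e.right_inv hy
  obtain ⟨g', h1, h2⟩ := key x hxs
  set φ := chartAt E (f x)
  have hyφ : y ∈ φ.source := by rw [← hfx]; exact mem_chart_source E (f x)
  have h3 : φ y ∈ (e.trans φ).target := by
    rw [OpenPartialHomeomorph.trans_target]
    refine ⟨φ.map_source hyφ, ?_⟩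
    rw [mem_preimage, φ.left_inv hyφ]; exact hy
  have h4 : (e.trans φ).symm (φ y) = x := by
    simp only [OpenPartialHomeomorph.coe_trans_symm, Function.comp_apply]
    rw [φ.left_inv hyφ]
  have h5 : ContDiffAt ℝ 1 (e.trans φ).symm (φ y) := by
    refine (e.trans φ).contDiffAt_symm (f₀' := g') h3 ?_ ?_ <;> rw [h4]
    · exact h2
    · exact h1
  have h6 : ContMDiffAt 𝓘(ℝ, E) 𝓘(ℝ, E') 1 (fun z => (e.trans φ).symm (φ z)) y :=
    h5.contMDiffAt.comp y (contMDiffAt_of_mem_maximalAtlas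
      (IsManifold.chart_mem_maximalAtlas (f x)) hyφ)
  refine (h6.congr_of_eventuallyEq ?_).contMDiffWithinAt
  filter_upwards [φ.open_source.mem_nhds hyφ] with z hz
  simp only [OpenPartialHomeomorph.coe_trans_symm, Function.comp_apply]
  rw [φ.left_inv hz]

variable [Bundle.RiemannianBundle (fun x : X => TangentSpace 𝓘(ℝ, E) x)]
  [IsContinuousRiemannianBundle E (fun x : X => TangentSpace 𝓘(ℝ, E) x)]

/-- The Riemannian norm is locally bounded by the norm of the representative in a chart. -/
lemma eventually_norm_le_norm_mfderiv_extChartAt (x : X) :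
    ∃ C > 0, ∀ᶠ y in 𝓝 x, ∀ v : TangentSpace 𝓘(ℝ, E) y,
      ‖v‖ ≤ C * norm (E := E) (mfderiv 𝓘(ℝ, E) 𝓘(ℝ, E) (extChartAt 𝓘(ℝ, E) x) y v) := by
  obtain ⟨C, hC, h⟩ := eventually_norm_symmL_trivializationAt_lt E
    (fun x : X => TangentSpace 𝓘(ℝ, E) x) x
  refine ⟨C, hC, ?_⟩
  filter_upwards [h, chart_source_mem_nhds E x] with y hy hys v
  have h1 : (trivializationAt E (TangentSpace 𝓘(ℝ, E)) x).continuousLinearMapAt ℝ y =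
      mfderiv 𝓘(ℝ, E) 𝓘(ℝ, E) (extChartAt 𝓘(ℝ, E) x) y :=
    TangentBundle.continuousLinearMapAt_trivializationAt hys
  have hyb : y ∈ (trivializationAt E (TangentSpace 𝓘(ℝ, E)) x).baseSet := hys
  have h2 := (trivializationAt E (TangentSpace 𝓘(ℝ, E)) x).symmL_continuousLinearMapAt
    (R := ℝ) hyb v
  calc ‖v‖ = ‖(trivializationAt E (TangentSpace 𝓘(ℝ, E)) x).symmL ℝ y
        ((trivializationAt E (TangentSpace 𝓘(ℝ, E)) x).continuousLinearMapAt ℝ y v)‖ := by rw [h2]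
    _ ≤ C * ‖((trivializationAt E (TangentSpace 𝓘(ℝ, E)) x).continuousLinearMapAt ℝ y v : E)‖ :=
      ContinuousLinearMap.le_of_opNorm_le _ hy.le _
    _ = _ := by rw [h1]; rfl

/-- The differentials of a `C^1` map of a normed space into a Riemannian manifold are locally
bounded. -/
lemma ContMDiffAt.eventually_norm_mfderiv_le {f : E' → X} {z : E'}
    (hf : ContMDiffAt 𝓘(ℝ, E') 𝓘(ℝ, E) 1 f z) :
    ∃ C > 0, ∀ᶠ y in 𝓝 z, ∀ v : E', ‖mfderiv 𝓘(ℝ, E') 𝓘(ℝ, E) f y v‖ ≤ C * ‖v‖ := by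
  obtain ⟨C, hC, h⟩ := eventually_norm_le_norm_mfderiv_extChartAt (E := E) (f z)
  have h1 : ContMDiffAt 𝓘(ℝ, E') 𝓘(ℝ, E) 1 (fun y => extChartAt 𝓘(ℝ, E) (f z) (f y)) z :=
    (contMDiffAt_extChartAt (x := f z)).comp z hf
  have h2 : ContinuousAt (fderiv ℝ (fun y => extChartAt 𝓘(ℝ, E) (f z) (f y))) z :=
    (h1.contDiffAt.fderiv_right (m := 0) (by simp)).continuousAt
  set B := ‖fderiv ℝ (fun y => extChartAt 𝓘(ℝ, E) (f z) (f y)) z‖ + 1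
  refine ⟨C * B, by positivity, ?_⟩
  have h3 : ∀ᶠ y in 𝓝 z, ‖fderiv ℝ (fun y => extChartAt 𝓘(ℝ, E) (f z) (f y)) y‖ < B :=
    h2.norm.eventually (gt_mem_nhds (lt_add_one _))
  have h4 : ∀ᶠ y in 𝓝 z, f y ∈ (chartAt E (f z)).source :=
    hf.continuousAt.eventually (chart_source_mem_nhds E (f z))
  have h5 : ∀ᶠ y in 𝓝 z, ContMDiffAt 𝓘(ℝ, E') 𝓘(ℝ, E) 1 f y :=
    (contMDiffAt_iff_contMDiffAt_nhds (by simp)).1 hf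
  filter_upwards [hf.continuousAt.eventually h, h3, h4, h5] with y g1 g2 g3 g4 v
  refine (g1 _).trans ?_
  rw [mul_assoc]
  gcongr
  have h6 : mfderiv 𝓘(ℝ, E') 𝓘(ℝ, E) (fun y => extChartAt 𝓘(ℝ, E) (f z) (f y)) y =
      (mfderiv 𝓘(ℝ, E) 𝓘(ℝ, E) (extChartAt 𝓘(ℝ, E) (f z)) (f y)).comp
        (mfderiv 𝓘(ℝ, E') 𝓘(ℝ, E) f y) :=
    mfderiv_comp y (mdifferentiableAt_extChartAt g3) (g4.mdifferentiableAt one_ne_zero)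
  have h7 : (mfderiv 𝓘(ℝ, E) 𝓘(ℝ, E) (extChartAt 𝓘(ℝ, E) (f z)) (f y)
      (mfderiv 𝓘(ℝ, E') 𝓘(ℝ, E) f y v) : E) =
      fderiv ℝ (fun y => extChartAt 𝓘(ℝ, E) (f z) (f y)) y v := by
    rw [← mfderiv_eq_fderiv, h6]; rfl
  rw [h7]
  exact ContinuousLinearMap.le_of_opNorm_le _ g2.le v

end Parametrization

/-! ### Perturbations of a map in the `C^1` sense -/

section Perturbations

open Filter

variable {E X : Type*} [NormedAddCommGroup E] [InnerProductSpace ℝ E]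
  [EMetricSpace X] [ChartedSpace E X]
  [Bundle.RiemannianBundle (fun x : X => TangentSpace 𝓘(ℝ, E) x)]
  {a : ℕ} {χ : Fin a → OpenPartialHomeomorph X E} {V : Set X} {S : X → X}

lemma C1CloseOn.mono {ν ν' : ℝ} {T : X → X} (h : C1CloseOn χ V ν S T) (hν : ν ≤ ν') :
    C1CloseOn χ V ν' S T := fun x hx =>
  ⟨(h x hx).1.trans (ENNReal.ofReal_le_ofReal hν), fun b h1 h2 => ((h x hx).2 b h1 h2).trans hν⟩

/-- The filter of neighbourhoods of `S` in the `C^1` sense, on maps that are `C^1` on `V`. -/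
def perturbations (χ : Fin a → OpenPartialHomeomorph X E) (V : Set X) (S : X → X) :
    Filter (X → X) :=
  ⨅ ν ∈ Ioi (0 : ℝ), 𝓟 {T | ContMDiffOn 𝓘(ℝ, E) 𝓘(ℝ, E) 1 T V ∧ C1CloseOn χ V ν S T}

lemma hasBasis_perturbations :
    (perturbations χ V S).HasBasis (fun ν : ℝ => ν ∈ Ioi (0 : ℝ))
      (fun ν => {T | ContMDiffOn 𝓘(ℝ, E) 𝓘(ℝ, E) 1 T V ∧ C1CloseOn χ V ν S T}) := by
  refine hasBasis_biInf_principal' ?_ ⟨1, mem_Ioi.2 one_pos⟩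
  intro ν hν ν' hν'
  exact ⟨min ν ν', mem_Ioi.2 (lt_min (mem_Ioi.1 hν) (mem_Ioi.1 hν')),
    fun T hT => ⟨hT.1, hT.2.mono (min_le_left _ _)⟩,
    fun T hT => ⟨hT.1, hT.2.mono (min_le_right _ _)⟩⟩

lemma eventually_perturbations_iff {p : (X → X) → Prop} :
    (∀ᶠ T in perturbations χ V S, p T) ↔ ∃ ν > 0, ∀ T : X → X,
      ContMDiffOn 𝓘(ℝ, E) 𝓘(ℝ, E) 1 T V → C1CloseOn χ V ν S T → p T := by
  rw [hasBasis_perturbations.eventually_iff]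
  exact ⟨fun ⟨ν, h, H⟩ => ⟨ν, h, fun T h1 h2 => H ⟨h1, h2⟩⟩,
    fun ⟨ν, h, H⟩ => ⟨ν, h, fun T hT => H T hT.1 hT.2⟩⟩

lemma eventually_contMDiffOn_perturbations :
    ∀ᶠ T in perturbations χ V S, ContMDiffOn 𝓘(ℝ, E) 𝓘(ℝ, E) 1 T V :=
  eventually_perturbations_iff.2 ⟨1, one_pos, fun _ h _ => h⟩

lemma eventually_c1CloseOn_perturbations {ν : ℝ} (hν : 0 < ν) :
    ∀ᶠ T in perturbations χ V S, C1CloseOn χ V ν S T :=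
  eventually_perturbations_iff.2 ⟨ν, hν, fun _ _ h => h⟩

/-- Evaluation is jointly continuous at `S`. -/
lemma tendsto_apply_perturbations (hV : IsOpen V) {x : X} (hx : x ∈ V) (hS : ContinuousAt S x) :
    Tendsto (fun q : (X → X) × X => q.1 q.2) (perturbations χ V S ×ˢ 𝓝 x) (𝓝 (S x)) := by
  rw [EMetric.tendsto_nhds]
  intro ε hε
  obtain ⟨ν, hν0, hν⟩ : ∃ ν : ℝ, 0 < ν ∧ ENNReal.ofReal ν < ε / 2 := by
    obtain ⟨r, hr, hr'⟩ := ENNReal.lt_iff_exists_nnreal_btwn.1 (ENNReal.half_pos hε.ne')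
    refine ⟨r, by exact_mod_cast hr, by simpa using hr'⟩
  have h1 : ∀ᶠ y in 𝓝 x, edist (S y) (S x) < ε / 2 :=
    (EMetric.tendsto_nhds.1 hS) _ (ENNReal.half_pos hε.ne')
  have h2 := (eventually_c1CloseOn_perturbations (χ := χ) (V := V) (S := S) hν0).prod_mk
    (h1.and (hV.mem_nhds hx))
  filter_upwards [h2] with q hq
  calc edist (q.1 q.2) (S x) ≤ edist (q.1 q.2) (S q.2) + edist (S q.2) (S x) :=
        edist_triangle _ _ _
    _ < ε / 2 + ε / 2 := by
        refine ENNReal.add_lt_add ?_ hq.2.1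
        rw [edist_comm]
        exact ((hq.1 q.2 hq.2.2).1).trans_lt hν
    _ = ε := ENNReal.add_halves ε

lemma tendsto_comp_perturbations {Z : Type*} [TopologicalSpace Z] (hV : IsOpen V) {H : Z → X}
    {z : Z} (hH : ContinuousAt H z) (hz : H z ∈ V) (hS : ContinuousAt S (H z)) :
    Tendsto (fun q : (X → X) × Z => q.1 (H q.2)) (perturbations χ V S ×ˢ 𝓝 z) (𝓝 (S (H z))) :=
  (tendsto_apply_perturbations hV hz hS).comp (tendsto_id.prodMap hH)

variable [IsManifold 𝓘(ℝ, E) 1 X]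
  [IsContinuousRiemannianBundle E (fun x : X => TangentSpace 𝓘(ℝ, E) x)]
  {E' E'' : Type*} [NormedAddCommGroup E'] [NormedSpace ℝ E']
  [NormedAddCommGroup E''] [NormedSpace ℝ E'']

/-- In a chart of the target, the differential of a perturbation of `S`, composed with a
parametrization `H`, is jointly continuous at `S`. -/
lemma tendsto_fderiv_chart_perturbations (hV : IsOpen V) (hS : ContMDiff 𝓘(ℝ, E) 𝓘(ℝ, E) 1 S)
    (hχ : ∀ b, χ b ∈ IsManifold.maximalAtlas 𝓘(ℝ, E) 1 X) {H : E' → X} {z : E'}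
    (hH : ContMDiffAt 𝓘(ℝ, E') 𝓘(ℝ, E) 1 H z) (hz : H z ∈ V) {b : Fin a}
    (hb : S (H z) ∈ (χ b).source) :
    (∀ᶠ q in perturbations χ V S ×ˢ 𝓝 z, q.1 (H q.2) ∈ (χ b).source ∧
      ContDiffAt ℝ 1 (fun y => χ b (q.1 (H y))) q.2) ∧
    Tendsto (fun q : (X → X) × E' => fderiv ℝ (fun y => χ b (q.1 (H y))) q.2)
      (perturbations χ V S ×ˢ 𝓝 z) (𝓝 (fderiv ℝ (fun y => χ b (S (H y))) z)) := by
  have hlim := tendsto_comp_perturbations (χ := χ) hV hH.continuousAt hz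
    hS.continuous.continuousAt
  have h1 : ∀ᶠ q in perturbations χ V S ×ˢ 𝓝 z, q.1 (H q.2) ∈ (χ b).source :=
    hlim.eventually ((χ b).open_source.mem_nhds hb)
  have h2 : ∀ᶠ y in 𝓝 z, H y ∈ V := hH.continuousAt.eventually (hV.mem_nhds hz)
  have h3 : ∀ᶠ y in 𝓝 z, ContMDiffAt 𝓘(ℝ, E') 𝓘(ℝ, E) 1 H y :=
    (contMDiffAt_iff_contMDiffAt_nhds (by simp)).1 hH
  have h4 : ∀ᶠ y in 𝓝 z, S (H y) ∈ (χ b).source :=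
    (hS.continuous.continuousAt.comp hH.continuousAt).eventually ((χ b).open_source.mem_nhds hb)
  have hprod := (eventually_contMDiffOn_perturbations (χ := χ) (V := V) (S := S)).prod_mk
    (h2.and (h3.and h4))
  have hmain : ∀ᶠ q in perturbations χ V S ×ˢ 𝓝 z, q.1 (H q.2) ∈ (χ b).source ∧
      ContDiffAt ℝ 1 (fun y => χ b (q.1 (H y))) q.2 := by
    filter_upwards [h1, hprod] with q g1 ⟨g2, g3, g4, _⟩
    refine ⟨g1, ContMDiffAt.contDiffAt ?_⟩
    exact (contMDiffAt_of_mem_maximalAtlas (hχ b) g1).comp q.2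
      ((g2.contMDiffAt (hV.mem_nhds g3)).comp q.2 g4)
  refine ⟨hmain, ?_⟩
  have hSd : ContDiffAt ℝ 1 (fun y => χ b (S (H y))) z := ContMDiffAt.contDiffAt
    ((contMDiffAt_of_mem_maximalAtlas (hχ b) hb).comp z (hS.contMDiffAt.comp z hH))
  have hc : ContinuousAt (fderiv ℝ (fun y => χ b (S (H y)))) z :=
    (hSd.fderiv_right (m := 0) (by simp)).continuousAt
  obtain ⟨C, hC, hHC⟩ := hH.eventually_norm_mfderiv_le
  rw [Metric.tendsto_nhds]
  intro ε hε
  have g0 : ∀ᶠ y in 𝓝 z, dist (fderiv ℝ (fun y => χ b (S (H y))) y)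
      (fderiv ℝ (fun y => χ b (S (H y))) z) < ε / 2 := (Metric.tendsto_nhds.1 hc) _ (half_pos hε)
  have hν : 0 < ε / (2 * C) := by positivity
  have hcl := (eventually_c1CloseOn_perturbations (χ := χ) (V := V) (S := S) hν).prod_mk
    (hHC.and g0)
  filter_upwards [h1, hprod, hcl] with q k1 ⟨k2, k3, k4, k5⟩ ⟨k6, k7, k8⟩
  refine (dist_triangle _ (fderiv ℝ (fun y => χ b (S (H y))) q.2) _).trans_lt ?_
  suffices dist (fderiv ℝ (fun y => χ b (q.1 (H y))) q.2)
      (fderiv ℝ (fun y => χ b (S (H y))) q.2) ≤ ε / 2 by linarith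
  have hcomp : ∀ T : X → X, ContMDiffAt 𝓘(ℝ, E) 𝓘(ℝ, E) 1 T (H q.2) →
      T (H q.2) ∈ (χ b).source → ∀ v, fderiv ℝ (fun y => χ b (T (H y))) q.2 v =
        chartDiff (χ b) T (H q.2) (mfderiv 𝓘(ℝ, E') 𝓘(ℝ, E) H q.2 v) := by
    intro T hT hTs v
    have e1 : ContMDiffAt 𝓘(ℝ, E) 𝓘(ℝ, E) 1 (fun y => χ b (T y)) (H q.2) :=
      (contMDiffAt_of_mem_maximalAtlas (hχ b) hTs).comp _ hT
    have e2 : mfderiv 𝓘(ℝ, E') 𝓘(ℝ, E) ((fun y => χ b (T y)) ∘ H) q.2 =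
        (mfderiv 𝓘(ℝ, E) 𝓘(ℝ, E) (fun y => χ b (T y)) (H q.2)).comp
          (mfderiv 𝓘(ℝ, E') 𝓘(ℝ, E) H q.2) :=
      mfderiv_comp q.2 (e1.mdifferentiableAt one_ne_zero) (k4.mdifferentiableAt one_ne_zero)
    rw [mfderiv_eq_fderiv] at e2
    change fderiv ℝ ((fun y => χ b (T y)) ∘ H) q.2 v = _
    rw [e2]
    rfl
  rw [dist_eq_norm]
  refine ContinuousLinearMap.opNorm_le_bound _ (half_pos hε).le fun v => ?_
  rw [sub_apply, hcomp q.1 (k2.contMDiffAt (hV.mem_nhds k3)) k1 v,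
    hcomp S hS.contMDiffAt k5 v, ← sub_apply, ← norm_neg, ← neg_apply, neg_sub]
  have e3 := (k6 (H q.2) k3).2 b k5 k1
  calc _ ≤ ε / (2 * C) * ‖mfderiv 𝓘(ℝ, E') 𝓘(ℝ, E) H q.2 v‖ :=
        ContinuousLinearMap.le_of_opNorm_le _ e3 _
    _ ≤ ε / (2 * C) * (C * ‖v‖) := by gcongr; exact k7 v
    _ = ε / 2 * ‖v‖ := by field_simp

/-- The differentials of the maps `K ∘ T ∘ H` are jointly continuous at `T = S`. -/
lemma tendsto_fderiv_comp_perturbations (hV : IsOpen V) (hS : ContMDiff 𝓘(ℝ, E) 𝓘(ℝ, E) 1 S)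
    (hχ : ∀ b, χ b ∈ IsManifold.maximalAtlas 𝓘(ℝ, E) 1 X) {H : E' → X} {z : E'}
    (hH : ContMDiffAt 𝓘(ℝ, E') 𝓘(ℝ, E) 1 H z) (hz : H z ∈ V) {b : Fin a}
    (hb : S (H z) ∈ (χ b).source) {K : X → E''}
    (hK : ContMDiffAt 𝓘(ℝ, E) 𝓘(ℝ, E'') 1 K (S (H z))) :
    (∀ᶠ q in perturbations χ V S ×ˢ 𝓝 z, ContDiffAt ℝ 1 (fun y => K (q.1 (H y))) q.2) ∧
    Tendsto (fun q : (X → X) × E' => fderiv ℝ (fun y => K (q.1 (H y))) q.2)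
      (perturbations χ V S ×ˢ 𝓝 z) (𝓝 (fderiv ℝ (fun y => K (S (H y))) z)) := by
  obtain ⟨h1, h2⟩ := tendsto_fderiv_chart_perturbations hV hS hχ hH hz hb
  set φ := χ b with hφ
  let k : E → E'' := fun w => K (φ.symm w)
  have hlim : Tendsto (fun q : (X → X) × E' => φ (q.1 (H q.2)))
      (perturbations χ V S ×ˢ 𝓝 z) (𝓝 (φ (S (H z)))) :=
    (φ.continuousAt hb).tendsto.comp (tendsto_comp_perturbations hV hH.continuousAt hz
      hS.continuous.continuousAt)
  have hk : ContDiffAt ℝ 1 k (φ (S (H z))) := by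
    refine ContMDiffAt.contDiffAt ?_
    have e1 : ContMDiffAt 𝓘(ℝ, E) 𝓘(ℝ, E) 1 φ.symm (φ (S (H z))) :=
      contMDiffAt_symm_of_mem_maximalAtlas (hχ b) (φ.map_source hb)
    refine ContMDiffAt.comp (φ (S (H z))) ?_ e1
    rwa [φ.left_inv hb]
  have hk' : ∀ᶠ w in 𝓝 (φ (S (H z))), ContDiffAt ℝ 1 k w := hk.eventually (by simp)
  have hkc : ContinuousAt (fderiv ℝ k) (φ (S (H z))) :=
    (hk.fderiv_right (m := 0) (by simp)).continuousAt
  -- near `q.2` the map `K ∘ T ∘ H` factors through the chart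
  have hloc : ∀ T : X → X, ∀ y : E', T (H y) ∈ φ.source →
      ContDiffAt ℝ 1 (fun y => φ (T (H y))) y → ContinuousAt (fun y => T (H y)) y →
      (fun y => K (T (H y))) =ᶠ[𝓝 y] fun y => k (φ (T (H y))) := by
    intro T y e1 _ e3
    filter_upwards [e3.eventually (φ.open_source.mem_nhds e1)] with w hw
    change _ = K (φ.symm (φ (T (H w))))
    rw [φ.left_inv hw]
  have hcT : ∀ᶠ q in perturbations χ V S ×ˢ 𝓝 z, ContinuousAt (fun y => q.1 (H y)) q.2 := by
    have g2 : ∀ᶠ y in 𝓝 z, H y ∈ V := hH.continuousAt.eventually (hV.mem_nhds hz)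
    have g3 : ∀ᶠ y in 𝓝 z, ContMDiffAt 𝓘(ℝ, E') 𝓘(ℝ, E) 1 H y :=
      (contMDiffAt_iff_contMDiffAt_nhds (by simp)).1 hH
    filter_upwards [(eventually_contMDiffOn_perturbations (χ := χ) (V := V) (S := S)).prod_mk
      (g2.and g3)] with q ⟨l1, l2, l3⟩
    exact ContinuousAt.comp (g := q.1) (l1.contMDiffAt (hV.mem_nhds l2)).continuousAt
      l3.continuousAt
  have hall : ∀ᶠ q in perturbations χ V S ×ˢ 𝓝 z,
      ContDiffAt ℝ 1 (fun y => K (q.1 (H y))) q.2 ∧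
      fderiv ℝ (fun y => K (q.1 (H y))) q.2 =
        (fderiv ℝ k (φ (q.1 (H q.2)))).comp (fderiv ℝ (fun y => φ (q.1 (H y))) q.2) := by
    filter_upwards [h1, hlim.eventually hk', hcT] with q ⟨g1, g2⟩ g3 g4
    have e := hloc q.1 q.2 g1 g2 g4
    refine ⟨(ContDiffAt.comp (f := fun y => φ (q.1 (H y))) (g := k) q.2 g3
      g2).congr_of_eventuallyEq e, ?_⟩
    rw [e.fderiv_eq]
    exact fderiv_comp (g := k) (f := fun y => φ (q.1 (H y))) q.2
      (g3.differentiableAt one_ne_zero) (g2.differentiableAt one_ne_zero)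
  refine ⟨hall.mono fun q hq => hq.1, ?_⟩
  have hSd : ContDiffAt ℝ 1 (fun y => φ (S (H y))) z := ContMDiffAt.contDiffAt
    ((contMDiffAt_of_mem_maximalAtlas (hχ b) hb).comp z (hS.contMDiffAt.comp z hH))
  have hval : fderiv ℝ (fun y => K (S (H y))) z =
      (fderiv ℝ k (φ (S (H z)))).comp (fderiv ℝ (fun y => φ (S (H y))) z) := by
    have e := hloc S z hb hSd (hS.continuous.continuousAt.comp hH.continuousAt)
    rw [e.fderiv_eq]
    exact fderiv_comp (g := k) (f := fun y => φ (S (H y))) z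
      (hk.differentiableAt one_ne_zero) (hSd.differentiableAt one_ne_zero)
  rw [hval]
  refine Tendsto.congr' (hall.mono fun q hq => hq.2.symm) ?_
  exact ((continuous_fst.clm_comp continuous_snd).tendsto
    (fderiv ℝ k (φ (S (H z))), fderiv ℝ (fun y => φ (S (H y))) z)).comp
    ((hkc.tendsto.comp hlim).prodMk_nhds h2)

end Perturbations

/-! ### Tubular coordinates -/

section Tube

open Filter

set_option linter.unusedSectionVars false

variable {E P F X M' : Type*}
  [NormedAddCommGroup E] [InnerProductSpace ℝ E]
  [NormedAddCommGroup P] [InnerProductSpace ℝ P] [FiniteDimensional ℝ P]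
  [NormedAddCommGroup F] [InnerProductSpace ℝ F] [CompleteSpace F]
  [EMetricSpace X] [ChartedSpace E X] [IsManifold 𝓘(ℝ, E) 1 X]
  [Bundle.RiemannianBundle (fun x : X => TangentSpace 𝓘(ℝ, E) x)]
  [TopologicalSpace M'] [ChartedSpace P M'] [IsManifold 𝓘(ℝ, P) 1 M']
  [Bundle.RiemannianBundle (fun p : M' => TangentSpace 𝓘(ℝ, P) p)]
  {n : WithTop ℕ∞} {D : NegInvariantManifold E P X M' n} (N : NormalBundleCover F D)
  {ρ : ℝ} {h : TangentBundle 𝓘(ℝ, E) X → X}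

namespace NormalBundleCover

/-- The tubular coordinates over the patch of index `i`: the base point is read in the chart `σ i`
of `M'` and the normal vector in the trivialization `e i`. -/
noncomputable def tube (h : TangentBundle 𝓘(ℝ, E) X → X) (i : Fin N.s) (z : P × F) : X :=
  h ⟨D.ι ((N.σ i).symm z.1), N.e i ((N.σ i).symm z.1) z.2⟩

lemma Q_eq_self_of_mem_fiber {p : M'} {v : TangentSpace 𝓘(ℝ, E) (D.ι p)}
    (hv : v ∈ N.fiber (D.ι p)) : N.Q (D.ι p) v = v := by
  obtain ⟨w, rfl⟩ := hv
  exact N.Q_idem p w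

lemma mem_fiber_of_Q_eq_self {p : M'} {v : TangentSpace 𝓘(ℝ, E) (D.ι p)}
    (hv : N.Q (D.ι p) v = v) : v ∈ N.fiber (D.ι p) := ⟨v, hv⟩

lemma e_mem_fiber (i : Fin N.s) {x : P} (hx : x ∈ Metric.ball (0 : P) N.J) (y : F) :
    N.e i ((N.σ i).symm x) y ∈ N.fiber (D.ι ((N.σ i).symm x)) :=
  N.mem_fiber_of_Q_eq_self (N.e_mem i x hx y)

lemma e_loc (i : Fin N.s) {x : P} (hx : x ∈ Metric.ball (0 : P) N.J)
    {u : ∀ p : M', TangentSpace 𝓘(ℝ, E) (D.ι p)}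
    (hu : u ((N.σ i).symm x) ∈ N.fiber (D.ι ((N.σ i).symm x))) :
    N.e i ((N.σ i).symm x) (N.loc u i x) = u ((N.σ i).symm x) :=
  N.e_ψ i x hx _ (N.Q_eq_self_of_mem_fiber hu)

lemma norm_loc (i : Fin N.s) {x : P} (hx : x ∈ Metric.ball (0 : P) N.J)
    {u : ∀ p : M', TangentSpace 𝓘(ℝ, E) (D.ι p)}
    (hu : u ((N.σ i).symm x) ∈ N.fiber (D.ι ((N.σ i).symm x))) :
    ‖N.loc u i x‖ = ‖u ((N.σ i).symm x)‖ := by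
  rw [← N.norm_e i x hx, N.e_loc i hx hu]

lemma norm_loc_sub_loc (i : Fin N.s) {x : P} (hx : x ∈ Metric.ball (0 : P) N.J)
    {u v : ∀ p : M', TangentSpace 𝓘(ℝ, E) (D.ι p)}
    (hu : u ((N.σ i).symm x) ∈ N.fiber (D.ι ((N.σ i).symm x)))
    (hv : v ((N.σ i).symm x) ∈ N.fiber (D.ι ((N.σ i).symm x))) :
    ‖N.loc u i x - N.loc v i x‖ = ‖u ((N.σ i).symm x) - v ((N.σ i).symm x)‖ := by
  rw [← N.norm_e i x hx, map_sub, N.e_loc i hx hu, N.e_loc i hx hv]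

lemma graph_eq_tube (i : Fin N.s) {x : P} (hx : x ∈ Metric.ball (0 : P) N.J)
    {u : ∀ p : M', TangentSpace 𝓘(ℝ, E) (D.ι p)}
    (hu : u ((N.σ i).symm x) ∈ N.fiber (D.ι ((N.σ i).symm x))) :
    D.graph h u ((N.σ i).symm x) = N.tube h i (x, N.loc u i x) := by
  simp only [NegInvariantManifold.graph, tube, N.e_loc i hx hu]

lemma injOn_symm (i : Fin N.s) : InjOn (N.σ i).symm (Metric.ball (0 : P) N.J) :=
  (N.σ i).symm.injOn.mono (N.ball_subset i)

lemma mem_U_iff (i : Fin N.s) {r : ℝ} (hr : r ≤ N.J) {p : M'} :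
    p ∈ N.U i r ↔ p ∈ (N.σ i).source ∧ N.σ i p ∈ Metric.ball (0 : P) r := by
  constructor
  · rintro ⟨x, hx, rfl⟩
    have hx' : x ∈ (N.σ i).target := N.ball_subset i (Metric.ball_subset_ball hr hx)
    exact ⟨(N.σ i).map_target hx', by rwa [(N.σ i).right_inv hx']⟩
  · rintro ⟨h1, h2⟩
    exact ⟨N.σ i p, h2, (N.σ i).left_inv h1⟩

lemma isOpen_U (i : Fin N.s) {r : ℝ} (hr : r ≤ N.J) : IsOpen (N.U i r) :=
  (N.σ i).symm.isOpen_image_of_subset_source Metric.isOpen_ball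
    ((Metric.ball_subset_ball hr).trans (N.ball_subset i))

lemma J_ge : (6 : ℝ) ≤ N.J := by exact_mod_cast N.six_le_J

lemma isOpen_base : IsOpen N.base :=
  isOpen_iUnion fun i => N.isOpen_U i (by linarith)

lemma U_subset_base (i : Fin N.s) {r : ℝ} (hr : r ≤ (N.J : ℝ) - 3) : N.U i r ⊆ N.base :=
  (image_mono (Metric.ball_subset_ball hr)).trans
    (subset_iUnion (fun i => N.U i ((N.J : ℝ) - 3)) i)

lemma Mbar_subset_base : D.Mbar ⊆ N.base := by
  intro p hp
  obtain ⟨i, hi⟩ := N.cover p hp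
  exact N.U_subset_base i (by linarith [N.J_ge]) hi

/-- The tubular coordinates determine the point of the normal bundle. -/
lemma eq_of_tube_eq (hh : N.IsTubular ρ h) {i j : Fin N.s} {z w : P × F}
    (hz : z ∈ Metric.ball (0 : P) N.J ×ˢ Metric.ball (0 : F) ρ)
    (hw : w ∈ Metric.ball (0 : P) N.J ×ˢ Metric.ball (0 : F) ρ)
    (hzw : N.tube h i z = N.tube h j w) :
    (⟨D.ι ((N.σ i).symm z.1), N.e i ((N.σ i).symm z.1) z.2⟩ : TangentBundle 𝓘(ℝ, E) X) =
      ⟨D.ι ((N.σ j).symm w.1), N.e j ((N.σ j).symm w.1) w.2⟩ := by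
  refine hh.injOn ?_ ?_ hzw
  · exact ⟨_, mem_iUnion.2 ⟨i, _, hz.1, rfl⟩, _, N.e_mem_fiber i hz.1 _,
      by rw [N.norm_e i _ hz.1]; simpa using hz.2, rfl⟩
  · exact ⟨_, mem_iUnion.2 ⟨j, _, hw.1, rfl⟩, _, N.e_mem_fiber j hw.1 _,
      by rw [N.norm_e j _ hw.1]; simpa using hw.2, rfl⟩

lemma injOn_tube (hh : N.IsTubular ρ h) (i : Fin N.s) :
    InjOn (N.tube h i) (Metric.ball (0 : P) N.J ×ˢ Metric.ball (0 : F) ρ) := by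
  rintro ⟨x, y⟩ hz ⟨x', y'⟩ hw hzw
  have h1 := N.eq_of_tube_eq hh hz hw hzw
  have h2 : x = x' := by
    refine N.injOn_symm i hz.1 hw.1 (D.isEmbedding_ι.injective ?_)
    exact congrArg Bundle.TotalSpace.proj h1
  subst h2
  have h3 : N.e i ((N.σ i).symm x) y = N.e i ((N.σ i).symm x) y' :=
    Bundle.TotalSpace.mk_injective _ h1
  have h4 := congrArg (N.ψ i ((N.σ i).symm x)) h3
  rw [N.ψ_e i x hz.1, N.ψ_e i x hz.1] at h4
  rw [h4]

lemma exists_tubeHomeo (hh : N.IsTubular ρ h) (i : Fin N.s) :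
    ∃ e : OpenPartialHomeomorph (P × F) X,
      e.source = Metric.ball (0 : P) N.J ×ˢ Metric.ball (0 : F) ρ ∧ ⇑e = N.tube h i ∧
      ContMDiffOn 𝓘(ℝ, E) 𝓘(ℝ, P × F) 1 e.symm e.target := by
  have : CompleteSpace P := FiniteDimensional.complete ℝ P
  exact exists_openPartialHomeomorph_of_isInvertible_mfderiv
    (Metric.isOpen_ball.prod Metric.isOpen_ball) (hh.contMDiffOn i) (hh.invertible i)
    (N.injOn_tube hh i)

/-- The tubular coordinates as a homeomorphism onto an open subset of `X`. -/
noncomputable def tubeHomeo (hh : N.IsTubular ρ h) (i : Fin N.s) :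
    OpenPartialHomeomorph (P × F) X :=
  (N.exists_tubeHomeo hh i).choose

lemma tubeHomeo_source (hh : N.IsTubular ρ h) (i : Fin N.s) :
    (N.tubeHomeo hh i).source = Metric.ball (0 : P) N.J ×ˢ Metric.ball (0 : F) ρ :=
  (N.exists_tubeHomeo hh i).choose_spec.1

lemma coe_tubeHomeo (hh : N.IsTubular ρ h) (i : Fin N.s) :
    ⇑(N.tubeHomeo hh i) = N.tube h i :=
  (N.exists_tubeHomeo hh i).choose_spec.2.1

lemma contMDiffOn_tubeHomeo_symm (hh : N.IsTubular ρ h) (i : Fin N.s) :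
    ContMDiffOn 𝓘(ℝ, E) 𝓘(ℝ, P × F) 1 (N.tubeHomeo hh i).symm (N.tubeHomeo hh i).target :=
  (N.exists_tubeHomeo hh i).choose_spec.2.2

lemma contMDiffAt_tube (hh : N.IsTubular ρ h) (i : Fin N.s) {z : P × F}
    (hz : z ∈ Metric.ball (0 : P) N.J ×ˢ Metric.ball (0 : F) ρ) :
    ContMDiffAt 𝓘(ℝ, P × F) 𝓘(ℝ, E) 1 (N.tube h i) z :=
  (hh.contMDiffOn i).contMDiffAt ((Metric.isOpen_ball.prod Metric.isOpen_ball).mem_nhds hz)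

lemma tube_mem_target (hh : N.IsTubular ρ h) (i : Fin N.s) {z : P × F}
    (hz : z ∈ Metric.ball (0 : P) N.J ×ˢ Metric.ball (0 : F) ρ) :
    N.tube h i z ∈ (N.tubeHomeo hh i).target := by
  rw [← N.coe_tubeHomeo hh i]
  exact (N.tubeHomeo hh i).map_source (by rwa [N.tubeHomeo_source hh i])

lemma tubeHomeo_symm_tube (hh : N.IsTubular ρ h) (i : Fin N.s) {z : P × F}
    (hz : z ∈ Metric.ball (0 : P) N.J ×ˢ Metric.ball (0 : F) ρ) :
    (N.tubeHomeo hh i).symm (N.tube h i z) = z := by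
  rw [← N.coe_tubeHomeo hh i]
  exact (N.tubeHomeo hh i).left_inv (by rwa [N.tubeHomeo_source hh i])

lemma tube_tubeHomeo_symm (hh : N.IsTubular ρ h) (i : Fin N.s) {y : X}
    (hy : y ∈ (N.tubeHomeo hh i).target) : N.tube h i ((N.tubeHomeo hh i).symm y) = y := by
  rw [← N.coe_tubeHomeo hh i]
  exact (N.tubeHomeo hh i).right_inv hy

lemma tubeHomeo_symm_mem (hh : N.IsTubular ρ h) (i : Fin N.s) {y : X}
    (hy : y ∈ (N.tubeHomeo hh i).target) : (N.tubeHomeo hh i).symm y ∈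
      Metric.ball (0 : P) N.J ×ˢ Metric.ball (0 : F) ρ := by
  rw [← N.tubeHomeo_source hh i]; exact (N.tubeHomeo hh i).map_target hy

lemma zero_mem_prod (hh : N.IsTubular ρ h) {x : P} (hx : x ∈ Metric.ball (0 : P) N.J) :
    (x, (0 : F)) ∈ Metric.ball (0 : P) N.J ×ˢ Metric.ball (0 : F) ρ :=
  ⟨hx, Metric.mem_ball_self hh.pos⟩

lemma tube_zero (hh : N.IsTubular ρ h) (i : Fin N.s) {x : P}
    (hx : x ∈ Metric.ball (0 : P) N.J) : N.tube h i (x, 0) = D.ι ((N.σ i).symm x) := by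
  simp only [tube, map_zero]
  exact hh.zero i _ ⟨x, hx, rfl⟩

/-- The differential of the tubular coordinates at the zero section, in the direction of the
fibre. -/
lemma mfderiv_tube_snd (hh : N.IsTubular ρ h) (i : Fin N.s) {x : P}
    (hx : x ∈ Metric.ball (0 : P) N.J) (y : F) :
    (mfderiv 𝓘(ℝ, P × F) 𝓘(ℝ, E) (N.tube h i) (x, 0) ((0 : P), y) : E) =
      N.e i ((N.σ i).symm x) y := by
  have h1 := hh.normal i ((N.σ i).symm x) ⟨x, hx, rfl⟩ _ (N.e_mem_fiber i hx y)
  rw [← h1]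
  have h2 : (fun t : ℝ => h ⟨D.ι ((N.σ i).symm x), t • N.e i ((N.σ i).symm x) y⟩) =
      N.tube h i ∘ fun t : ℝ => (x, t • y) := by
    ext t
    simp only [tube, Function.comp_apply, map_smul]
  rw [h2]
  have h3 : HasFDerivAt (fun t : ℝ => (x, t • y))
      ((0 : ℝ →L[ℝ] P).prod (ContinuousLinearMap.toSpanSingleton ℝ y)) 0 :=
    (hasFDerivAt_const x (0 : ℝ)).prodMk
      (ContinuousLinearMap.toSpanSingleton ℝ y).hasFDerivAt
  have h4 : (fun t : ℝ => (x, t • y)) 0 = (x, (0 : F)) := by simp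
  let L : P × F →L[ℝ] E := mfderiv 𝓘(ℝ, P × F) 𝓘(ℝ, E) (N.tube h i) (x, 0)
  have h5 : HasMFDerivAt 𝓘(ℝ, P × F) 𝓘(ℝ, E) (N.tube h i) ((fun t : ℝ => (x, t • y)) 0) L := by
    rw [h4]
    exact ((N.contMDiffAt_tube hh i (N.zero_mem_prod hh hx)).mdifferentiableAt
      one_ne_zero).hasMFDerivAt
  have h6 := (h5.comp (0 : ℝ) h3.hasMFDerivAt).mfderiv
  rw [h6]
  change L ((0 : P), y) = L ((0 : P), (1 : ℝ) • y)
  rw [one_smul]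

/-- The differential of the tubular coordinates at the zero section, in the direction of the
base, is tangent to `M'`. -/
lemma Q_mfderiv_tube_fst (hh : N.IsTubular ρ h) (hσ : ∀ i, N.σ i ∈
      IsManifold.maximalAtlas 𝓘(ℝ, P) 1 M') (hι : ContMDiff 𝓘(ℝ, P) 𝓘(ℝ, E) 1 D.ι)
    (i : Fin N.s) {x : P} (hx : x ∈ Metric.ball (0 : P) N.J) (ξ : P) :
    N.Q (D.ι ((N.σ i).symm x))
      (mfderiv 𝓘(ℝ, P × F) 𝓘(ℝ, E) (N.tube h i) (x, 0) (ξ, (0 : F)) : E) = 0 := by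
  have hxt := N.ball_subset i hx
  have h1 : ContMDiffAt 𝓘(ℝ, P) 𝓘(ℝ, P) 1 (N.σ i).symm x :=
    contMDiffAt_symm_of_mem_maximalAtlas (hσ i) hxt
  have h2 : (fun t : P => N.tube h i (t, 0)) =ᶠ[𝓝 x] D.ι ∘ (N.σ i).symm := by
    filter_upwards [Metric.isOpen_ball.mem_nhds hx] with t ht using N.tube_zero hh i ht
  have h3 : HasFDerivAt (fun t : P => (t, (0 : F))) (ContinuousLinearMap.inl ℝ P F) x :=
    (ContinuousLinearMap.inl ℝ P F).hasFDerivAt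
  have h4 := mfderiv_comp (I := 𝓘(ℝ, P)) (I' := 𝓘(ℝ, P × F)) (I'' := 𝓘(ℝ, E)) x
    (g := N.tube h i) (f := fun t : P => (t, (0 : F)))
    ((N.contMDiffAt_tube hh i (N.zero_mem_prod hh hx)).mdifferentiableAt one_ne_zero)
    h3.hasMFDerivAt.mdifferentiableAt
  have h5 := mfderiv_comp (I := 𝓘(ℝ, P)) (I' := 𝓘(ℝ, P)) (I'' := 𝓘(ℝ, E)) x
    (g := D.ι) (f := (N.σ i).symm)
    (hι.contMDiffAt.mdifferentiableAt one_ne_zero) (h1.mdifferentiableAt one_ne_zero)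
  have h6 : mfderiv 𝓘(ℝ, P) 𝓘(ℝ, E) (N.tube h i ∘ fun t : P => (t, (0 : F))) x =
      mfderiv 𝓘(ℝ, P) 𝓘(ℝ, E) (D.ι ∘ (N.σ i).symm) x := h2.mfderiv_eq
  rw [h4, h5, h3.hasMFDerivAt.mfderiv] at h6
  refine (N.Q_eq_zero_iff _ _).2 ⟨mfderiv 𝓘(ℝ, P) 𝓘(ℝ, P) (N.σ i).symm x ξ, ?_⟩
  exact (DFunLike.congr_fun h6 ξ).symm

end NormalBundleCover

end Tube

/-! ### The map in tubular coordinates -/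

section Transition

open Filter

set_option linter.unusedSectionVars false

variable {E P F X M' : Type*}
  [NormedAddCommGroup E] [InnerProductSpace ℝ E]
  [NormedAddCommGroup P] [InnerProductSpace ℝ P] [FiniteDimensional ℝ P]
  [NormedAddCommGroup F] [InnerProductSpace ℝ F] [CompleteSpace F]
  [EMetricSpace X] [ChartedSpace E X] [IsManifold 𝓘(ℝ, E) 1 X]
  [Bundle.RiemannianBundle (fun x : X => TangentSpace 𝓘(ℝ, E) x)]
  [TopologicalSpace M'] [ChartedSpace P M'] [IsManifold 𝓘(ℝ, P) 1 M']
  [Bundle.RiemannianBundle (fun p : M' => TangentSpace 𝓘(ℝ, P) p)]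
  {n : WithTop ℕ∞} {D : NegInvariantManifold E P X M' n} (N : NormalBundleCover F D)
  {ρ : ℝ} {h : TangentBundle 𝓘(ℝ, E) X → X}

lemma NegInvariantManifold.contMDiff_one_ι (D : NegInvariantManifold E P X M' n) :
    ContMDiff 𝓘(ℝ, P) 𝓘(ℝ, E) 1 D.ι := D.contMDiff_ι.of_le (by simp)

namespace NormalBundleCover

lemma σ_mem_one (i : Fin N.s) : N.σ i ∈ IsManifold.maximalAtlas 𝓘(ℝ, P) 1 M' :=
  IsManifold.maximalAtlas_subset_of_le (by simp) (N.σ_mem i)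

/-- The map `T` in the tubular coordinates of indices `i` (source) and `j` (target). -/
noncomputable def transition (hh : N.IsTubular ρ h) (i j : Fin N.s) (T : X → X) (z : P × F) :
    P × F :=
  (N.tubeHomeo hh j).symm (T (N.tube h i z))

/-- The inverse of `S` along `M'`, in the charts of indices `j` (source) and `i` (target). -/
noncomputable def baseInv (i j : Fin N.s) (x : P) : P := N.σ i (D.Sinv ((N.σ j).symm x))

variable {i j : Fin N.s} {x' : P}

lemma closedBall_subset_ball_J {r : ℝ} (hr : r ≤ (N.J : ℝ) - 1) :
    Metric.closedBall (0 : P) r ⊆ Metric.ball (0 : P) N.J :=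
  Metric.closedBall_subset_ball (by linarith)

lemma one_le_J : (1 : ℝ) ≤ N.J := by linarith [N.J_ge]

lemma ball_one_subset : Metric.ball (0 : P) 1 ⊆ Metric.ball (0 : P) N.J :=
  Metric.ball_subset_ball N.one_le_J

lemma baseInv_mem (hi : D.Sinv ((N.σ j).symm x') ∈ N.U i 1) :
    N.baseInv i j x' ∈ Metric.ball (0 : P) 1 ∧
      (N.σ i).symm (N.baseInv i j x') = D.Sinv ((N.σ j).symm x') := by
  obtain ⟨h1, h2⟩ := (N.mem_U_iff i N.one_le_J).1 hi
  exact ⟨h2, (N.σ i).left_inv h1⟩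

lemma S_tube_baseInv (hh : N.IsTubular ρ h) (hx' : x' ∈ Metric.ball (0 : P) N.J)
    (hi : D.Sinv ((N.σ j).symm x') ∈ N.U i 1) :
    D.S (N.tube h i (N.baseInv i j x', 0)) = N.tube h j (x', 0) := by
  obtain ⟨h1, h2⟩ := N.baseInv_mem hi
  rw [N.tube_zero hh i (N.ball_one_subset h1), h2, D.S_Sinv, N.tube_zero hh j hx']

lemma transition_baseInv (hh : N.IsTubular ρ h) (hx' : x' ∈ Metric.ball (0 : P) N.J)
    (hi : D.Sinv ((N.σ j).symm x') ∈ N.U i 1) :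
    N.transition hh i j D.S (N.baseInv i j x', 0) = (x', 0) := by
  rw [transition, N.S_tube_baseInv hh hx' hi]
  exact N.tubeHomeo_symm_tube hh j (N.zero_mem_prod hh hx')

lemma eventually_Sinv_mem (hx' : x' ∈ Metric.ball (0 : P) N.J)
    (hi : D.Sinv ((N.σ j).symm x') ∈ N.U i 1) :
    ∀ᶠ t in 𝓝 x', D.Sinv ((N.σ j).symm t) ∈ N.U i 1 :=
  (D.contMDiff_Sinv.continuous.continuousAt.comp
    ((N.σ j).continuousAt_symm (N.ball_subset j hx'))).eventually
    ((N.isOpen_U i N.one_le_J).mem_nhds hi)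

lemma contMDiffAt_σ_Sinv (hi : D.Sinv ((N.σ j).symm x') ∈ N.U i 1) :
    ContMDiffAt 𝓘(ℝ, P) 𝓘(ℝ, P) 1 (N.σ i) (D.Sinv ((N.σ j).symm x')) :=
  contMDiffAt_of_mem_maximalAtlas (N.σ_mem_one i) ((N.mem_U_iff i N.one_le_J).1 hi).1

lemma contMDiffAt_σ_symm (j : Fin N.s) (hx' : x' ∈ Metric.ball (0 : P) N.J) :
    ContMDiffAt 𝓘(ℝ, P) 𝓘(ℝ, P) 1 (N.σ j).symm x' :=
  contMDiffAt_symm_of_mem_maximalAtlas (N.σ_mem_one j) (N.ball_subset j hx')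

lemma contDiffAt_baseInv (hx' : x' ∈ Metric.ball (0 : P) N.J)
    (hi : D.Sinv ((N.σ j).symm x') ∈ N.U i 1) : ContDiffAt ℝ 1 (N.baseInv i j) x' :=
  ContMDiffAt.contDiffAt ((N.contMDiffAt_σ_Sinv hi).comp x'
    (D.contMDiff_Sinv.contMDiffAt.comp x' (N.contMDiffAt_σ_symm j hx')))

/-- The chart bounds turn the bound for `A` into one for its coordinate representative. -/
lemma norm_fderiv_baseInv_le {C : ℝ} (hC : 1 ≤ C) (hCN : N.ChartBound C)
    (hx' : x' ∈ Metric.closedBall (0 : P) ((N.J : ℝ) - 1))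
    (hi : D.Sinv ((N.σ j).symm x') ∈ N.U i 1) :
    ‖fderiv ℝ (N.baseInv i j) x'‖ ≤ C ^ 2 * ‖D.A ((N.σ j).symm x')‖ := by
  have hxJ := N.closedBall_subset_ball_J le_rfl hx'
  obtain ⟨h1, h2⟩ := N.baseInv_mem hi
  have hC0 : 0 ≤ C := zero_le_one.trans hC
  have b1 := (hCN i (N.baseInv i j x')
    (Metric.closedBall_subset_closedBall (by linarith [N.J_ge])
      (Metric.ball_subset_closedBall h1))).1
  rw [h2] at b1
  have b2 := (hCN j x' hx').2
  have e1 := mfderiv_comp (I := 𝓘(ℝ, P)) (I' := 𝓘(ℝ, P)) (I'' := 𝓘(ℝ, P)) x'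
    (g := D.Sinv) (f := (N.σ j).symm) (D.contMDiff_Sinv.contMDiffAt.mdifferentiableAt one_ne_zero)
    ((N.contMDiffAt_σ_symm j hxJ).mdifferentiableAt one_ne_zero)
  have e2 := mfderiv_comp (I := 𝓘(ℝ, P)) (I' := 𝓘(ℝ, P)) (I'' := 𝓘(ℝ, P)) x'
    (g := N.σ i) (f := D.Sinv ∘ (N.σ j).symm)
    ((N.contMDiffAt_σ_Sinv hi).mdifferentiableAt one_ne_zero)
    ((D.contMDiff_Sinv.contMDiffAt.comp x' (N.contMDiffAt_σ_symm j hxJ)).mdifferentiableAt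
      one_ne_zero)
  rw [mfderiv_eq_fderiv, e1] at e2
  refine ContinuousLinearMap.opNorm_le_bound _ (by positivity) fun ξ => ?_
  change ‖fderiv ℝ (N.σ i ∘ D.Sinv ∘ (N.σ j).symm) x' ξ‖ ≤ _
  rw [e2]
  have k0 := ContinuousLinearMap.le_of_opNorm_le _ b2 ξ
  have k1 := (D.A ((N.σ j).symm x')).le_opNorm (mfderiv 𝓘(ℝ, P) 𝓘(ℝ, P) (N.σ j).symm x' ξ)
  have k2 := ContinuousLinearMap.le_of_opNorm_le _ b1
    (D.A ((N.σ j).symm x') (mfderiv 𝓘(ℝ, P) 𝓘(ℝ, P) (N.σ j).symm x' ξ))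
  rw [norm_tangentSpace_vectorSpace] at k2
  have k3 : ‖(show TangentSpace 𝓘(ℝ, P) x' from ξ)‖ = norm (E := P) ξ :=
    norm_tangentSpace_vectorSpace
  refine k2.trans ?_
  rw [← k3]
  calc _ ≤ C * (‖D.A ((N.σ j).symm x')‖ * (C * ‖(show TangentSpace 𝓘(ℝ, P) x' from ξ)‖)) := by
        gcongr
        exact k1.trans (by gcongr)
    _ = _ := by ring

variable [CompleteSpace E]

lemma contMDiffAt_tubeHomeo_symm (hh : N.IsTubular ρ h) {y : X}
    (hy : y ∈ (N.tubeHomeo hh j).target) :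
    ContMDiffAt 𝓘(ℝ, E) 𝓘(ℝ, P × F) 1 (N.tubeHomeo hh j).symm y :=
  (N.contMDiffOn_tubeHomeo_symm hh j).contMDiffAt ((N.tubeHomeo hh j).open_target.mem_nhds hy)

lemma contDiffAt_transition (hh : N.IsTubular ρ h) {T : X → X} {z : P × F}
    (hz : z ∈ Metric.ball (0 : P) N.J ×ˢ Metric.ball (0 : F) ρ)
    (hT : ContMDiffAt 𝓘(ℝ, E) 𝓘(ℝ, E) 1 T (N.tube h i z))
    (hTz : T (N.tube h i z) ∈ (N.tubeHomeo hh j).target) :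
    ContDiffAt ℝ 1 (N.transition hh i j T) z :=
  ContMDiffAt.contDiffAt ((N.contMDiffAt_tubeHomeo_symm hh hTz).comp z
    (hT.comp z (N.contMDiffAt_tube hh i hz)))

lemma contDiffAt_transition_S (hh : N.IsTubular ρ h) (hx' : x' ∈ Metric.ball (0 : P) N.J)
    (hi : D.Sinv ((N.σ j).symm x') ∈ N.U i 1) :
    ContDiffAt ℝ 1 (N.transition hh i j D.S) (N.baseInv i j x', 0) := by
  refine N.contDiffAt_transition hh
    (N.zero_mem_prod hh (N.ball_one_subset (N.baseInv_mem hi).1)) D.contMDiff_S.contMDiffAt ?_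
  rw [N.S_tube_baseInv hh hx' hi]
  exact N.tube_mem_target hh j (N.zero_mem_prod hh hx')

/-- In tubular coordinates the differential of `S` maps `T M'` to `T M'`, with the coordinate
representative of `A` as its inverse. -/
lemma fderiv_transition_fst (hh : N.IsTubular ρ h) (hx' : x' ∈ Metric.ball (0 : P) N.J)
    (hi : D.Sinv ((N.σ j).symm x') ∈ N.U i 1) (ξ : P) :
    fderiv ℝ (N.transition hh i j D.S) (N.baseInv i j x', 0)
      (fderiv ℝ (N.baseInv i j) x' ξ, 0) = (ξ, 0) := by
  have h1 : (fun t => N.transition hh i j D.S (N.baseInv i j t, 0)) =ᶠ[𝓝 x'] fun t => (t, 0) := by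
    filter_upwards [N.eventually_Sinv_mem hx' hi, Metric.isOpen_ball.mem_nhds hx'] with t h1 h2
    exact N.transition_baseInv hh h2 h1
  have h2 : HasFDerivAt (fun t => (N.baseInv i j t, (0 : F)))
      ((ContinuousLinearMap.inl ℝ P F).comp (fderiv ℝ (N.baseInv i j) x')) x' :=
    HasFDerivAt.comp x' (g := fun t : P => (t, (0 : F))) (f := N.baseInv i j)
      (g' := ContinuousLinearMap.inl ℝ P F) (ContinuousLinearMap.inl ℝ P F).hasFDerivAt
      ((N.contDiffAt_baseInv hx' hi).differentiableAt one_ne_zero).hasFDerivAt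
  have h3 := (HasFDerivAt.comp x' (g := N.transition hh i j D.S)
    ((N.contDiffAt_transition_S hh hx' hi).differentiableAt one_ne_zero).hasFDerivAt h2).fderiv
  have h4 : fderiv ℝ (fun t : P => (t, (0 : F))) x' = ContinuousLinearMap.inl ℝ P F :=
    (ContinuousLinearMap.inl ℝ P F).fderiv
  have h5 := h1.fderiv_eq (𝕜 := ℝ)
  rw [h4] at h5
  have h6 := h3.symm.trans h5
  exact DFunLike.congr_fun h6 ξ

lemma norm_eq_of_eq {x y : X} (hxy : x = y) (v : E) :
    norm (E := TangentSpace 𝓘(ℝ, E) x) v = norm (E := TangentSpace 𝓘(ℝ, E) y) v := by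
  subst hxy; rfl

lemma Q_eq_of_eq {x y : X} (hxy : x = y) (v : E) : (N.Q x v : E) = N.Q y v := by
  subst hxy; rfl

/-- In tubular coordinates the normal part of the differential of `S` is `B`. -/
lemma norm_fderiv_transition_snd_le (hh : N.IsTubular ρ h) (hx' : x' ∈ Metric.ball (0 : P) N.J)
    (hi : D.Sinv ((N.σ j).symm x') ∈ N.U i 1) (y : F) :
    ‖(fderiv ℝ (N.transition hh i j D.S) (N.baseInv i j x', 0) (0, y)).2‖ ≤
      ‖N.B ((N.σ j).symm x')‖ * ‖y‖ := by
  obtain ⟨hb1, hb2⟩ := N.baseInv_mem hi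
  have hbJ := N.ball_one_subset hb1
  set x := N.baseInv i j x' with hx
  set p := (N.σ j).symm x' with hp
  have hSz := N.S_tube_baseInv hh hx' hi
  set L := fderiv ℝ (N.transition hh i j D.S) (x, 0) with hL
  -- differentiate `tube j ∘ transition = S ∘ tube i`
  have h1 : N.tube h j ∘ N.transition hh i j D.S =ᶠ[𝓝 (x, 0)] D.S ∘ N.tube h i := by
    have hc : ContinuousAt (D.S ∘ N.tube h i) (x, 0) :=
      D.contMDiff_S.continuous.continuousAt.comp
        (N.contMDiffAt_tube hh i (N.zero_mem_prod hh hbJ)).continuousAt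
    have ht : (D.S ∘ N.tube h i) (x, 0) ∈ (N.tubeHomeo hh j).target := by
      rw [Function.comp_apply, hSz]
      exact N.tube_mem_target hh j (N.zero_mem_prod hh hx')
    filter_upwards [hc.eventually ((N.tubeHomeo hh j).open_target.mem_nhds ht)] with z hz
    exact N.tube_tubeHomeo_symm hh j hz
  let Lj : P × F →L[ℝ] E := mfderiv 𝓘(ℝ, P × F) 𝓘(ℝ, E) (N.tube h j) (x', 0)
  let Li : P × F →L[ℝ] E := mfderiv 𝓘(ℝ, P × F) 𝓘(ℝ, E) (N.tube h i) (x, 0)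
  let LS : E →L[ℝ] E := mfderiv 𝓘(ℝ, E) 𝓘(ℝ, E) D.S (D.ι (D.Sinv p))
  have g1 : HasMFDerivAt 𝓘(ℝ, P × F) 𝓘(ℝ, E) (N.tube h j)
      (N.transition hh i j D.S (x, 0)) Lj := by
    rw [N.transition_baseInv hh hx' hi]
    exact ((N.contMDiffAt_tube hh j (N.zero_mem_prod hh hx')).mdifferentiableAt
      one_ne_zero).hasMFDerivAt
  have g2 : HasMFDerivAt 𝓘(ℝ, P × F) 𝓘(ℝ, P × F) (N.transition hh i j D.S) (x, 0) L :=
    ((N.contDiffAt_transition_S hh hx' hi).differentiableAt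
      one_ne_zero).hasFDerivAt.hasMFDerivAt
  have hti : N.tube h i (x, 0) = D.ι (D.Sinv p) := by rw [N.tube_zero hh i hbJ, hb2]
  have g3 : HasMFDerivAt 𝓘(ℝ, E) 𝓘(ℝ, E) D.S (N.tube h i (x, 0)) LS := by
    rw [hti]
    exact (D.contMDiff_S.contMDiffAt.mdifferentiableAt one_ne_zero).hasMFDerivAt
  have g4 : HasMFDerivAt 𝓘(ℝ, P × F) 𝓘(ℝ, E) (N.tube h i) (x, 0) Li :=
    ((N.contMDiffAt_tube hh i (N.zero_mem_prod hh hbJ)).mdifferentiableAt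
      one_ne_zero).hasMFDerivAt
  have g5 := (g1.comp (x, (0 : F)) g2).mfderiv
  have g6 := (g3.comp (x, (0 : F)) g4).mfderiv
  have g7 : Lj.comp L = LS.comp Li := by
    rw [h1.mfderiv_eq] at g5
    exact g5.symm.trans g6
  have g8 : Lj (L (0, y)) = LS (N.e i (D.Sinv p) y) := by
    have := DFunLike.congr_fun g7 ((0 : P), y)
    have e1 : Li ((0 : P), y) = N.e i ((N.σ i).symm x) y := N.mfderiv_tube_snd hh i hbJ y
    rw [hb2] at e1
    change Lj (L (0, y)) = LS (Li (0, y)) at this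
    rw [this, e1]
  -- apply the projection onto the normal bundle
  set β := (L (0, y)).1
  set b := (L (0, y)).2
  have g9 : Lj (L (0, y)) = Lj (β, 0) + Lj (0, b) := by
    rw [← map_add]; simp [β, b]
  have g10 : Lj ((0 : P), b) = N.e j p b := N.mfderiv_tube_snd hh j hx' b
  have g11 : (N.Q (D.ι p) (Lj (β, (0 : F))) : E) = 0 :=
    N.Q_mfderiv_tube_fst hh N.σ_mem_one D.contMDiff_one_ι j hx' β
  let Qp : E →L[ℝ] E := N.Q (D.ι p)
  let ej : E := N.e j p b
  have g12 : Qp (LS (N.e i (D.Sinv p) y)) = ej := by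
    have e0 : Lj ((0 : P), b) = ej := g10
    rw [← g8, g9, map_add, e0]
    have e1 : Qp (Lj (β, 0)) = 0 := g11
    have e2 : Qp ej = ej := N.e_mem j x' hx' b
    rw [e1, e2, zero_add]
  have hmem : N.e i (D.Sinv p) y ∈ N.fiber (D.ι (D.Sinv p)) := by
    have := N.e_mem_fiber i hbJ y
    rwa [hb2] at this
  have g13 := (N.B p).le_opNorm ⟨N.e i (D.Sinv p) y, hmem⟩
  have g14 : norm (E := TangentSpace 𝓘(ℝ, E) (D.S (D.ι (D.Sinv p))))
      (N.B p ⟨N.e i (D.Sinv p) y, hmem⟩) = ‖b‖ := by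
    have e1 : (N.B p ⟨N.e i (D.Sinv p) y, hmem⟩ : E) = ej := by
      rw [← g12]
      exact N.Q_eq_of_eq (D.S_Sinv p) (LS (N.e i (D.Sinv p) y))
    have e2 : norm (E := TangentSpace 𝓘(ℝ, E) (D.S (D.ι (D.Sinv p))))
        (N.B p ⟨N.e i (D.Sinv p) y, hmem⟩) =
        norm (E := TangentSpace 𝓘(ℝ, E) (D.S (D.ι (D.Sinv p)))) ej :=
      congrArg (norm (E := TangentSpace 𝓘(ℝ, E) (D.S (D.ι (D.Sinv p))))) e1
    rw [e2, norm_eq_of_eq (D.S_Sinv p)]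
    exact N.norm_e j x' hx' b
  have g15 : ‖(⟨N.e i (D.Sinv p) y, hmem⟩ : N.fiber (D.ι (D.Sinv p)))‖ = ‖y‖ := by
    change ‖N.e i (D.Sinv p) y‖ = ‖y‖
    have := N.norm_e i x hbJ y
    rwa [hb2] at this
  rw [g15] at g13
  rw [← g14]
  exact g13

/-- The differential of `S` at a point of `M'`, in tubular coordinates, is a dominated block
map. Since the trivializations of the normal bundle are isometric, passing to coordinates costs no
factor for `B`, and a factor `C ^ 2` for `A`. -/
lemma isDominatedBlock_fderiv_transition (hh : N.IsTubular ρ h) {C ϑ R : ℝ} (hC : 1 ≤ C)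
    (hCN : N.ChartBound C) (hstab : N.Stability C ϑ) (hsmooth : N.Smoothing C ϑ)
    (hx' : x' ∈ Metric.closedBall (0 : P) ((N.J : ℝ) - 1))
    (hi : D.Sinv ((N.σ j).symm x') ∈ N.U i 1)
    (hR : ‖fderiv ℝ (N.transition hh i j D.S) (N.baseInv i j x', 0)‖ ≤ R)
    (hR' : ‖fderiv ℝ (N.baseInv i j) x'‖ ≤ R) :
    ∃ b : F →L[ℝ] F, IsDominatedBlock ϑ R
      (fderiv ℝ (N.transition hh i j D.S) (N.baseInv i j x', 0))
      (fderiv ℝ (N.baseInv i j) x') b := by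
  have hxJ := N.closedBall_subset_ball_J le_rfl hx'
  set p := (N.σ j).symm x'
  set L := fderiv ℝ (N.transition hh i j D.S) (N.baseInv i j x', 0)
  let b : F →L[ℝ] F :=
    (ContinuousLinearMap.snd ℝ P F).comp (L.comp (ContinuousLinearMap.inr ℝ P F))
  have hb : ‖b‖ ≤ ‖N.B p‖ := ContinuousLinearMap.opNorm_le_bound _ (N.B p).opNorm_nonneg fun y =>
    N.norm_fderiv_transition_snd_le hh hxJ hi y
  have ha := N.norm_fderiv_baseInv_le hC hCN hx' hi
  have hp : p ∈ N.core := mem_iUnion.2 ⟨j, x', hx', rfl⟩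
  have h1 := hstab p hp
  have h2 := hsmooth p hp
  have hB0 := (N.B p).opNorm_nonneg
  have hA0 := (D.A p).opNorm_nonneg
  refine ⟨b, fun ξ => N.fderiv_transition_fst hh hxJ hi ξ, fun y => rfl, hR, hR', ?_, ?_⟩
  · have : 1 * ‖N.B p‖ ≤ C ^ 2 * ‖N.B p‖ := by gcongr; exact one_le_pow₀ hC
    linarith
  · calc ‖fderiv ℝ (N.baseInv i j) x'‖ * ‖b‖ ≤ C ^ 2 * ‖D.A p‖ * ‖N.B p‖ := by gcongr
      _ ≤ C ^ 4 * ‖D.A p‖ * ‖N.B p‖ := by gcongr; norm_num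
      _ ≤ ϑ := h2.le

end NormalBundleCover

end Transition

/-! ### Uniform control of the perturbed maps in tubular coordinates -/

section Control

lemma ContDiffAt.eventually_norm_fderiv_lt {Z E₁ E₂ : Type*} [TopologicalSpace Z]
    [NormedAddCommGroup E₁] [NormedSpace ℝ E₁] [NormedAddCommGroup E₂] [NormedSpace ℝ E₂]
    {f : Z → E₁} {g : E₁ → E₂} {x : Z} (hg : ContDiffAt ℝ 1 g (f x)) (hf : ContinuousAt f x) :
    ∀ᶠ t in 𝓝 x, ‖fderiv ℝ g (f t)‖ < ‖fderiv ℝ g (f x)‖ + 1 := by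
  have h1 : ContinuousAt (fderiv ℝ g) (f x) := (hg.fderiv_right (m := 0) (by simp)).continuousAt
  have h2 : ContinuousAt (fun t => ‖fderiv ℝ g (f t)‖) x :=
    ContinuousAt.norm (ContinuousAt.comp (f := f) h1 hf)
  exact h2.eventually (gt_mem_nhds (lt_add_one _))

open Filter

set_option linter.unusedSectionVars false

variable {E P F X M' : Type*}
  [NormedAddCommGroup E] [InnerProductSpace ℝ E] [CompleteSpace E]
  [NormedAddCommGroup P] [InnerProductSpace ℝ P] [FiniteDimensional ℝ P]
  [NormedAddCommGroup F] [InnerProductSpace ℝ F] [CompleteSpace F]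
  [EMetricSpace X] [ChartedSpace E X] [IsManifold 𝓘(ℝ, E) 1 X]
  [Bundle.RiemannianBundle (fun x : X => TangentSpace 𝓘(ℝ, E) x)]
  [IsContinuousRiemannianBundle E (fun x : X => TangentSpace 𝓘(ℝ, E) x)]
  [TopologicalSpace M'] [ChartedSpace P M'] [IsManifold 𝓘(ℝ, P) 1 M']
  [Bundle.RiemannianBundle (fun p : M' => TangentSpace 𝓘(ℝ, P) p)]
  {n : WithTop ℕ∞} {D : NegInvariantManifold E P X M' n} (N : NormalBundleCover F D)
  {ρ : ℝ} {h : TangentBundle 𝓘(ℝ, E) X → X}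
  {a : ℕ} {χ : Fin a → OpenPartialHomeomorph X E} {V : Set X}

namespace NormalBundleCover

/-- If a perturbation of `S` maps a point near `M'` to a point near `p ∈ M'`, then the base point
of the former is close to `S⁻¹ p`. This is where the injectivity of `S` is used. -/
lemma exists_localization (hh : N.IsTubular ρ h) (hV : IsOpen V) (hVM : range D.ι ⊆ V)
    {j : Fin N.s} {x' : P} (hx' : x' ∈ Metric.ball (0 : P) N.J) {O : Set M'} (hO : IsOpen O)
    (hOx : D.Sinv ((N.σ j).symm x') ∈ O) :
    ∃ e > 0, ∃ pT : (X → X) → Prop, (∀ᶠ T in perturbations χ V D.S, pT T) ∧ ∃ W ∈ 𝓝 x',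
      ∀ T, pT T → ∀ x'' ∈ W, ∀ i, ∀ t ∈ Metric.closedBall (0 : P) ((N.J : ℝ) - 3), ∀ y y' : F,
        ‖y‖ < e → ‖y'‖ < e → T (N.tube h i (t, y)) = N.tube h j (x'', y') →
          (N.σ i).symm t ∈ O := by
  have key : ∀ i : Fin N.s, ∀ᶠ w in perturbations χ V D.S ×ˢ (𝓝 x' ×ˢ (𝓝 (0 : F) ×ˢ 𝓝 (0 : F))),
      ∀ t ∈ Metric.closedBall (0 : P) ((N.J : ℝ) - 3),
        w.1 (N.tube h i (t, w.2.2.1)) = N.tube h j (w.2.1, w.2.2.2) → (N.σ i).symm t ∈ O := by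
    intro i
    have hK : IsCompact (Metric.closedBall (0 : P) ((N.J : ℝ) - 3)) := isCompact_closedBall _ _
    set l := perturbations χ V D.S ×ˢ (𝓝 x' ×ˢ (𝓝 (0 : F) ×ˢ 𝓝 (0 : F)))
    have h0 : {w : ((X → X) × (P × (F × F))) × P | w.1.1 (N.tube h i (w.2, w.1.2.2.1)) =
        N.tube h j (w.1.2.1, w.1.2.2.2) → (N.σ i).symm w.2 ∈ O} ∈
        l ×ˢ 𝓝ˢ (Metric.closedBall (0 : P) ((N.J : ℝ) - 3)) := by
      refine hK.mem_prod_nhdsSet_of_forall fun t ht => ?_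
      have htJ : t ∈ Metric.ball (0 : P) N.J := N.closedBall_subset_ball_J (by linarith) ht
      by_cases hS : D.S (D.ι ((N.σ i).symm t)) = D.ι ((N.σ j).symm x')
      · have h1 : (N.σ i).symm t = D.Sinv ((N.σ j).symm x') := by
          refine D.isEmbedding_ι.injective (D.injective_S ?_)
          rw [hS, D.S_Sinv]
        have h2 : ∀ᶠ s in 𝓝 t, (N.σ i).symm s ∈ O :=
          ((N.σ i).continuousAt_symm (N.ball_subset i htJ)).eventually
            (hO.mem_nhds (by rwa [h1]))
        filter_upwards [tendsto_snd.eventually h2] with w hw _ using hw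
      · have hz := N.zero_mem_prod hh htJ (ρ := ρ) (h := h)
        have h1 : Tendsto (fun q : (X → X) × (P × F) => q.1 (N.tube h i q.2))
            (perturbations χ V D.S ×ˢ 𝓝 (t, (0 : F))) (𝓝 (D.S (N.tube h i (t, 0)))) := by
          refine tendsto_comp_perturbations hV (N.contMDiffAt_tube hh i hz).continuousAt ?_
            D.contMDiff_S.continuous.continuousAt
          rw [N.tube_zero hh i htJ]
          exact hVM (mem_range_self _)
        have h2 : Tendsto (fun w : ((X → X) × (P × (F × F))) × P => (w.1.1, (w.2, w.1.2.2.1)))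
            (l ×ˢ 𝓝 t) (perturbations χ V D.S ×ˢ 𝓝 (t, (0 : F))) := by
          refine (tendsto_fst.comp tendsto_fst).prodMk ?_
          rw [nhds_prod_eq]
          exact tendsto_snd.prodMk
            (tendsto_fst.comp (tendsto_snd.comp (tendsto_snd.comp tendsto_fst)))
        have h3 : Tendsto (fun w : ((X → X) × (P × (F × F))) × P =>
            N.tube h j (w.1.2.1, w.1.2.2.2)) (l ×ˢ 𝓝 t) (𝓝 (N.tube h j (x', 0))) := by
          have e1 := (N.contMDiffAt_tube hh j (N.zero_mem_prod hh hx')).continuousAt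
          refine e1.tendsto.comp ?_
          rw [nhds_prod_eq]
          exact (tendsto_fst.comp (tendsto_snd.comp tendsto_fst)).prodMk
            (tendsto_snd.comp (tendsto_snd.comp (tendsto_snd.comp tendsto_fst)))
        have hne : D.S (N.tube h i (t, 0)) ≠ N.tube h j (x', 0) := by
          rwa [N.tube_zero hh i htJ, N.tube_zero hh j hx']
        have h4 : ∀ᶠ q in 𝓝 (D.S (N.tube h i (t, 0))) ×ˢ 𝓝 (N.tube h j (x', 0)), q.1 ≠ q.2 := by
          rw [← nhds_prod_eq]
          exact isClosed_diagonal.isOpen_compl.mem_nhds (x := (_, _)) hne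
        filter_upwards [((h1.comp h2).prodMk h3).eventually h4] with w hw hw' using absurd hw' hw
    obtain ⟨A, hA, B, hB, hAB⟩ := mem_prod_iff.1 h0
    filter_upwards [hA] with w hw t ht
    exact hAB (mk_mem_prod hw (subset_of_mem_nhdsSet hB ht))
  have hall := eventually_all.2 key
  obtain ⟨pT, hpT, pW, hpW, H⟩ := eventually_prod_iff.1 hall
  obtain ⟨pX, hpX, pY, hpY, H2⟩ := eventually_prod_iff.1 hpW
  obtain ⟨p1, hp1, p2, hp2, H3⟩ := eventually_prod_iff.1 hpY
  obtain ⟨e1, he1, h1⟩ := Metric.eventually_nhds_iff_ball.1 hp1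
  obtain ⟨e2, he2, h2⟩ := Metric.eventually_nhds_iff_ball.1 hp2
  refine ⟨min e1 e2, lt_min he1 he2, pT, hpT, {x | pX x}, hpX, ?_⟩
  intro T hT x'' hx'' i t ht y y' hy hy' heq
  refine H hT (H2 hx'' (H3 (h1 y ?_) (h2 y' ?_))) i t ht heq
  · rw [mem_ball_zero_iff]; exact hy.trans_le (min_le_left _ _)
  · rw [mem_ball_zero_iff]; exact hy'.trans_le (min_le_right _ _)

/-- All patches of radius `J - 3` are mapped by `S⁻¹` into the patches of radius `1`, with uniformly
bounded coordinate representatives. -/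
lemma exists_uniform_bound (hh : N.IsTubular ρ h) :
    ∃ R : ℝ, 1 ≤ R ∧ ∀ j, ∀ x' ∈ Metric.closedBall (0 : P) ((N.J : ℝ) - 3), ∃ i,
      D.Sinv ((N.σ j).symm x') ∈ N.U i 1 ∧
      ‖fderiv ℝ (N.transition hh i j D.S) (N.baseInv i j x', 0)‖ ≤ R ∧
      ‖fderiv ℝ (N.baseInv i j) x'‖ ≤ R := by
  have key : ∀ j, ∃ R : ℝ, ∀ x' ∈ Metric.closedBall (0 : P) ((N.J : ℝ) - 3), ∃ i,
      D.Sinv ((N.σ j).symm x') ∈ N.U i 1 ∧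
      ‖fderiv ℝ (N.transition hh i j D.S) (N.baseInv i j x', 0)‖ ≤ R ∧
      ‖fderiv ℝ (N.baseInv i j) x'‖ ≤ R := by
    intro j
    refine (isCompact_closedBall (0 : P) ((N.J : ℝ) - 3)).induction_on
      (p := fun s => ∃ R : ℝ, ∀ x' ∈ s, ∃ i,
      D.Sinv ((N.σ j).symm x') ∈ N.U i 1 ∧
      ‖fderiv ℝ (N.transition hh i j D.S) (N.baseInv i j x', 0)‖ ≤ R ∧
      ‖fderiv ℝ (N.baseInv i j) x'‖ ≤ R) ⟨0, by simp⟩ ?_ ?_ ?_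
    · rintro s t hst ⟨R, hR⟩
      exact ⟨R, fun x hx => hR x (hst hx)⟩
    · rintro s t ⟨R, hR⟩ ⟨R', hR'⟩
      refine ⟨max R R', ?_⟩
      rintro x (hx | hx)
      · obtain ⟨i, h1, h2, h3⟩ := hR x hx
        exact ⟨i, h1, h2.trans (le_max_left _ _), h3.trans (le_max_left _ _)⟩
      · obtain ⟨i, h1, h2, h3⟩ := hR' x hx
        exact ⟨i, h1, h2.trans (le_max_right _ _), h3.trans (le_max_right _ _)⟩
    · intro x' hx'
      have hxJ := N.closedBall_subset_ball_J (by linarith) hx'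
      obtain ⟨i, hi⟩ := N.cover _ (D.Sinv_mem ((N.σ j).symm x'))
      have hi' : D.Sinv ((N.σ j).symm x') ∈ N.U i 1 := hi
      have c1 := N.contDiffAt_baseInv hxJ hi'
      have c2 := N.contDiffAt_transition_S hh hxJ hi'
      have d1 : ContinuousAt (fderiv ℝ (N.baseInv i j)) x' :=
        (c1.fderiv_right (m := 0) (by simp)).continuousAt
      have d3 : ContinuousAt (fun t => (N.baseInv i j t, (0 : F))) x' :=
        c1.continuousAt.prodMk continuousAt_const
      set R := max (‖fderiv ℝ (N.transition hh i j D.S) (N.baseInv i j x', 0)‖)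
        (‖fderiv ℝ (N.baseInv i j) x'‖) + 1
      have g1 : ∀ᶠ t in 𝓝 x',
          ‖fderiv ℝ (N.transition hh i j D.S) (N.baseInv i j t, 0)‖ < R := by
        filter_upwards [ContDiffAt.eventually_norm_fderiv_lt
          (f := fun t => (N.baseInv i j t, (0 : F))) c2 d3] with t ht
        exact ht.trans_le (add_le_add_left (le_max_left _ _) _)
      have g2 : ∀ᶠ t in 𝓝 x', ‖fderiv ℝ (N.baseInv i j) t‖ < R :=
        (continuous_norm.continuousAt.comp d1).eventually
          (gt_mem_nhds ((le_max_right _ _).trans_lt (lt_add_one _)))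
      refine ⟨_, mem_nhdsWithin_of_mem_nhds (g1.and (g2.and (N.eventually_Sinv_mem hxJ hi'))), R,
        fun t ht => ⟨i, ht.2.2, ht.1.le, ht.2.1.le⟩⟩
  choose R hR using key
  obtain ⟨B, hB⟩ := (finite_range R).bddAbove
  refine ⟨max B 1, le_max_right _ _, fun j x' hx' => ?_⟩
  obtain ⟨i, h1, h2, h3⟩ := hR j x' hx'
  have : R j ≤ max B 1 := (hB (mem_range_self j)).trans (le_max_left _ _)
  exact ⟨i, h1, h2.trans this, h3.trans this⟩

/-- Control of all small perturbations of `S` near the point of `M'` with coordinate `x'` in the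
chart `σ j`. In the tubular coordinates of some index `i` near the preimage (with coordinate `x`) of
this point, they are dominated block maps up to Lipschitz errors of size `c`, on a ball of radius
`r`; and the points of the tube of radius `e` that are mapped near the given point lie over this
ball, which is contained in `Mbar`. -/
def Controlled (hh : N.IsTubular ρ h) (χ : Fin a → OpenPartialHomeomorph X E) (V : Set X)
    (θ R c e : ℝ) (j : Fin N.s) (x' : P) : Prop :=
  ∃ (i : Fin N.s) (x : P) (r : ℝ) (L : P × F →L[ℝ] P × F) (A : P →L[ℝ] P) (b : F →L[ℝ] F),
    0 < r ∧ r ≤ ρ ∧ 4 * R * (R + 3) * e ≤ r ∧ Metric.ball x r ⊆ Metric.ball 0 1 ∧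
    IsDominatedBlock θ R L A b ∧ D.S (N.tube h i (x, 0)) = N.tube h j (x', 0) ∧
    (N.σ i).symm '' Metric.ball x r ⊆ D.Mbar ∧
    (∀ᶠ T in perturbations χ V D.S,
      (∀ z ∈ Metric.ball (x, (0 : F)) r, T (N.tube h i z) ∈ (N.tubeHomeo hh j).target ∧
        ContDiffAt ℝ 1 (N.transition hh i j T) z) ∧
      ∀ z ∈ Metric.ball (x, (0 : F)) r, ∀ z' ∈ Metric.ball (x, (0 : F)) r,
        ‖N.transition hh i j T z - N.transition hh i j T z' - L (z - z')‖ ≤ c * ‖z - z'‖) ∧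
    ∀ᶠ q in perturbations χ V D.S ×ˢ 𝓝 x', ∀ i',
      ∀ t ∈ Metric.closedBall (0 : P) ((N.J : ℝ) - 3), ∀ y y' : F, ‖y‖ < e → ‖y'‖ < e →
        q.1 (N.tube h i' (t, y)) = N.tube h j (q.2, y') →
          (N.σ i').symm t ∈ (N.σ i).symm '' Metric.ball x r

lemma Controlled.anti {hh : N.IsTubular ρ h} {θ R c e e' : ℝ} (hR : 1 ≤ R) {j : Fin N.s} {x' : P}
    (hc : N.Controlled hh χ V θ R c e j x') (he : e' ≤ e) :
    N.Controlled hh χ V θ R c e' j x' := by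
  obtain ⟨i, x, r, L, A, b, h1, h2, h3, h4, h5, h6, h7, h8, h9⟩ := hc
  refine ⟨i, x, r, L, A, b, h1, h2, le_trans ?_ h3, h4, h5, h6, h7, h8, ?_⟩
  · gcongr
  · filter_upwards [h9] with q hq i' t ht y y' hy hy' using
      hq i' t ht y y' (hy.trans_le he) (hy'.trans_le he)

/-- Near every point of `M'` of the patches of radius `J - 3`, the perturbations are controlled. -/
lemma exists_eventually_controlled (hh : N.IsTubular ρ h) {C ϑ R : ℝ} (hC : 1 ≤ C)
    (hCN : N.ChartBound C) (hstab : N.Stability C ϑ) (hsmooth : N.Smoothing C ϑ)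
    (hV : IsOpen V) (hVM : range D.ι ⊆ V)
    (hχ : ∀ b, χ b ∈ IsManifold.maximalAtlas 𝓘(ℝ, E) 1 X)
    (hχM : range D.ι ⊆ ⋃ b, (χ b).source) (hR : 1 ≤ R) {i j : Fin N.s} {x' : P}
    (hx' : x' ∈ Metric.closedBall (0 : P) ((N.J : ℝ) - 3))
    (hi : D.Sinv ((N.σ j).symm x') ∈ N.U i 1)
    (hR1 : ‖fderiv ℝ (N.transition hh i j D.S) (N.baseInv i j x', 0)‖ ≤ R)
    (hR2 : ‖fderiv ℝ (N.baseInv i j) x'‖ ≤ R) {c : ℝ} (hc : 0 < c) :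
    ∃ e > 0, ∀ᶠ t in 𝓝 x', N.Controlled hh χ V ϑ R c e j t := by
  have hxJ := N.closedBall_subset_ball_J (by linarith) hx'
  obtain ⟨b, hb⟩ := N.isDominatedBlock_fderiv_transition hh hC hCN hstab hsmooth
    (Metric.closedBall_subset_closedBall (by linarith) hx') hi hR1 hR2
  obtain ⟨hm1, hm2⟩ := N.baseInv_mem hi
  set x := N.baseInv i j x' with hx
  set L := fderiv ℝ (N.transition hh i j D.S) (x, 0) with hL
  have hxJ' := N.ball_one_subset hm1
  have hz := N.zero_mem_prod hh hxJ' (ρ := ρ) (h := h)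
  have hSz := N.S_tube_baseInv hh hxJ hi
  have hzV : N.tube h i (x, 0) ∈ V := by
    rw [N.tube_zero hh i hxJ']; exact hVM (mem_range_self _)
  obtain ⟨β, hβ⟩ : ∃ β, D.S (N.tube h i (x, 0)) ∈ (χ β).source := by
    have : D.S (N.tube h i (x, 0)) ∈ range D.ι := by
      rw [hSz, N.tube_zero hh j hxJ]; exact mem_range_self _
    exact mem_iUnion.1 (hχM this)
  have htarget : D.S (N.tube h i (x, 0)) ∈ (N.tubeHomeo hh j).target := by
    rw [hSz]; exact N.tube_mem_target hh j (N.zero_mem_prod hh hxJ)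
  have htube := N.contMDiffAt_tube hh i hz
  obtain ⟨h1, h2⟩ := tendsto_fderiv_comp_perturbations hV D.contMDiff_S hχ htube hzV hβ
    (N.contMDiffAt_tubeHomeo_symm hh htarget)
  have h3 : ∀ᶠ q in perturbations χ V D.S ×ˢ 𝓝 (x, (0 : F)),
      q.1 (N.tube h i q.2) ∈ (N.tubeHomeo hh j).target :=
    (tendsto_comp_perturbations hV htube.continuousAt hzV
      D.contMDiff_S.continuous.continuousAt).eventually
      ((N.tubeHomeo hh j).open_target.mem_nhds htarget)
  have h4 : ∀ᶠ q in perturbations χ V D.S ×ˢ 𝓝 (x, (0 : F)),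
      ‖fderiv ℝ (N.transition hh i j q.1) q.2 - L‖ < c := by
    have := (Metric.tendsto_nhds.1 h2) c hc
    filter_upwards [this] with q hq
    rw [dist_eq_norm] at hq
    exact hq
  obtain ⟨pT, hpT, pz, hpz, H⟩ := eventually_prod_iff.1 (h1.and (h3.and h4))
  obtain ⟨r₀, hr₀, H0⟩ := Metric.eventually_nhds_iff_ball.1 hpz
  -- `S⁻¹` is a local homeomorphism with values in `Mbar`
  have hMbar : ∀ᶠ t in 𝓝 x, (N.σ i).symm t ∈ D.Mbar := by
    have : CompleteSpace P := FiniteDimensional.complete ℝ P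
    have g1 := ((N.contDiffAt_baseInv hxJ hi).hasStrictFDerivAt one_ne_zero).map_nhds_eq_of_surj
      (LinearMap.range_eq_top.2 hb.surjective)
    rw [hx, ← g1, eventually_map]
    filter_upwards [N.eventually_Sinv_mem hxJ hi] with t ht
    rw [(N.baseInv_mem ht).2]
    exact D.Sinv_mem _
  obtain ⟨r₁, hr₁, H1⟩ := Metric.mem_nhds_iff.1
    (Filter.inter_mem (Metric.isOpen_ball.mem_nhds hm1) hMbar)
  set r := min (min r₀ r₁) ρ / 2 with hr
  have hr0 : 0 < r := by have := hh.pos; positivity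
  have hrr₀ : 2 * r ≤ r₀ := by
    rw [hr]; linarith [min_le_left (min r₀ r₁) ρ, min_le_left r₀ r₁]
  have hrr₁ : 2 * r ≤ r₁ := by
    rw [hr]; linarith [min_le_left (min r₀ r₁) ρ, min_le_right r₀ r₁]
  have hrρ : 2 * r ≤ ρ := by rw [hr]; linarith [min_le_right (min r₀ r₁) ρ]
  -- the localization, in a smaller ball
  have hO : IsOpen ((N.σ i).symm '' Metric.ball x (r / 2)) := by
    refine (N.σ i).symm.isOpen_image_of_subset_source Metric.isOpen_ball ?_
    refine (Metric.ball_subset_ball (by linarith)).trans (Subset.trans (fun t ht => (H1 ht).1) ?_)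
    exact N.ball_one_subset.trans (N.ball_subset i)
  have hOx : D.Sinv ((N.σ j).symm x') ∈ (N.σ i).symm '' Metric.ball x (r / 2) :=
    ⟨x, Metric.mem_ball_self (by linarith), hm2⟩
  obtain ⟨e₀, he₀, pT', hpT', W, hW, HW⟩ :=
    N.exists_localization (χ := χ) hh hV hVM hxJ hO hOx
  have hR0 : 0 < R := by linarith
  refine ⟨min e₀ (r / (4 * R * (R + 3))), lt_min he₀ (by positivity), ?_⟩
  have hcont : ContinuousAt (N.baseInv i j) x' := (N.contDiffAt_baseInv hxJ hi).continuousAt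
  have hnear : ∀ᶠ t in 𝓝 x', N.baseInv i j t ∈ Metric.ball x (r / 2) :=
    hcont.eventually (Metric.ball_mem_nhds _ (by linarith))
  filter_upwards [hnear, N.eventually_Sinv_mem hxJ hi, Metric.isOpen_ball.mem_nhds hxJ,
    eventually_mem_nhds_iff.2 hW] with t ht1 ht2 ht3 ht4
  have hsub : Metric.ball (N.baseInv i j t) r ⊆ Metric.ball x (2 * r) := by
    refine Metric.ball_subset_ball' ?_
    rw [Metric.mem_ball] at ht1
    linarith
  have hsub' : Metric.ball (N.baseInv i j t, (0 : F)) r ⊆ Metric.ball (x, (0 : F)) r₀ := by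
    rw [← ball_prod_same, ← ball_prod_same]
    exact prod_mono (hsub.trans (Metric.ball_subset_ball hrr₀))
      (Metric.ball_subset_ball (by linarith))
  have hsub'' : Metric.ball x (r / 2) ⊆ Metric.ball (N.baseInv i j t) r := by
    refine Metric.ball_subset_ball' ?_
    rw [Metric.mem_ball, dist_comm] at ht1
    linarith
  refine ⟨i, N.baseInv i j t, r, L, fderiv ℝ (N.baseInv i j) x', b, hr0, by linarith, ?_,
    fun s hs => (H1 (Metric.ball_subset_ball hrr₁ (hsub hs))).1, hb,
    N.S_tube_baseInv hh ht3 ht2,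
    image_subset_iff.2 fun s hs => (H1 (Metric.ball_subset_ball hrr₁ (hsub hs))).2, ?_, ?_⟩
  · have h5 := min_le_right e₀ (r / (4 * R * (R + 3)))
    rw [le_div_iff₀ (by positivity)] at h5
    linarith
  · filter_upwards [hpT] with T hT
    have hall : ∀ z ∈ Metric.ball (N.baseInv i j t, (0 : F)) r,
        ContDiffAt ℝ 1 (N.transition hh i j T) z ∧
        T (N.tube h i z) ∈ (N.tubeHomeo hh j).target ∧
        ‖fderiv ℝ (N.transition hh i j T) z - L‖ < c :=
      fun z hz => H hT (H0 z (hsub' hz))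
    refine ⟨fun z hz => ⟨(hall z hz).2.1, (hall z hz).1⟩, fun z hz z' hz' => ?_⟩
    exact (convex_ball _ _).norm_image_sub_le_of_norm_fderiv_le' (𝕜 := ℝ)
      (fun w hw => (hall w hw).1.differentiableAt one_ne_zero)
      (fun w hw => (hall w hw).2.2.le) hz' hz
  · filter_upwards [hpT'.prod_mk ht4] with q ⟨hq1, hq2⟩ i' s hs y y' hy hy' heq
    exact image_mono hsub'' (HW q.1 hq1 q.2 hq2 i' s hs y y' (hy.trans_le (min_le_left _ _))
      (hy'.trans_le (min_le_left _ _)) heq)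

/-- The control of the perturbations is uniform in the patches of radius `J - 3`. -/
lemma exists_controlled (hh : N.IsTubular ρ h) {C ϑ : ℝ} (hC : 1 ≤ C)
    (hCN : N.ChartBound C) (hstab : N.Stability C ϑ) (hsmooth : N.Smoothing C ϑ)
    (hV : IsOpen V) (hVM : range D.ι ⊆ V)
    (hχ : ∀ b, χ b ∈ IsManifold.maximalAtlas 𝓘(ℝ, E) 1 X)
    (hχM : range D.ι ⊆ ⋃ b, (χ b).source) :
    ∃ R : ℝ, 1 ≤ R ∧ ∀ c > 0, ∃ e > 0, ∀ j,
      ∀ x' ∈ Metric.closedBall (0 : P) ((N.J : ℝ) - 3), N.Controlled hh χ V ϑ R c e j x' := by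
  obtain ⟨R, hR, HR⟩ := N.exists_uniform_bound hh
  refine ⟨R, hR, fun c hc => ?_⟩
  have key : ∀ j, ∃ e > 0, ∀ x' ∈ Metric.closedBall (0 : P) ((N.J : ℝ) - 3),
      N.Controlled hh χ V ϑ R c e j x' := by
    intro j
    refine (isCompact_closedBall (0 : P) ((N.J : ℝ) - 3)).induction_on
      (p := fun s => ∃ e > 0, ∀ x' ∈ s, N.Controlled hh χ V ϑ R c e j x')
      ⟨1, one_pos, by simp⟩ ?_ ?_ ?_
    · rintro s t hst ⟨e, he, H⟩
      exact ⟨e, he, fun x hx => H x (hst hx)⟩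
    · rintro s t ⟨e, he, H⟩ ⟨e', he', H'⟩
      refine ⟨min e e', lt_min he he', ?_⟩
      rintro x (hx | hx)
      · exact (H x hx).anti N hR (min_le_left _ _)
      · exact (H' x hx).anti N hR (min_le_right _ _)
    · intro x' hx'
      obtain ⟨i, h1, h2, h3⟩ := HR j x' hx'
      obtain ⟨e, he, H⟩ := N.exists_eventually_controlled hh hC hCN hstab hsmooth hV hVM hχ hχM hR
        hx' h1 h2 h3 hc
      exact ⟨_, mem_nhdsWithin_of_mem_nhds H, e, he, fun t ht => ht⟩
  choose e he H using key
  rcases isEmpty_or_nonempty (Fin N.s) with hs | hs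
  · exact ⟨1, one_pos, fun j => (hs.false j).elim⟩
  · obtain ⟨j₀, hj₀⟩ := Finite.exists_min e
    exact ⟨e j₀, he j₀, fun j x' hx' => (H j x' hx').anti N hR (hj₀ j)⟩

end NormalBundleCover

end Control

/-! ### The graph transform of a controlled map -/

section GraphTransform

open Filter

set_option linter.unusedSectionVars false

/-- A locally `δ`-Lipschitz function on a convex set is `δ`-Lipschitz. -/
lemma Convex.norm_sub_le_of_eventually {G H : Type*} [NormedAddCommGroup G] [NormedSpace ℝ G]
    [NormedAddCommGroup H] {s : Set G} (hs : Convex ℝ s) {f : G → H} {δ : ℝ}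
    (hf : ∀ x ∈ s, ∀ᶠ z in 𝓝 (x, x), ‖f z.1 - f z.2‖ ≤ δ * ‖z.1 - z.2‖) {a b : G} (ha : a ∈ s)
    (hb : b ∈ s) : ‖f a - f b‖ ≤ δ * ‖a - b‖ := by
  let γ : ℝ → G := fun t => b + t • (a - b)
  have hγc : Continuous γ := by fun_prop
  have hγs : ∀ t ∈ Icc (0 : ℝ) 1, γ t ∈ s := fun t ht => by
    have := hs.add_smul_sub_mem hb ha ht
    exact this
  have hγd : ∀ t t', ‖γ t - γ t'‖ = |t - t'| * ‖a - b‖ := fun t t' => by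
    simp only [γ, add_sub_add_left_eq_sub, ← sub_smul, norm_smul, Real.norm_eq_abs]
  have hloc : ∀ t ∈ Icc (0 : ℝ) 1, ∀ᶠ t' in 𝓝 t,
      ‖f (γ t') - f (γ t)‖ ≤ δ * (|t' - t| * ‖a - b‖) := by
    intro t ht
    have h1 : Tendsto (fun t' => (γ t', γ t)) (𝓝 t) (𝓝 (γ t, γ t)) :=
      (hγc.prodMk continuous_const).tendsto t
    filter_upwards [h1.eventually (hf _ (hγs t ht))] with t' h
    rwa [hγd] at h
  have hcont : ContinuousOn (fun t => f (γ t)) (Icc 0 1) := by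
    intro t ht
    refine ContinuousAt.continuousWithinAt ?_
    rw [ContinuousAt, tendsto_iff_norm_sub_tendsto_zero]
    refine squeeze_zero' (Eventually.of_forall fun _ => norm_nonneg _) (hloc t ht) ?_
    have : Continuous fun t' : ℝ => δ * (|t' - t| * ‖a - b‖) := by fun_prop
    simpa using this.tendsto t
  have hall : Icc (0 : ℝ) 1 ⊆ {t | ‖f (γ t) - f b‖ ≤ δ * (t * ‖a - b‖)} := by
    refine IsClosed.Icc_subset_of_forall_mem_nhdsWithin ?_ (by simp [γ]) ?_
    · rw [inter_comm]
      exact isClosed_Icc.isClosed_le (f := fun t => ‖f (γ t) - f b‖)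
        ((hcont.sub continuousOn_const).norm) (by fun_prop)
    · rintro t ⟨ht1, ht2⟩
      filter_upwards [mem_nhdsWithin_of_mem_nhds (hloc t ⟨ht2.1, ht2.2.le⟩), self_mem_nhdsWithin]
        with t' h1 h2
      have h3 : t < t' := h2
      rw [abs_of_pos (sub_pos.2 h3)] at h1
      have h4 : ‖f (γ t) - f b‖ ≤ δ * (t * ‖a - b‖) := ht1
      calc ‖f (γ t') - f b‖ ≤ ‖f (γ t') - f (γ t)‖ + ‖f (γ t) - f b‖ :=
            norm_sub_le_norm_sub_add_norm_sub _ _ _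
        _ ≤ δ * (t' * ‖a - b‖) := by linarith
  have h1 := hall (right_mem_Icc.2 zero_le_one)
  simpa [γ] using h1

variable {E P F X M' : Type*}
  [NormedAddCommGroup E] [InnerProductSpace ℝ E] [CompleteSpace E]
  [NormedAddCommGroup P] [InnerProductSpace ℝ P] [FiniteDimensional ℝ P]
  [NormedAddCommGroup F] [InnerProductSpace ℝ F] [CompleteSpace F]
  [EMetricSpace X] [ChartedSpace E X] [IsManifold 𝓘(ℝ, E) 1 X]
  [Bundle.RiemannianBundle (fun x : X => TangentSpace 𝓘(ℝ, E) x)]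
  [IsContinuousRiemannianBundle E (fun x : X => TangentSpace 𝓘(ℝ, E) x)]
  [TopologicalSpace M'] [ChartedSpace P M'] [IsManifold 𝓘(ℝ, P) 1 M']
  [Bundle.RiemannianBundle (fun p : M' => TangentSpace 𝓘(ℝ, P) p)]
  {n : WithTop ℕ∞} {D : NegInvariantManifold E P X M' n} (N : NormalBundleCover F D)
  {ρ : ℝ} {h : TangentBundle 𝓘(ℝ, E) X → X}
  {a : ℕ} {χ : Fin a → OpenPartialHomeomorph X E} {V : Set X}

namespace NormalBundleCover

/-- Control of a single map `T` near the point of `M'` with coordinate `x''` in the chart `σ j`: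
in tubular coordinates `T` is, near the preimage of this point, a dominated block map up to a
Lipschitz error of size `c` and almost preserves the zero section, and the points of the disc
bundle of radius `ε` that are mapped near the given point have their base point in `Mbar`, in the
ball where `T` is controlled. -/
def LocalControl (hh : N.IsTubular ρ h) (T : X → X) (θ R c ε : ℝ) (j : Fin N.s) (x'' : P) :
    Prop :=
  ∃ (i : Fin N.s) (x x' : P) (r : ℝ) (L : P × F →L[ℝ] P × F) (A : P →L[ℝ] P) (b : F →L[ℝ] F),
    0 < r ∧ r ≤ ρ ∧ 4 * R * (R + 3) * ε ≤ r ∧ Metric.ball x r ⊆ Metric.ball 0 1 ∧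
    (N.σ i).symm '' Metric.ball x r ⊆ D.Mbar ∧ IsDominatedBlock θ R L A b ∧
    (∀ z ∈ Metric.ball (x, (0 : F)) r, T (N.tube h i z) ∈ (N.tubeHomeo hh j).target ∧
        ContDiffAt ℝ 1 (N.transition hh i j T) z) ∧
    (∀ z ∈ Metric.ball (x, (0 : F)) r, ∀ z' ∈ Metric.ball (x, (0 : F)) r,
        ‖N.transition hh i j T z - N.transition hh i j T z' - L (z - z')‖ ≤ c * ‖z - z'‖) ∧
    ‖N.transition hh i j T (x, 0) - (x', 0)‖ ≤ (1 - θ) / 16 * ε ∧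
    ‖x'' - x'‖ ≤ (1 - θ) / 16 * ε ∧
    ∀ᶠ s in 𝓝 x'', ∀ i', ∀ t ∈ Metric.closedBall (0 : P) ((N.J : ℝ) - 3), ∀ y y' : F,
      ‖y‖ < ε → ‖y'‖ < ε → T (N.tube h i' (t, y)) = N.tube h j (s, y') →
        (N.σ i').symm t ∈ (N.σ i).symm '' Metric.ball x r

lemma eventually_localControl (hh : N.IsTubular ρ h) {θ R c e ε : ℝ} (hθ : θ < 1)
    (hR : 1 ≤ R) (hV : IsOpen V) (hVM : range D.ι ⊆ V)
    (hctrl : ∀ j, ∀ x' ∈ Metric.closedBall (0 : P) ((N.J : ℝ) - 3),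
      N.Controlled hh χ V θ R c e j x') (hε : 0 < ε) (hεe : ε ≤ e) :
    ∀ᶠ T in perturbations χ V D.S, ∀ j, ∀ x'' ∈ Metric.closedBall (0 : P) ((N.J : ℝ) - 3),
      N.LocalControl hh T θ R c ε j x'' := by
  refine eventually_all.2 fun j => ?_
  have hK : IsCompact (Metric.closedBall (0 : P) ((N.J : ℝ) - 3)) := isCompact_closedBall _ _
  have key : {q : (X → X) × P | N.LocalControl hh q.1 θ R c ε j q.2} ∈
      perturbations χ V D.S ×ˢ 𝓝ˢ (Metric.closedBall (0 : P) ((N.J : ℝ) - 3)) := by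
    refine hK.mem_prod_nhdsSet_of_forall fun x' hx' => ?_
    have hxJ := N.closedBall_subset_ball_J (by linarith) hx'
    obtain ⟨i, x, r, L, A, b, h1, h2, h3, h4, h5, h6, h7, h8, h9⟩ :=
      (hctrl j x' hx').anti N hR hεe
    have hx1 : x ∈ Metric.ball (0 : P) 1 := h4 (Metric.mem_ball_self h1)
    have hxJ' := N.ball_one_subset hx1
    have hz := N.zero_mem_prod hh hxJ' (ρ := ρ) (h := h)
    have hs : 0 < (1 - θ) / 16 * ε := by
      have : 0 < 1 - θ := sub_pos.2 hθ
      positivity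
    have g1 : Tendsto (fun T : X → X => T (N.tube h i (x, 0))) (perturbations χ V D.S)
        (𝓝 (N.tube h j (x', 0))) := by
      rw [← h6]
      have := tendsto_comp_perturbations (χ := χ) hV (H := fun _ : Unit => N.tube h i (x, 0))
        (z := ()) continuousAt_const
        (by rw [N.tube_zero hh i hxJ']; exact hVM (mem_range_self _))
        D.contMDiff_S.continuous.continuousAt
      exact this.comp (tendsto_id.prodMk tendsto_const_nhds)
    have g2 : Tendsto (fun T : X → X => N.transition hh i j T (x, 0)) (perturbations χ V D.S)
        (𝓝 (x', 0)) := by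
      have := (N.contMDiffAt_tubeHomeo_symm hh
        (N.tube_mem_target hh j (N.zero_mem_prod hh hxJ))).continuousAt.tendsto
      rw [N.tubeHomeo_symm_tube hh j (N.zero_mem_prod hh hxJ)] at this
      exact this.comp g1
    have g3 : ∀ᶠ T in perturbations χ V D.S,
        ‖N.transition hh i j T (x, 0) - (x', 0)‖ < (1 - θ) / 16 * ε := by
      filter_upwards [Metric.tendsto_nhds.1 g2 _ hs] with T hT
      rwa [dist_eq_norm] at hT
    have g4 : ∀ᶠ s in 𝓝 x', ‖s - x'‖ < (1 - θ) / 16 * ε := by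
      filter_upwards [Metric.ball_mem_nhds x' hs] with s hs
      rwa [Metric.mem_ball, dist_eq_norm] at hs
    obtain ⟨pT, hpT, px, hpx, H⟩ := eventually_prod_iff.1 h9
    have g5 := (h8.and (g3.and hpT)).prod_mk (g4.and (eventually_eventually_nhds.2 hpx))
    filter_upwards [g5] with q hq
    obtain ⟨⟨q1, q2, q3⟩, q4, q5⟩ := hq
    refine ⟨i, x, x', r, L, A, b, h1, h2, h3, h4, h7, h5, q1.1, q1.2, q2.le, q4.le, ?_⟩
    filter_upwards [q5] with s hs using H q3 hs
  obtain ⟨A, hA, B, hB, hAB⟩ := mem_prod_iff.1 key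
  filter_upwards [hA] with T hT x'' hx''
  exact hAB (mk_mem_prod hT (subset_of_mem_nhdsSet hB hx''))

/-- The graph of the section `v` of the disc bundle of radius `ε` consists of images under `T` of
points of the graph of `u`. -/
def IsGraphImage (h : TangentBundle 𝓘(ℝ, E) X → X) (ε : ℝ) (T : X → X)
    (u v : ∀ p : M', TangentSpace 𝓘(ℝ, E) (D.ι p)) : Prop :=
  ∀ p ∈ N.base, v p ∈ N.fiber (D.ι p) ∧ ‖v p‖ < ε ∧
    ∃ q ∈ N.base, T (D.graph h u q) = D.graph h v p

lemma ball_subset_ball_J : Metric.ball (0 : P) ((N.J : ℝ) - 3) ⊆ Metric.ball (0 : P) N.J :=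
  Metric.ball_subset_ball (by linarith)

lemma ball_one_subset_ball : Metric.ball (0 : P) 1 ⊆ Metric.ball (0 : P) ((N.J : ℝ) - 3) :=
  Metric.ball_subset_ball (by linarith [N.J_ge])

lemma symm_mem_base (i : Fin N.s) {x : P} (hx : x ∈ Metric.ball (0 : P) ((N.J : ℝ) - 3)) :
    (N.σ i).symm x ∈ N.base := N.U_subset_base i le_rfl ⟨x, hx, rfl⟩

lemma exists_symm_eq {p : M'} (hp : p ∈ N.base) :
    ∃ i, ∃ x ∈ Metric.ball (0 : P) ((N.J : ℝ) - 3), (N.σ i).symm x = p := by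
  obtain ⟨i, hi⟩ := mem_iUnion.1 hp
  obtain ⟨x, hx, rfl⟩ := hi
  exact ⟨i, x, hx, rfl⟩

variable {N} {hh : N.IsTubular ρ h} {T : X → X} {θ R δ c ε : ℝ} {j : Fin N.s} {x'' : P}
  {u u' v v' : ∀ p : M', TangentSpace 𝓘(ℝ, E) (D.ι p)}

lemma norm_loc_lt (hu : u ∈ N.LipSection ε δ) (i : Fin N.s) {x : P}
    (hx : x ∈ Metric.ball (0 : P) ((N.J : ℝ) - 3)) : ‖N.loc u i x‖ < ε := by
  have h1 := hu.1 _ (N.symm_mem_base i hx)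
  rw [N.norm_loc i (N.ball_subset_ball_J hx) h1.1]
  exact h1.2

lemma graph_eq_tube_of_mem (hu : u ∈ N.LipSection ε δ) (i : Fin N.s) {x : P}
    (hx : x ∈ Metric.ball (0 : P) ((N.J : ℝ) - 3)) :
    D.graph h u ((N.σ i).symm x) = N.tube h i (x, N.loc u i x) :=
  N.graph_eq_tube i (N.ball_subset_ball_J hx) (hu.1 _ (N.symm_mem_base i hx)).1

namespace LocalControl

/-- The image of a section has points over every point of the base. -/
lemma exists_preimage (hK : GraphConstants θ R δ c) (hc : N.LocalControl hh T θ R c ε j x'')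
    (hε : 0 < ε) (hu : u ∈ N.LipSection ε δ) :
    ∃ q ∈ N.base, ∃ y' : F, ‖y'‖ ≤ (1 + θ) / 2 * ε ∧
      T (D.graph h u q) = N.tube h j (x'', y') := by
  obtain ⟨i, x, x', r, L, A, b, h1, h2, h3, h4, h5, h6, h7, h8, h9, h10, h11⟩ := hc
  have hsub : Metric.ball x r ⊆ Metric.ball 0 ((N.J : ℝ) - 3) := h4.trans N.ball_one_subset_ball
  obtain ⟨t, ht, ht1, ht2⟩ := hK.exists_preimage h6 (x'' := x'') (u := N.loc u i) h1 hε h3 h8 h9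
    h10 (fun t ht => norm_loc_lt hu i (hsub ht))
    (fun t ht t' ht' => hu.2 i t (hsub ht) t' (hsub ht'))
  refine ⟨_, N.symm_mem_base i (hsub ht), _, ht2, ?_⟩
  have hεr : ε < r := by
    have := hK.one_le
    have : 16 * ε ≤ 4 * R * (R + 3) * ε := by gcongr; nlinarith
    linarith
  have hz : (t, N.loc u i t) ∈ Metric.ball (x, (0 : F)) r := by
    rw [← ball_prod_same]
    exact ⟨ht, by simpa using (norm_loc_lt hu i (hsub ht)).trans hεr⟩
  rw [graph_eq_tube_of_mem hu i (hsub ht), ← N.tube_tubeHomeo_symm hh j (h7 _ hz).1]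
  congr 1
  exact Prod.ext ht1 rfl

/-- The local data of a controlled map that are used to compare sections: all points of graphs of
sections that are mapped near the given point are seen in one coordinate system, in which the map
is a dominated block map up to a small Lipschitz error. -/
lemma exists_chart (hK : GraphConstants θ R δ c) (hc : N.LocalControl hh T θ R c ε j x'')
    (hε : 0 < ε) (hx'' : x'' ∈ Metric.ball (0 : P) N.J) :
    ∃ (i : Fin N.s) (x : P) (r : ℝ) (L : P × F →L[ℝ] P × F) (A : P →L[ℝ] P) (b : F →L[ℝ] F),
      0 < r ∧ ε < r ∧ Metric.ball x r ⊆ Metric.ball 0 ((N.J : ℝ) - 3) ∧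
      (N.σ i).symm '' Metric.ball x r ⊆ D.Mbar ∧ IsDominatedBlock θ R L A b ∧
      (∀ z ∈ Metric.ball (x, (0 : F)) r, ContDiffAt ℝ 1 (N.transition hh i j T) z) ∧
      (∀ z ∈ Metric.ball (x, (0 : F)) r, ∀ z' ∈ Metric.ball (x, (0 : F)) r,
        ‖N.transition hh i j T z - N.transition hh i j T z' - L (z - z')‖ ≤ c * ‖z - z'‖) ∧
      ∀ᶠ s in 𝓝 x'', ∀ u ∈ N.LipSection ε δ, ∀ q ∈ N.base, ∀ y' : F, ‖y'‖ < ε →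
        T (D.graph h u q) = N.tube h j (s, y') → ∃ t ∈ Metric.ball x r, (N.σ i).symm t = q ∧
          (t, N.loc u i t) ∈ Metric.ball (x, (0 : F)) r ∧
          N.transition hh i j T (t, N.loc u i t) = (s, y') := by
  obtain ⟨i, x, x', r, L, A, b, h1, h2, h3, h4, h5, h6, h7, h8, h9, h10, h11⟩ := hc
  have hsub : Metric.ball x r ⊆ Metric.ball 0 ((N.J : ℝ) - 3) := h4.trans N.ball_one_subset_ball
  have hεr : ε < r := by
    have := hK.one_le
    have : 16 * ε ≤ 4 * R * (R + 3) * ε := by gcongr; nlinarith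
    linarith
  refine ⟨i, x, r, L, A, b, h1, hεr, hsub, h5, h6, fun z hz => (h7 z hz).2, h8, ?_⟩
  filter_upwards [h11, Metric.isOpen_ball.mem_nhds hx''] with s hs hsJ u hu q hq y' hy' hTq
  obtain ⟨i', t', ht', rfl⟩ := N.exists_symm_eq hq
  have hTq' := hTq
  rw [graph_eq_tube_of_mem hu i' ht'] at hTq'
  obtain ⟨t, ht, htt⟩ := hs i' t' (Metric.ball_subset_closedBall ht') _ _ (norm_loc_lt hu i' ht')
    hy' hTq'
  rw [← htt, graph_eq_tube_of_mem hu i (hsub ht)] at hTq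
  refine ⟨t, ht, htt, ?_, ?_⟩
  · rw [← ball_prod_same]
    exact ⟨ht, by simpa using (norm_loc_lt hu i (hsub ht)).trans hεr⟩
  · rw [transition, hTq]
    exact N.tubeHomeo_symm_tube hh j ⟨hsJ, by simpa using hy'.trans (hεr.trans_le h2)⟩

/-- The preimages of points over the base lie over `Mbar`. -/
lemma mem_Mbar (hK : GraphConstants θ R δ c) (hc : N.LocalControl hh T θ R c ε j x'')
    (hε : 0 < ε) (hx'' : x'' ∈ Metric.ball (0 : P) N.J) (hu : u ∈ N.LipSection ε δ) {q : M'}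
    (hq : q ∈ N.base) {y' : F} (hy' : ‖y'‖ < ε) (hT : T (D.graph h u q) = N.tube h j (x'', y')) :
    q ∈ D.Mbar := by
  obtain ⟨i, x, r, L, A, b, h1, h2, h3, h4, h5, h6, h7, h8⟩ := hc.exists_chart hK hε hx''
  obtain ⟨t, ht, rfl, -⟩ := h8.self_of_nhds u hu q hq y' hy' hT
  exact h4 ⟨t, ht, rfl⟩

/-- The graph transform contracts the distance of sections. -/
lemma contraction (hK : GraphConstants θ R δ c) (hc : N.LocalControl hh T θ R c ε j x'')
    (hε : 0 < ε) (hx'' : x'' ∈ Metric.ball (0 : P) N.J) (hu : u ∈ N.LipSection ε δ)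
    (hv : v ∈ N.LipSection ε δ) {d : ℝ} (hd : 0 ≤ d) (huv : ∀ p ∈ N.base, ‖u p - v p‖ ≤ d)
    {q q' : M'} (hq : q ∈ N.base) (hq' : q' ∈ N.base) {y y' : F} (hy : ‖y‖ < ε) (hy' : ‖y'‖ < ε)
    (hT : T (D.graph h u q) = N.tube h j (x'', y))
    (hT' : T (D.graph h v q') = N.tube h j (x'', y')) :
    ‖y - y'‖ ≤ (1 + θ) / 2 * d ∧ (d = 0 → q = q') := by
  obtain ⟨i, x, r, L, A, b, h1, h2, h3, h4, h5, h6, h7, h8⟩ := hc.exists_chart hK hε hx''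
  obtain ⟨t, ht, rfl, htm, ht2⟩ := h8.self_of_nhds u hu q hq y hy hT
  obtain ⟨t', ht', rfl, htm', ht2'⟩ := h8.self_of_nhds v hv q' hq' y' hy' hT'
  have h9 := h7 _ htm _ htm'
  rw [ht2, ht2'] at h9
  have h10 : ‖N.loc u i t' - N.loc v i t'‖ ≤ d := by
    rw [N.norm_loc_sub_loc i (N.ball_subset_ball_J (h3 ht')) (hu.1 _ hq').1 (hv.1 _ hq').1]
    exact huv _ hq'
  have h11 : ‖N.loc u i t - N.loc v i t'‖ ≤ δ * ‖t - t'‖ + d := by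
    have := hu.2 i t (h3 ht) t' (h3 ht')
    linarith [norm_sub_le_norm_sub_add_norm_sub (N.loc u i t) (N.loc u i t') (N.loc v i t')]
  obtain ⟨h12, h13⟩ := hK.contraction h5 hd h9 (by simp) (by simpa using h11)
  refine ⟨by simpa using h13, fun hd0 => ?_⟩
  rw [hd0, mul_zero] at h12
  have : t = t' := sub_eq_zero.1 (norm_le_zero_iff.1 h12)
  rw [this]

/-- The graph transform preserves the Lipschitz bound of a section, and improves its defect of
strict differentiability. -/
lemma eventually_norm_sub_le (hK : GraphConstants θ R δ c)
    (hc : N.LocalControl hh T θ R c ε j x'') (hε : 0 < ε)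
    (hx'' : x'' ∈ Metric.ball (0 : P) ((N.J : ℝ) - 3)) (hu : u ∈ N.LipSection ε δ)
    (huv : N.IsGraphImage h ε T u v) :
    (∀ᶠ z in 𝓝 (x'', x''), ‖N.loc v j z.1 - N.loc v j z.2‖ ≤ δ * ‖z.1 - z.2‖) ∧
    ∀ η, 0 < η → η ≤ δ →
      (∀ i, ∀ x ∈ Metric.ball (0 : P) ((N.J : ℝ) - 3), DefectLE (N.loc u i) x η) →
      DefectLE (N.loc v j) x'' ((1 + θ) / 2 * η) := by
  obtain ⟨i, x, r, L, A, b, h1, h2, h3, h4, h5, h6, h7, h8⟩ :=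
    hc.exists_chart hK hε (N.ball_subset_ball_J hx'')
  have key : ∀ᶠ s in 𝓝 x'', ∃ t ∈ Metric.ball x r, (t, N.loc u i t) ∈ Metric.ball (x, (0 : F)) r ∧
      N.transition hh i j T (t, N.loc u i t) = (s, N.loc v j s) := by
    filter_upwards [h8, Metric.isOpen_ball.mem_nhds hx''] with s hs hs3
    obtain ⟨hv1, hv2, q, hq, hTq⟩ := huv _ (N.symm_mem_base j hs3)
    have hsJ := N.ball_subset_ball_J hs3
    rw [N.graph_eq_tube j hsJ hv1] at hTq
    rw [← N.norm_loc j hsJ hv1] at hv2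
    obtain ⟨t, ht, -, ht2⟩ := hs u hu q hq _ hv2 hTq
    exact ⟨t, ht, ht2⟩
  obtain ⟨ξ, hξ⟩ := key.choice
  have hpair : ∀ᶠ z in 𝓝 (x'', x''), ‖ξ z.1 - ξ z.2‖ ≤ 2 * R * ‖z.1 - z.2‖ ∧
      ‖N.loc v j z.1 - N.loc v j z.2‖ ≤ δ * ‖z.1 - z.2‖ := by
    rw [nhds_prod_eq]
    filter_upwards [hξ.prod_mk hξ] with z ⟨⟨a1, a2, a3⟩, b1, b2, b3⟩
    have h9 := h7 _ a2 _ b2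
    rw [a3, b3] at h9
    exact hK.lipschitz h5 h9 (hu.2 i _ (h3 a1) _ (h3 b1))
  refine ⟨hpair.mono fun z hz => hz.2, fun η hη hηδ hdef => ?_⟩
  obtain ⟨c1, c2, c3⟩ := hξ.self_of_nhds
  have hdiff := h6 _ c2
  have hΛ := hdiff.hasStrictFDerivAt one_ne_zero
  have hΛL : ‖fderiv ℝ (N.transition hh i j T) (ξ x'', N.loc u i (ξ x'')) - L‖ ≤ c := by
    refine (hΛ.hasFDerivAt.sub L.hasFDerivAt).le_of_lip' hK.acc_pos.le ?_
    filter_upwards [Metric.isOpen_ball.mem_nhds c2] with z hz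
    have := h7 z hz _ c2
    rw [map_sub] at this
    simpa only [Pi.sub_apply, sub_sub_sub_comm] using this
  have hξc : Tendsto ξ (𝓝 x'') (𝓝 (ξ x'')) := by
    rw [tendsto_iff_norm_sub_tendsto_zero]
    have g1 : Tendsto (fun s => (s, x'')) (𝓝 x'') (𝓝 (x'', x'')) :=
      Continuous.tendsto (f := fun s => (s, x'')) (by fun_prop) x''
    refine squeeze_zero' (Eventually.of_forall fun _ => norm_nonneg _)
      ((g1.eventually hpair).mono fun s hs => hs.1) ?_
    have : Continuous fun s : P => 2 * R * ‖s - x''‖ := by fun_prop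
    simpa using this.tendsto x''
  refine hK.defectLE_image h5 hΛ hΛL ?_ hξc (hξ.mono fun s hs => hs.2.2) hη hηδ
    (hdef i _ (h3 c1))
  have g2 := (Metric.isOpen_ball.mem_nhds (h3 c1))
  rw [nhds_prod_eq]
  filter_upwards [Eventually.prod_mk g2 g2] with z hz using hu.2 i _ hz.1 _ hz.2

end LocalControl

end NormalBundleCover

end GraphTransform

/-! ### The invariant section -/

section InvariantSection

open Filter

set_option linter.unusedSectionVars false

variable {E P F X M' : Type*}
  [NormedAddCommGroup E] [InnerProductSpace ℝ E] [CompleteSpace E]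
  [NormedAddCommGroup P] [InnerProductSpace ℝ P] [FiniteDimensional ℝ P]
  [NormedAddCommGroup F] [InnerProductSpace ℝ F] [CompleteSpace F]
  [EMetricSpace X] [ChartedSpace E X] [IsManifold 𝓘(ℝ, E) 1 X]
  [Bundle.RiemannianBundle (fun x : X => TangentSpace 𝓘(ℝ, E) x)]
  [IsContinuousRiemannianBundle E (fun x : X => TangentSpace 𝓘(ℝ, E) x)]
  [TopologicalSpace M'] [ChartedSpace P M'] [IsManifold 𝓘(ℝ, P) 1 M']
  [Bundle.RiemannianBundle (fun p : M' => TangentSpace 𝓘(ℝ, P) p)]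
  {n : WithTop ℕ∞} {D : NegInvariantManifold E P X M' n} {N : NormalBundleCover F D}
  {ρ : ℝ} {h : TangentBundle 𝓘(ℝ, E) X → X}

namespace NormalBundleCover

variable {hh : N.IsTubular ρ h} {T : X → X} {θ R δ c ε : ℝ}
  {u u' v v' : ∀ p : M', TangentSpace 𝓘(ℝ, E) (D.ι p)}

lemma IsGraphImage.mem_lipSection (hK : GraphConstants θ R δ c)
    (hc : ∀ j, ∀ x ∈ Metric.closedBall (0 : P) ((N.J : ℝ) - 3), N.LocalControl hh T θ R c ε j x)
    (hε : 0 < ε) (hu : u ∈ N.LipSection ε δ) (huv : N.IsGraphImage h ε T u v) :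
    v ∈ N.LipSection ε δ := by
  refine ⟨fun p hp => ⟨(huv p hp).1, (huv p hp).2.1⟩, fun i x hx x' hx' => ?_⟩
  refine (convex_ball (0 : P) ((N.J : ℝ) - 3)).norm_sub_le_of_eventually (fun s hs => ?_) hx hx'
  exact ((hc i s (Metric.ball_subset_closedBall hs)).eventually_norm_sub_le hK hε hs hu huv).1

lemma exists_isGraphImage (hK : GraphConstants θ R δ c)
    (hc : ∀ j, ∀ x ∈ Metric.closedBall (0 : P) ((N.J : ℝ) - 3), N.LocalControl hh T θ R c ε j x)
    (hε : 0 < ε) (hu : u ∈ N.LipSection ε δ) :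
    ∃ v, N.IsGraphImage h ε T u v ∧ ∀ p ∈ N.base, ‖v p‖ ≤ (1 + θ) / 2 * ε := by
  classical
  have key : ∀ p, ∃ w : TangentSpace 𝓘(ℝ, E) (D.ι p), p ∈ N.base →
      w ∈ N.fiber (D.ι p) ∧ ‖w‖ ≤ (1 + θ) / 2 * ε ∧
      ∃ q ∈ N.base, T (D.graph h u q) = h ⟨D.ι p, w⟩ := by
    intro p
    by_cases hp : p ∈ N.base
    · obtain ⟨j, x, hx, rfl⟩ := N.exists_symm_eq hp
      obtain ⟨q, hq, y, hy, hT⟩ :=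
        (hc j x (Metric.ball_subset_closedBall hx)).exists_preimage hK hε hu
      have hxJ := N.ball_subset_ball_J hx
      refine ⟨N.e j _ y, fun _ => ⟨N.e_mem_fiber j hxJ y, ?_, q, hq, hT⟩⟩
      rwa [N.norm_e j x hxJ]
    · exact ⟨0, fun hp' => absurd hp' hp⟩
  choose v hv using key
  have hlt : (1 + θ) / 2 * ε < ε := by
    have := hK.rate_lt
    nlinarith
  exact ⟨v, fun p hp => ⟨(hv p hp).1, (hv p hp).2.1.trans_lt hlt, (hv p hp).2.2⟩,
    fun p hp => (hv p hp).2.1⟩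

lemma IsGraphImage.contraction (hK : GraphConstants θ R δ c)
    (hc : ∀ j, ∀ x ∈ Metric.closedBall (0 : P) ((N.J : ℝ) - 3), N.LocalControl hh T θ R c ε j x)
    (hε : 0 < ε) (hu : u ∈ N.LipSection ε δ) (hv : v ∈ N.LipSection ε δ)
    (hu' : N.IsGraphImage h ε T u u') (hv' : N.IsGraphImage h ε T v v') {d : ℝ} (hd : 0 ≤ d)
    (huv : ∀ p ∈ N.base, ‖u p - v p‖ ≤ d) {p : M'} (hp : p ∈ N.base) :
    ‖u' p - v' p‖ ≤ (1 + θ) / 2 * d := by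
  obtain ⟨a1, a2, q, hq, hT⟩ := hu' p hp
  obtain ⟨b1, b2, q', hq', hT'⟩ := hv' p hp
  obtain ⟨j, x, hx, rfl⟩ := N.exists_symm_eq hp
  have hxJ := N.ball_subset_ball_J hx
  rw [N.graph_eq_tube j hxJ a1] at hT
  rw [N.graph_eq_tube j hxJ b1] at hT'
  rw [← N.norm_loc j hxJ a1] at a2
  rw [← N.norm_loc j hxJ b1] at b2
  rw [← N.norm_loc_sub_loc j hxJ a1 b1]
  exact ((hc j x (Metric.ball_subset_closedBall hx)).contraction hK hε hxJ hu hv hd huv hq hq'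
    a2 b2 hT hT').1

lemma zero_mem_lipSection (hε : 0 < ε) (hδ : 0 ≤ δ) : (fun _ => 0) ∈ N.LipSection ε δ := by
  refine ⟨fun p _ => ⟨zero_mem _, by simpa using hε⟩, fun i x _ x' _ => ?_⟩
  simp only [loc, map_zero, sub_zero, norm_zero]
  positivity

/-- The graph transform has a fixed point, as the limit of its iterates on the zero section. -/
lemma exists_isGraphImage_self (hK : GraphConstants θ R δ c)
    (hc : ∀ j, ∀ x ∈ Metric.closedBall (0 : P) ((N.J : ℝ) - 3), N.LocalControl hh T θ R c ε j x)
    (hε : 0 < ε) : ∃ u ∈ N.LipSection ε δ, N.IsGraphImage h ε T u u := by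
  classical
  set κ := (1 + θ) / 2 with hκ
  have hκ0 : 0 < κ := by have := hK.rate_pos; positivity
  have hκ1 : κ < 1 := by have := hK.rate_lt; rw [hκ]; linarith
  have hκε : κ * ε < ε := by nlinarith
  have step : ∀ u : N.LipSection ε δ, ∃ v : N.LipSection ε δ, N.IsGraphImage h ε T u.1 v.1 ∧
      ∀ p ∈ N.base, ‖v.1 p‖ ≤ κ * ε := by
    intro u
    obtain ⟨v, h1, h2⟩ := exists_isGraphImage hK hc hε u.2
    exact ⟨⟨v, h1.mem_lipSection hK hc hε u.2⟩, h1, h2⟩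
  choose Γ hΓ hΓn using step
  let s : ℕ → N.LipSection ε δ := fun k => Γ^[k] ⟨_, zero_mem_lipSection hε hK.lip_pos.le⟩
  have hs : ∀ k, s (k + 1) = Γ (s k) := fun k => Function.iterate_succ_apply' Γ k _
  have hstep : ∀ k, ∀ p ∈ N.base, ‖(s k).1 p - (s (k + 1)).1 p‖ ≤ ε * κ ^ k := by
    intro k
    induction k with
    | zero =>
      intro p hp
      have h0 : (s 0).1 p = 0 := rfl
      rw [h0, zero_sub, norm_neg, pow_zero, mul_one]
      exact ((s 1).2.1 p hp).2.le
    | succ k ih =>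
      intro p hp
      rw [hs k, hs (k + 1)]
      have := (hΓ (s k)).contraction hK hc hε (s k).2 (s (k + 1)).2 (hΓ (s (k + 1)))
        (by positivity) ih hp
      refine this.trans (le_of_eq ?_)
      rw [pow_succ]; ring
  -- pointwise limits, taken in the model fibre
  have hlim : ∀ p, ∃ w : TangentSpace 𝓘(ℝ, E) (D.ι p), p ∈ N.base → w ∈ N.fiber (D.ι p) ∧
      ∀ k, ‖(s k).1 p - w‖ ≤ ε * κ ^ k / (1 - κ) := by
    intro p
    by_cases hp : p ∈ N.base
    · obtain ⟨j, x, hx, rfl⟩ := N.exists_symm_eq hp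
      have hxJ := N.ball_subset_ball_J hx
      have hmem := fun k => ((s k).2.1 _ hp).1
      have hd : ∀ k, dist (N.loc (s k).1 j x) (N.loc (s (k + 1)).1 j x) ≤ ε * κ ^ k := fun k => by
        rw [dist_eq_norm, N.norm_loc_sub_loc j hxJ (hmem k) (hmem (k + 1))]
        exact hstep k _ hp
      obtain ⟨y, hy⟩ := cauchySeq_tendsto_of_complete (cauchySeq_of_le_geometric κ ε hκ1 hd)
      refine ⟨N.e j _ y, fun _ => ⟨N.e_mem_fiber j hxJ y, fun k => ?_⟩⟩
      have h1 := dist_le_of_le_geometric_of_tendsto κ ε hκ1 hd hy k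
      rw [dist_eq_norm] at h1
      rwa [← N.e_loc j hxJ (hmem k), ← map_sub, N.norm_e j x hxJ]
    · exact ⟨0, fun hp' => absurd hp' hp⟩
  choose w hw using hlim
  have hlim0 : Tendsto (fun k : ℕ => ε * κ ^ k / (1 - κ)) atTop (𝓝 0) := by
    have := ((tendsto_pow_atTop_nhds_zero_of_lt_one hκ0.le hκ1).const_mul ε).div_const (1 - κ)
    simpa using this
  have hnorm : ∀ p ∈ N.base, ‖w p‖ ≤ κ * ε := by
    intro p hp
    have h0 : Tendsto (fun k : ℕ => κ * ε + ε * κ ^ (k + 1) / (1 - κ)) atTop (𝓝 (κ * ε)) := by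
      simpa using ((tendsto_add_atTop_iff_nat 1).2 hlim0).const_add (κ * ε)
    refine ge_of_tendsto h0 (Eventually.of_forall fun k => ?_)
    have h1 := (hw p hp).2 (k + 1)
    have h2 := hΓn (s k) p hp
    rw [← hs k] at h2
    have h3 := norm_sub_le ((s (k + 1)).1 p) ((s (k + 1)).1 p - w p)
    rw [sub_sub_cancel] at h3
    linarith
  have hwL : w ∈ N.LipSection ε δ := by
    refine ⟨fun p hp => ⟨(hw p hp).1, (hnorm p hp).trans_lt hκε⟩, fun i x hx x' hx' => ?_⟩
    have hloc : ∀ x ∈ Metric.ball (0 : P) ((N.J : ℝ) - 3),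
        Tendsto (fun k => N.loc (s k).1 i x) atTop (𝓝 (N.loc w i x)) := by
      intro x hx
      have hb := N.symm_mem_base i hx
      rw [tendsto_iff_norm_sub_tendsto_zero]
      refine squeeze_zero (fun _ => norm_nonneg _) (fun k => ?_) hlim0
      rw [N.norm_loc_sub_loc i (N.ball_subset_ball_J hx) ((s k).2.1 _ hb).1 (hw _ hb).1]
      exact (hw _ hb).2 k
    exact le_of_tendsto ((hloc x hx).sub (hloc x' hx')).norm
      (Eventually.of_forall fun k => (s k).2.2 i x hx x' hx')
  obtain ⟨v, hv, -⟩ := exists_isGraphImage hK hc hε hwL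
  have hvw : ∀ p ∈ N.base, v p = w p := by
    intro p hp
    have h1 : ∀ k : ℕ, ‖v p - w p‖ ≤ κ * (ε * κ ^ k / (1 - κ)) + ε * κ ^ (k + 1) / (1 - κ) := by
      intro k
      have h2 := (hΓ (s k)).contraction hK hc hε (s k).2 hwL hv
        (d := ε * κ ^ k / (1 - κ)) (by have := sub_pos.2 hκ1; positivity)
        (fun p hp => (hw p hp).2 k) hp
      rw [← hs k, ← hκ] at h2
      have h3 := (hw p hp).2 (k + 1)
      have h4 := norm_sub_le ((s (k + 1)).1 p - w p) ((s (k + 1)).1 p - v p)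
      rw [sub_sub_sub_cancel_left] at h4
      linarith
    have h2 : Tendsto (fun k : ℕ => κ * (ε * κ ^ k / (1 - κ)) + ε * κ ^ (k + 1) / (1 - κ)) atTop
        (𝓝 0) := by
      simpa using (hlim0.const_mul κ).add ((tendsto_add_atTop_iff_nat 1).2 hlim0)
    have h3 : ‖v p - w p‖ ≤ 0 := ge_of_tendsto h2 (Eventually.of_forall h1)
    exact sub_eq_zero.1 (norm_le_zero_iff.1 h3)
  refine ⟨w, hwL, fun p hp => ⟨(hw p hp).1, (hwL.1 p hp).2, ?_⟩⟩
  obtain ⟨-, -, q, hq, hT⟩ := hv p hp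
  refine ⟨q, hq, hT.trans ?_⟩
  simp only [NegInvariantManifold.graph, hvw p hp]

lemma IsGraphImage.eqOn (hK : GraphConstants θ R δ c)
    (hc : ∀ j, ∀ x ∈ Metric.closedBall (0 : P) ((N.J : ℝ) - 3), N.LocalControl hh T θ R c ε j x)
    (hε : 0 < ε) (hu : u ∈ N.LipSection ε δ) (hv : v ∈ N.LipSection ε δ)
    (hu' : N.IsGraphImage h ε T u u) (hv' : N.IsGraphImage h ε T v v) : EqOn u v N.base := by
  set κ := (1 + θ) / 2 with hκ
  have hκ0 : 0 < κ := by have := hK.rate_pos; positivity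
  have hκ1 : κ < 1 := by have := hK.rate_lt; rw [hκ]; linarith
  have h1 : ∀ k : ℕ, ∀ p ∈ N.base, ‖u p - v p‖ ≤ κ ^ k * (2 * ε) := by
    intro k
    induction k with
    | zero =>
      intro p hp
      have := norm_sub_le (u p) (v p)
      have h2 := (hu.1 p hp).2
      have h3 := (hv.1 p hp).2
      rw [pow_zero, one_mul]
      linarith
    | succ k ih =>
      intro p hp
      refine (hu'.contraction hK hc hε hu hv hv' (by positivity) ih hp).trans (le_of_eq ?_)
      rw [pow_succ]; ring
  intro p hp
  have h2 : Tendsto (fun k : ℕ => κ ^ k * (2 * ε)) atTop (𝓝 0) := by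
    simpa using (tendsto_pow_atTop_nhds_zero_of_lt_one hκ0.le hκ1).mul_const (2 * ε)
  have h3 : ‖u p - v p‖ ≤ 0 := ge_of_tendsto h2 (Eventually.of_forall fun k => h1 k p hp)
  have h4 : @Eq (TangentSpace 𝓘(ℝ, E) (D.ι p)) (u p) (v p) :=
    sub_eq_zero.1 (norm_le_zero_iff.1 h3)
  exact h4

/-- Two points of the graph of a section whose images lie over the same point of the base coincide,
and their base point belongs to `Mbar`. -/
lemma eq_of_apply_graph_eq (hK : GraphConstants θ R δ c)
    (hc : ∀ j, ∀ x ∈ Metric.closedBall (0 : P) ((N.J : ℝ) - 3), N.LocalControl hh T θ R c ε j x)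
    (hε : 0 < ε) (hu : u ∈ N.LipSection ε δ) {p q q' : M'} (hp : p ∈ N.base) (hq : q ∈ N.base)
    (hq' : q' ∈ N.base) {w w' : TangentSpace 𝓘(ℝ, E) (D.ι p)} (hw : w ∈ N.fiber (D.ι p))
    (hw' : w' ∈ N.fiber (D.ι p)) (hwε : ‖w‖ < ε) (hwε' : ‖w'‖ < ε)
    (hT : T (D.graph h u q) = h ⟨D.ι p, w⟩) (hT' : T (D.graph h u q') = h ⟨D.ι p, w'⟩) :
    w = w' ∧ q = q' ∧ q ∈ D.Mbar := by
  obtain ⟨j, x, hx, rfl⟩ := N.exists_symm_eq hp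
  have hxJ := N.ball_subset_ball_J hx
  have hψ : ∀ w : TangentSpace 𝓘(ℝ, E) (D.ι ((N.σ j).symm x)), w ∈ N.fiber _ →
      N.e j _ (N.ψ j _ w) = w := fun w hw => N.e_ψ j x hxJ w (N.Q_eq_self_of_mem_fiber hw)
  have e1 : h ⟨D.ι ((N.σ j).symm x), w⟩ = N.tube h j (x, N.ψ j _ w) := by
    simp only [tube, hψ w hw]
  have e2 : h ⟨D.ι ((N.σ j).symm x), w'⟩ = N.tube h j (x, N.ψ j _ w') := by
    simp only [tube, hψ w' hw']
  have n1 : ‖N.ψ j ((N.σ j).symm x) w‖ < ε := by rw [← N.norm_e j x hxJ, hψ w hw]; exact hwε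
  have n2 : ‖N.ψ j ((N.σ j).symm x) w'‖ < ε := by rw [← N.norm_e j x hxJ, hψ w' hw']; exact hwε'
  rw [e1] at hT
  rw [e2] at hT'
  have hcx := hc j x (Metric.ball_subset_closedBall hx)
  obtain ⟨h1, h2⟩ := hcx.contraction hK hε hxJ hu hu le_rfl (by simp) hq hq' n1 n2 hT hT'
  rw [mul_zero] at h1
  have h3 := sub_eq_zero.1 (norm_le_zero_iff.1 h1)
  exact ⟨by rw [← hψ w hw, ← hψ w' hw', h3], h2 rfl, hcx.mem_Mbar hK hε hxJ hu hq n1 hT⟩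

lemma isFixedSection_iff (hK : GraphConstants θ R δ c)
    (hc : ∀ j, ∀ x ∈ Metric.closedBall (0 : P) ((N.J : ℝ) - 3), N.LocalControl hh T θ R c ε j x)
    (hε : 0 < ε) (hu : u ∈ N.LipSection ε δ) :
    N.IsFixedSection h ε T u ↔ N.IsGraphImage h ε T u u := by
  constructor
  · intro hf p hp
    refine ⟨(hu.1 p hp).1, (hu.1 p hp).2, ?_⟩
    have h1 : D.graph h u p ∈ D.graph h u '' N.base := ⟨p, hp, rfl⟩
    rw [← hf] at h1
    obtain ⟨⟨_, ⟨q, hq, rfl⟩, hT⟩, -⟩ := h1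
    exact ⟨q, hq, hT⟩
  · intro hi
    refine Subset.antisymm ?_ ?_
    · rintro _ ⟨⟨_, ⟨q, hq, rfl⟩, rfl⟩, _, ⟨p, hp, w, hw, hwε, rfl⟩, hT⟩
      obtain ⟨h1, h2, q', hq', hT'⟩ := hi p hp
      obtain ⟨rfl, -, -⟩ := eq_of_apply_graph_eq hK hc hε hu hp hq hq' hw h1 hwε h2 hT.symm hT'
      exact ⟨p, hp, hT⟩
    · rintro _ ⟨p, hp, rfl⟩
      obtain ⟨h1, h2, q, hq, hT⟩ := hi p hp
      exact ⟨⟨_, ⟨q, hq, rfl⟩, hT⟩, _, ⟨p, hp, u p, h1, h2, rfl⟩, rfl⟩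

lemma existsUnique_image_Mbar (hK : GraphConstants θ R δ c)
    (hc : ∀ j, ∀ x ∈ Metric.closedBall (0 : P) ((N.J : ℝ) - 3), N.LocalControl hh T θ R c ε j x)
    (hε : 0 < ε) (hu : u ∈ N.LipSection ε δ) (hi : N.IsGraphImage h ε T u u) {z : X}
    (hz : z ∈ D.graph h u '' D.Mbar) : ∃! w, w ∈ D.graph h u '' D.Mbar ∧ T w = z := by
  obtain ⟨p, hp, rfl⟩ := hz
  have hpb := N.Mbar_subset_base hp
  obtain ⟨h1, h2, q, hq, hT⟩ := hi p hpb
  obtain ⟨-, -, h3⟩ := eq_of_apply_graph_eq hK hc hε hu hpb hq hq h1 h1 h2 h2 hT hT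
  refine ⟨_, ⟨⟨q, h3, rfl⟩, hT⟩, ?_⟩
  rintro _ ⟨⟨q', hq', rfl⟩, hT'⟩
  obtain ⟨-, h4, -⟩ := eq_of_apply_graph_eq hK hc hε hu hpb hq (N.Mbar_subset_base hq') h1 h1 h2
    h2 hT hT'
  rw [h4]

/-- The invariant section is of class `C^1`, since the graph transform improves its defect of
differentiability by a definite factor. -/
lemma IsGraphImage.contDiffOn (hK : GraphConstants θ R δ c)
    (hc : ∀ j, ∀ x ∈ Metric.closedBall (0 : P) ((N.J : ℝ) - 3), N.LocalControl hh T θ R c ε j x)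
    (hε : 0 < ε) (hu : u ∈ N.LipSection ε δ) (hi : N.IsGraphImage h ε T u u) (i : Fin N.s) :
    ContDiffOn ℝ 1 (N.loc u i) (Metric.ball 0 ((N.J : ℝ) - 3)) := by
  set κ := (1 + θ) / 2 with hκ
  have hκ0 : 0 < κ := by have := hK.rate_pos; positivity
  have hκ1 : κ < 1 := by have := hK.rate_lt; rw [hκ]; linarith
  have hδ := hK.lip_pos
  have h1 : ∀ k : ℕ, ∀ i, ∀ x ∈ Metric.ball (0 : P) ((N.J : ℝ) - 3),
      DefectLE (N.loc u i) x (κ ^ k * δ) := by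
    intro k
    induction k with
    | zero =>
      intro i x hx
      refine ⟨0, ?_⟩
      have g2 := Metric.isOpen_ball.mem_nhds hx
      rw [nhds_prod_eq]
      filter_upwards [Eventually.prod_mk g2 g2] with z hz
      simpa using hu.2 i _ hz.1 _ hz.2
    | succ k ih =>
      intro i x hx
      have := ((hc i x (Metric.ball_subset_closedBall hx)).eventually_norm_sub_le hK hε hx hu
        hi).2 (κ ^ k * δ) (by positivity)
        (mul_le_of_le_one_left hδ.le (pow_le_one₀ hκ0.le hκ1.le)) ih
      rwa [← mul_assoc, ← pow_succ'] at this
  refine contDiffOn_one_of_hasStrictFDerivAt Metric.isOpen_ball fun x hx =>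
    DefectLE.exists_hasStrictFDerivAt fun η hη => ?_
  have h2 : Tendsto (fun k : ℕ => κ ^ k * δ) atTop (𝓝 0) := by
    simpa using (tendsto_pow_atTop_nhds_zero_of_lt_one hκ0.le hκ1).mul_const δ
  obtain ⟨k, hk⟩ := (h2.eventually (gt_mem_nhds hη)).exists
  obtain ⟨L, hL⟩ := h1 k i x hx
  exact ⟨L, hL.mono fun z hz => hz.trans (by gcongr)⟩

end NormalBundleCover

end InvariantSection

/-! ### The graph of the invariant section as an embedding -/

section Graph

open Filter

set_option linter.unusedSectionVars false

variable {E P F X M' : Type*}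
  [NormedAddCommGroup E] [InnerProductSpace ℝ E] [CompleteSpace E]
  [NormedAddCommGroup P] [InnerProductSpace ℝ P] [FiniteDimensional ℝ P]
  [NormedAddCommGroup F] [InnerProductSpace ℝ F] [CompleteSpace F]
  [EMetricSpace X] [ChartedSpace E X] [IsManifold 𝓘(ℝ, E) 1 X]
  [Bundle.RiemannianBundle (fun x : X => TangentSpace 𝓘(ℝ, E) x)]
  [IsContinuousRiemannianBundle E (fun x : X => TangentSpace 𝓘(ℝ, E) x)]
  [TopologicalSpace M'] [ChartedSpace P M'] [IsManifold 𝓘(ℝ, P) 1 M']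
  [Bundle.RiemannianBundle (fun p : M' => TangentSpace 𝓘(ℝ, P) p)]
  {n : WithTop ℕ∞} {D : NegInvariantManifold E P X M' n} {N : NormalBundleCover F D}
  {ρ : ℝ} {h : TangentBundle 𝓘(ℝ, E) X → X}

namespace NormalBundleCover

variable {δ ε : ℝ} {u : ∀ p : M', TangentSpace 𝓘(ℝ, E) (D.ι p)} {j : Fin N.s} {x : P}

/-- The base point of a point of `X`, in the tubular coordinates of index `j`. -/
noncomputable def tubeProj (hh : N.IsTubular ρ h) (j : Fin N.s) (y : X) : M' :=
  (N.σ j).symm ((N.tubeHomeo hh j).symm y).1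

lemma mem_prod_of_mem_lipSection (hερ : ε ≤ ρ) (hu : u ∈ N.LipSection ε δ) (j : Fin N.s)
    (hx : x ∈ Metric.ball (0 : P) ((N.J : ℝ) - 3)) :
    (x, N.loc u j x) ∈ Metric.ball (0 : P) N.J ×ˢ Metric.ball (0 : F) ρ :=
  ⟨N.ball_subset_ball_J hx, by simpa using (norm_loc_lt hu j hx).trans_le hερ⟩

lemma graph_mem_target (hh : N.IsTubular ρ h) (hερ : ε ≤ ρ) (hu : u ∈ N.LipSection ε δ)
    (hx : x ∈ Metric.ball (0 : P) ((N.J : ℝ) - 3)) :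
    D.graph h u ((N.σ j).symm x) ∈ (N.tubeHomeo hh j).target := by
  rw [graph_eq_tube_of_mem hu j hx]
  exact N.tube_mem_target hh j (mem_prod_of_mem_lipSection hερ hu j hx)

lemma tubeProj_graph (hh : N.IsTubular ρ h) (hερ : ε ≤ ρ) (hu : u ∈ N.LipSection ε δ) {q : M'}
    (hq : q ∈ N.base) (hqt : D.graph h u q ∈ (N.tubeHomeo hh j).target) :
    N.tubeProj hh j (D.graph h u q) = q := by
  obtain ⟨i, t, ht, rfl⟩ := N.exists_symm_eq hq
  have h1 := N.tube_tubeHomeo_symm hh j hqt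
  have h2 := N.tubeHomeo_symm_mem hh j hqt
  nth_rw 2 [graph_eq_tube_of_mem hu i ht] at h1
  have h3 := N.eq_of_tube_eq hh h2 (mem_prod_of_mem_lipSection hερ hu i ht) h1
  exact D.isEmbedding_ι.injective (congrArg Bundle.TotalSpace.proj h3)

lemma contMDiffAt_tubeProj (hh : N.IsTubular ρ h) (hερ : ε ≤ ρ) (hu : u ∈ N.LipSection ε δ)
    (hx : x ∈ Metric.ball (0 : P) ((N.J : ℝ) - 3)) :
    ContMDiffAt 𝓘(ℝ, E) 𝓘(ℝ, P) 1 (N.tubeProj hh j) (D.graph h u ((N.σ j).symm x)) := by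
  have hz := mem_prod_of_mem_lipSection hερ hu j hx
  have h1 := N.contMDiffAt_tubeHomeo_symm hh (graph_mem_target (j := j) hh hερ hu hx)
  have h2 : (N.tubeHomeo hh j).symm (D.graph h u ((N.σ j).symm x)) = (x, N.loc u j x) := by
    rw [graph_eq_tube_of_mem hu j hx, N.tubeHomeo_symm_tube hh j hz]
  have h3 : ContMDiffAt 𝓘(ℝ, P × F) 𝓘(ℝ, P) 1 (fun z : P × F => z.1)
      ((N.tubeHomeo hh j).symm (D.graph h u ((N.σ j).symm x))) :=
    contDiff_fst.contMDiff.contMDiffAt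
  have h4 := h3.comp _ h1
  have h5 : ContMDiffAt 𝓘(ℝ, P) 𝓘(ℝ, P) 1 (N.σ j).symm
      (((N.tubeHomeo hh j).symm (D.graph h u ((N.σ j).symm x))).1) := by
    rw [h2]
    exact N.contMDiffAt_σ_symm j (N.ball_subset_ball_J hx)
  exact ContMDiffAt.comp (g := (N.σ j).symm)
    (f := fun y => ((N.tubeHomeo hh j).symm y).1) _ h5 h4

lemma contMDiffAt_graph (hh : N.IsTubular ρ h) (hερ : ε ≤ ρ) (hu : u ∈ N.LipSection ε δ)
    (hloc : ∀ i, ContDiffOn ℝ 1 (N.loc u i) (Metric.ball 0 ((N.J : ℝ) - 3))) {p : M'}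
    (hp : p ∈ N.base) : ContMDiffAt 𝓘(ℝ, P) 𝓘(ℝ, E) 1 (D.graph h u) p := by
  obtain ⟨j, x, hx, rfl⟩ := N.exists_symm_eq hp
  have hxJ := N.ball_subset_ball_J hx
  have hxt := N.ball_subset j hxJ
  have hz := mem_prod_of_mem_lipSection hερ hu j hx
  have h1 : ContMDiffAt 𝓘(ℝ, P) 𝓘(ℝ, P) 1 (N.σ j) ((N.σ j).symm x) :=
    contMDiffAt_of_mem_maximalAtlas (N.σ_mem_one j) ((N.σ j).map_target hxt)
  have h2 : ContMDiffAt 𝓘(ℝ, P) 𝓘(ℝ, P × F) 1 (fun t => (t, N.loc u j t)) x :=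
    (contDiffAt_id.prodMk ((hloc j).contDiffAt (Metric.isOpen_ball.mem_nhds hx))).contMDiffAt
  have h3 : ContMDiffAt 𝓘(ℝ, P) 𝓘(ℝ, E) 1 (fun t => N.tube h j (t, N.loc u j t)) x :=
    ContMDiffAt.comp (g := N.tube h j) (f := fun t => (t, N.loc u j t)) x
      (N.contMDiffAt_tube hh j hz) h2
  have h4 : ContMDiffAt 𝓘(ℝ, P) 𝓘(ℝ, E) 1 (fun q => N.tube h j (N.σ j q, N.loc u j (N.σ j q)))
      ((N.σ j).symm x) := by
    refine ContMDiffAt.comp (f := N.σ j) (g := fun t => N.tube h j (t, N.loc u j t)) _ ?_ h1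
    rwa [(N.σ j).right_inv hxt]
  refine h4.congr_of_eventuallyEq ?_
  have h5 : N.U j ((N.J : ℝ) - 3) ∈ 𝓝 ((N.σ j).symm x) :=
    (N.isOpen_U j (by linarith)).mem_nhds ⟨x, hx, rfl⟩
  filter_upwards [h5]
  rintro _ ⟨t, ht, rfl⟩
  rw [graph_eq_tube_of_mem hu j ht, (N.σ j).right_inv (N.ball_subset j (N.ball_subset_ball_J ht))]

lemma injective_mfderiv_graph (hh : N.IsTubular ρ h) (hερ : ε ≤ ρ) (hu : u ∈ N.LipSection ε δ)
    (hloc : ∀ i, ContDiffOn ℝ 1 (N.loc u i) (Metric.ball 0 ((N.J : ℝ) - 3))) {p : M'}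
    (hp : p ∈ N.base) : Function.Injective (mfderiv 𝓘(ℝ, P) 𝓘(ℝ, E) (D.graph h u) p) := by
  have h1 := contMDiffAt_graph hh hερ hu hloc hp
  obtain ⟨j, x, hx, hxp⟩ := N.exists_symm_eq hp
  have h2 := contMDiffAt_tubeProj (j := j) hh hερ hu hx
  have h3 := graph_mem_target (j := j) hh hερ hu hx
  rw [hxp] at h2 h3
  have h4 : N.tubeProj hh j ∘ D.graph h u =ᶠ[𝓝 p] id := by
    filter_upwards [N.isOpen_base.mem_nhds hp,
      h1.continuousAt.eventually ((N.tubeHomeo hh j).open_target.mem_nhds h3)] with q hq hq'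
    exact tubeProj_graph hh hερ hu hq hq'
  have h5 := h4.mfderiv_eq (I := 𝓘(ℝ, P)) (I' := 𝓘(ℝ, P))
  rw [mfderiv_comp (I' := 𝓘(ℝ, E)) p (h2.mdifferentiableAt one_ne_zero)
    (h1.mdifferentiableAt one_ne_zero), mfderiv_id] at h5
  intro v w hvw
  have hv := DFunLike.congr_fun h5 v
  have hw := DFunLike.congr_fun h5 w
  simp only [ContinuousLinearMap.comp_apply] at hv hw
  rw [hvw, hw] at hv
  exact hv.symm

lemma isEmbedding_graph (hh : N.IsTubular ρ h) (hερ : ε ≤ ρ) (hu : u ∈ N.LipSection ε δ)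
    (hloc : ∀ i, ContDiffOn ℝ 1 (N.loc u i) (Metric.ball 0 ((N.J : ℝ) - 3))) :
    IsEmbedding (N.base.domRestrict (D.graph h u)) := by
  have hcont : Continuous (N.base.domRestrict (D.graph h u)) :=
    continuousOn_iff_continuous_domRestrict.1 fun p hp =>
      (contMDiffAt_graph hh hερ hu hloc hp).continuousAt.continuousWithinAt
  refine ⟨isInducing_iff_nhds.2 fun p => le_antisymm (hcont.tendsto p).le_comap ?_, ?_⟩
  · obtain ⟨p, hp⟩ := p
    obtain ⟨j, x, hx, rfl⟩ := N.exists_symm_eq hp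
    have h2 := (contMDiffAt_tubeProj (j := j) hh hερ hu hx).continuousAt
    have h3 := graph_mem_target (j := j) hh hερ hu hx
    have h4 := tubeProj_graph (j := j) hh hερ hu hp h3
    rw [ContinuousAt, h4] at h2
    rw [nhds_subtype, ← map_le_iff_le_comap]
    have h5 : Tendsto (N.base.domRestrict (D.graph h u))
        (comap (N.base.domRestrict (D.graph h u)) (𝓝 (D.graph h u ((N.σ j).symm x))))
        (𝓝 (D.graph h u ((N.σ j).symm x))) := tendsto_comap
    refine (h2.comp h5).congr' ?_
    filter_upwards [h5.eventually ((N.tubeHomeo hh j).open_target.mem_nhds h3)] with q hq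
    exact tubeProj_graph hh hερ hu q.2 hq
  · rintro ⟨p, hp⟩ ⟨q, hq⟩ hpq
    obtain ⟨j, x, hx, rfl⟩ := N.exists_symm_eq hp
    have hpq' : D.graph h u ((N.σ j).symm x) = D.graph h u q := hpq
    have h3 := graph_mem_target (j := j) hh hερ hu hx
    have h4 := tubeProj_graph (j := j) hh hερ hu hp h3
    rw [hpq'] at h3 h4
    exact Subtype.ext (h4.symm.trans (tubeProj_graph hh hερ hu hq h3))

end NormalBundleCover

end Graph

/-! ### The choice of the constants -/

section Constants

open Filter

set_option linter.unusedSectionVars false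

variable {E P F X M' : Type*}
  [NormedAddCommGroup E] [InnerProductSpace ℝ E] [CompleteSpace E]
  [NormedAddCommGroup P] [InnerProductSpace ℝ P] [FiniteDimensional ℝ P]
  [NormedAddCommGroup F] [InnerProductSpace ℝ F] [CompleteSpace F]
  [EMetricSpace X] [ChartedSpace E X] [IsManifold 𝓘(ℝ, E) 1 X]
  [Bundle.RiemannianBundle (fun x : X => TangentSpace 𝓘(ℝ, E) x)]
  [IsContinuousRiemannianBundle E (fun x : X => TangentSpace 𝓘(ℝ, E) x)]
  [TopologicalSpace M'] [ChartedSpace P M'] [IsManifold 𝓘(ℝ, P) 1 M']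
  [Bundle.RiemannianBundle (fun p : M' => TangentSpace 𝓘(ℝ, P) p)]
  {n : WithTop ℕ∞} {D : NegInvariantManifold E P X M' n} (N : NormalBundleCover F D)
  {ρ : ℝ} {h : TangentBundle 𝓘(ℝ, E) X → X}
  {a : ℕ} {χ : Fin a → OpenPartialHomeomorph X E} {V : Set X}

/-- The choice of the constants: first a bound for the Lipschitz constant of the sections, then the
accuracy of the linear approximations, then a bound for the size of the sections, and last the
neighbourhood of `S`. -/
lemma NormalBundleCover.exists_constants (hh : N.IsTubular ρ h) {C ϑ : ℝ} (hC : 1 ≤ C)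
    (hCN : N.ChartBound C) (hϑ : ϑ ∈ Ioo (0 : ℝ) 1) (hstab : N.Stability C ϑ)
    (hsmooth : N.Smoothing C ϑ) (hV : IsOpen V) (hVM : range D.ι ⊆ V)
    (hχ : ∀ b, χ b ∈ IsManifold.maximalAtlas 𝓘(ℝ, E) 1 X)
    (hχM : range D.ι ⊆ ⋃ b, (χ b).source) :
    ∃ R, ∃ δ₀ > 0, ∀ δ, 0 < δ → δ < δ₀ → ∃ c, GraphConstants ϑ R δ c ∧ ∃ ε₀ > 0, ε₀ ≤ ρ ∧
      ∀ ε, 0 < ε → ε < ε₀ → ∀ᶠ T in perturbations χ V D.S,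
        ∀ j, ∀ x ∈ Metric.closedBall (0 : P) ((N.J : ℝ) - 3), N.LocalControl hh T ϑ R c ε j x := by
  obtain ⟨R, hR, H⟩ := N.exists_controlled hh hC hCN hstab hsmooth hV hVM hχ hχM
  have hs : 0 < 1 - ϑ := sub_pos.2 hϑ.2
  have hR0 : 0 < 100 * R ^ 3 := by positivity
  refine ⟨R, (1 - ϑ) / (100 * R ^ 3), by positivity, fun δ hδ hδ₀ => ?_⟩
  refine ⟨δ * (1 - ϑ) / (100 * R ^ 3), ⟨hϑ.1, hϑ.2, hR, hδ, by positivity, ?_, ?_⟩, ?_⟩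
  · rw [lt_div_iff₀ hR0] at hδ₀
    linarith
  · rw [mul_div_cancel₀ _ hR0.ne']
  · obtain ⟨e, he, H'⟩ := H (δ * (1 - ϑ) / (100 * R ^ 3)) (by positivity)
    refine ⟨min e ρ, lt_min he hh.pos, min_le_right _ _, fun ε hε hεe => ?_⟩
    exact N.eventually_localControl hh hϑ.2 hR hV hVM H' hε (hεe.le.trans (min_le_left _ _))

end Constants

theorem theorem2p15
    {E P F X M' : Type*}
    [NormedAddCommGroup E] [InnerProductSpace ℝ E] [CompleteSpace E]
    [NormedAddCommGroup P] [InnerProductSpace ℝ P] [FiniteDimensional ℝ P]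
    [NormedAddCommGroup F] [InnerProductSpace ℝ F] [CompleteSpace F]
    (n : WithTop ℕ∞) (hn : 2 ≤ n)
    -- `X` is a Riemannian Hilbert manifold of class `C^(n+1)`
    [EMetricSpace X] [ChartedSpace E X] [IsManifold 𝓘(ℝ, E) (n + 1) X] [IsManifold 𝓘(ℝ, E) 1 X]
    [Bundle.RiemannianBundle (fun x : X => TangentSpace 𝓘(ℝ, E) x)]
    [IsContMDiffRiemannianBundle 𝓘(ℝ, E) n E (fun x : X => TangentSpace 𝓘(ℝ, E) x)]
    [IsRiemannianManifold 𝓘(ℝ, E) X]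
    -- `M'` is a connected manifold of class `C^(n+1)` modelled on `P`
    [TopologicalSpace M'] [ConnectedSpace M'] [ChartedSpace P M']
    [IsManifold 𝓘(ℝ, P) (n + 1) M'] [IsManifold 𝓘(ℝ, P) 1 M']
    [Bundle.RiemannianBundle (fun p : M' => TangentSpace 𝓘(ℝ, P) p)]
    (D : NegInvariantManifold E P X M' n) (N : NormalBundleCover F D)
    -- the tubular neighbourhood
    (ρ : ℝ) (h : TangentBundle 𝓘(ℝ, E) X → X) (hh : N.IsTubular ρ h)
    -- the stability and smoothing conditions
    (C ϑ : ℝ) (hC : 1 ≤ C) (hCN : N.ChartBound C) (hϑ : ϑ ∈ Ioo (0 : ℝ) 1)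
    (hstab : N.Stability C ϑ) (hsmooth : N.Smoothing C ϑ)
    -- the open set and the charts that enter the `C^1` distance of maps
    (V : Set X) (hV : IsOpen V) (hVM : range D.ι ⊆ V)
    (a : ℕ) (χ : Fin a → OpenPartialHomeomorph X E)
    (hχ : ∀ b, χ b ∈ IsManifold.maximalAtlas 𝓘(ℝ, E) (n + 1) X)
    (hχM : range D.ι ⊆ ⋃ b, (χ b).source) :
    ∃ δ₀ > 0, ∀ δ, 0 < δ → δ < δ₀ → ∃ ε₀ > 0, ∀ ε, 0 < ε → ε < ε₀ →
      (∃ ν₀ > 0, ∀ ν, 0 < ν → ν < ν₀ → ∀ T : X → X, ContMDiffOn 𝓘(ℝ, E) 𝓘(ℝ, E) 1 T V →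
        C1CloseOn χ V ν D.S T →
        ∃ u ∈ N.LipSection ε δ, N.IsFixedSection h ε T u ∧
          -- it is the only one
          (∀ u' ∈ N.LipSection ε δ, N.IsFixedSection h ε T u' → EqOn u' u N.base) ∧
          -- the section is of class `C^1`, and its graph is a `C^1` embedding
          (∀ i, ContDiffOn ℝ 1 (N.loc u i) (Metric.ball 0 ((N.J : ℝ) - 3))) ∧
          ContMDiffOn 𝓘(ℝ, P) 𝓘(ℝ, E) 1 (D.graph h u) N.base ∧
          (∀ p ∈ N.base, Function.Injective (mfderiv 𝓘(ℝ, P) 𝓘(ℝ, E) (D.graph h u) p)) ∧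
          IsEmbedding (N.base.domRestrict (D.graph h u)) ∧
          -- `T` has an inverse on the image of `Mbar`, which maps this image into itself
          (∀ z ∈ D.graph h u '' D.Mbar, ∃! w, w ∈ D.graph h u '' D.Mbar ∧ T w = z)) ∧
      -- convergence in `C^1` to the zero section, which represents the unperturbed manifold
      (∀ η > 0, ∃ ν₁ > 0, ∀ ν, 0 < ν → ν < ν₁ → ∀ T : X → X,
        ContMDiffOn 𝓘(ℝ, E) 𝓘(ℝ, E) 1 T V → C1CloseOn χ V ν D.S T →
        ∀ u ∈ N.LipSection ε δ, N.IsFixedSection h ε T u →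
          ∀ i, ∀ x ∈ Metric.ball (0 : P) ((N.J : ℝ) - 3),
            ‖N.loc u i x‖ ≤ η ∧ ‖fderiv ℝ (N.loc u i) x‖ ≤ η) := by
  have : IsContinuousRiemannianBundle E (fun x : X => TangentSpace 𝓘(ℝ, E) x) := by
    obtain ⟨g, hg, hg'⟩ := IsContMDiffRiemannianBundle.exists_contMDiff (IB := 𝓘(ℝ, E)) (n := n)
      (F := E) (E := fun x : X => TangentSpace 𝓘(ℝ, E) x)
    exact ⟨g, hg.continuous, hg'⟩
  have hχ' : ∀ b, χ b ∈ IsManifold.maximalAtlas 𝓘(ℝ, E) 1 X := fun b =>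
    IsManifold.maximalAtlas_subset_of_le (by simp) (hχ b)
  obtain ⟨R, δ₀, hδ₀, H⟩ := N.exists_constants hh hC hCN hϑ hstab hsmooth hV hVM hχ' hχM
  refine ⟨δ₀, hδ₀, fun δ hδ hδδ₀ => ?_⟩
  obtain ⟨c, hK, ε₀, hε₀, hε₀ρ, H1⟩ := H δ hδ hδδ₀
  refine ⟨ε₀, hε₀, fun ε hε hεε₀ => ⟨?_, fun η hη => ?_⟩⟩
  · obtain ⟨ν₀, hν₀, H2⟩ := eventually_perturbations_iff.1 (H1 ε hε hεε₀)
    refine ⟨ν₀, hν₀, fun ν hν hνν₀ T hT hST => ?_⟩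
    have hc := H2 T hT (hST.mono hνν₀.le)
    obtain ⟨u, hu, hi⟩ := NormalBundleCover.exists_isGraphImage_self hK hc hε
    have hερ : ε ≤ ρ := hεε₀.le.trans hε₀ρ
    have hloc := hi.contDiffOn hK hc hε hu
    refine ⟨u, hu, (NormalBundleCover.isFixedSection_iff hK hc hε hu).2 hi, ?_, hloc,
      fun p hp => (NormalBundleCover.contMDiffAt_graph hh hερ hu hloc hp).contMDiffWithinAt,
      fun p hp => NormalBundleCover.injective_mfderiv_graph hh hερ hu hloc hp,
      NormalBundleCover.isEmbedding_graph hh hερ hu hloc,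
      fun z hz => NormalBundleCover.existsUnique_image_Mbar hK hc hε hu hi hz⟩
    intro u' hu' hf'
    exact ((NormalBundleCover.isFixedSection_iff hK hc hε hu').1 hf').eqOn hK hc hε hu' hu hi
  · -- the invariant section is also the one for smaller `δ` and `ε`
    have hδ' : 0 < min δ η := lt_min hδ hη
    obtain ⟨c', hK', ε₀', hε₀', -, H1'⟩ := H (min δ η) hδ' ((min_le_left _ _).trans_lt hδδ₀)
    set ε' := min ε (min (ε₀' / 2) η) with hε'
    have hε'0 : 0 < ε' := lt_min hε (lt_min (half_pos hε₀') hη)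
    have hε'ε : ε' ≤ ε := min_le_left _ _
    have hε'η : ε' ≤ η := (min_le_right _ _).trans (min_le_right _ _)
    have hε'ε₀ : ε' < ε₀' :=
      ((min_le_right _ _).trans (min_le_left _ _)).trans_lt (half_lt_self hε₀')
    obtain ⟨ν₁, hν₁, H2⟩ := eventually_perturbations_iff.1
      ((H1 ε hε hεε₀).and (H1' ε' hε'0 hε'ε₀))
    refine ⟨ν₁, hν₁, fun ν hν hνν₁ T hT hST u hu hf i x hx => ?_⟩
    obtain ⟨hc, hc'⟩ := H2 T hT (hST.mono hνν₁.le)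
    obtain ⟨v, hv, hi⟩ := NormalBundleCover.exists_isGraphImage_self hK' hc' hε'0
    have hv' : v ∈ N.LipSection ε δ := ⟨fun p hp => ⟨(hv.1 p hp).1, (hv.1 p hp).2.trans_le hε'ε⟩,
      fun i x hx x' hx' => (hv.2 i x hx x' hx').trans (by gcongr; exact min_le_left _ _)⟩
    have hi' : N.IsGraphImage h ε T v v := fun p hp =>
      ⟨(hi p hp).1, (hi p hp).2.1.trans_le hε'ε, (hi p hp).2.2⟩
    have huv := ((NormalBundleCover.isFixedSection_iff hK hc hε hu).1 hf).eqOn hK hc hε hu hv' hi'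
    have hloc : ∀ t ∈ Metric.ball (0 : P) ((N.J : ℝ) - 3), N.loc u i t = N.loc v i t :=
      fun t ht => congrArg (N.ψ i ((N.σ i).symm t)) (huv (N.symm_mem_base i ht))
    constructor
    · rw [hloc x hx]
      exact (NormalBundleCover.norm_loc_lt hv i hx).le.trans hε'η
    · refine norm_fderiv_le_of_lip' ℝ hη.le ?_
      filter_upwards [Metric.isOpen_ball.mem_nhds hx] with t ht
      rw [hloc x hx, hloc t ht]
      exact (hv.2 i t ht x hx).trans (by gcongr; exact min_le_right _ _)
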